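/- **Setting.** All manifolds are finite-dimensional, without boundary, and all data are $C^\infty$. Let $Q$ be a manifold with a Riemannian metric $\kappa$, a potential $U\in C^\infty(Q)$, the Lagrangian $\mathcal L(v)=\tfrac12\kappa(v,v)+U$, and a subbundle $D\subset TQ$ (the constraints). Let a Lie group $G$ with Lie algebra $\mathfrak g$ act smoothly, freely and properly on $Q$, leaving $\mathcal L$ and $D$ invariant. Let $\iota:\mathcal M\hookrightarrow T^*Q$ be the embedded submanifold $\mathcal M=\kappa^\sharp(D)$, where $\kappa^\sharp(v)=\kappa(v,\cdot)$, with the restricted cotangent-lifted $G$-action $\varphi$, with $\tau:\mathcal M\to Q$ the restriction of the bundle projection, and with $\rho:\mathcal M\to\mathcal M/G$ the orbit projection. Put $\Theta_{\mathcal M}=\iota^*\Theta_Q$ (Liouville form) and $\Omega_{\mathcal M}=\iota^*\Omega_Q$, $\Omega_Q=-d\Theta_Q$; let $\mathcal C=\{v\in T\mathcal M: T\tau(v)\in D\}$, let $\xi_{\mathcal M}$ be the infinitesimal generator of $\xi\in\mathfrak g$, and let $\mathcal V_m=\{\xi_{\mathcal M}(m):\xi\in\mathfrak g\}$. Assume $T\mathcal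 M=\mathcal C+\mathcal V$ (the dimension assumption). For a bivector field $\pi$ write $\beta(\pi^\sharp\alpha)=\pi(\alpha,\beta)$ and, for a $k$-form $\phi$, $\pi^\sharp(\phi)(\alpha_1,\dots,\alpha_k)=(-1)^k\phi(\pi^\sharp\alpha_1,\dots,\pi^\sharp\alpha_k)$; the Schouten bracket is normalized by $\tfrac12[\pi,\pi](df,dg,dh)=\{f,\{g,h\}\}+\{g,\{h,f\}\}+\{h,\{f,g\}\}$, where $\{f,g\}=\pi(df,dg)$. The nonholonomic bivector $\pi_{\rm nh}$ is given by $\pi_{\rm nh}^\sharp(\alpha)=-X$, where $X\in\mathcal C$ is determined by $(i_X\Omega_{\mathcal M})|_{\mathcal C}=\alpha|_{\mathcal C}$. For a 2-form $B$ with $\mathrm{Id}+B^\flat\circ\pi_{\rm nh}^\sharp$ invertible (where $B^\flat(X)=i_XB$), $\pi_B$ is the bivector field with $\pi_B^\sharp=\pi_{\rm nh}^\sharp\circ(\mathrm{Id}+B^\flat\circ\pi_{\rm nh}^\sharp)^{-1}$. Let $\mathcal W\subset T\mathcal M$ be a $G$-invariant subbundle with $T\mathcal M=\mathcal C\oplus\mathcal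 W$ and $\mathcal W\subset\mathcal V$, with projections $P_{\mathcal C},P_{\mathcal W}$. Let $\mathcal A_{\mathcal W}$ be the $\mathfrak g$-valued 1-form with $\mathcal A_{\mathcal W}(v)=\xi\iff P_{\mathcal W}(v)=\xi_{\mathcal M}(m)$ for $v\in T_m\mathcal M$, let $\mathcal K_{\mathcal W}(X,Y)=d\mathcal A_{\mathcal W}(P_{\mathcal C}X,P_{\mathcal C}Y)$, let $\mathcal J:\mathcal M\to\mathfrak g^*$, $\langle\mathcal J,\xi\rangle=\Theta_{\mathcal M}(\xi_{\mathcal M})$, and let $$(d\mathcal J\wedge\mathcal K_{\mathcal W})(X,Y,Z)=\mathrm{cycl}\,\langle d\mathcal J(Z),\mathcal K_{\mathcal W}(X,Y)\rangle,\qquad \psi_{\pi_B}(\alpha,\beta,\gamma)=\mathrm{cycl}\,\gamma\big((\mathcal K_{\mathcal W}(\pi_B^\sharp\alpha,\pi_B^\sharp\beta))_{\mathcal M}\big).$$ **Theorem.** Assume the vertical-symmetry condition: there is a Lie subalgebra $\mathfrak g_{\mathcal W}\subseteq\mathfrak g$ such that $\mathcal W_m=\{\xi_{\mathcal M}(m):\xi\in\mathfrak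 g_{\mathcal W}\}$ for all $m\in\mathcal M$. Then $$(d\mathcal J\wedge\mathcal K_{\mathcal W})|_{\mathcal C}=(d\langle\mathcal J,\mathcal K_{\mathcal W}\rangle)|_{\mathcal C},$$ i.e. the two 3-forms agree on triples of vectors in $\mathcal C_m$, for every $m$. Moreover, let $B$ be a 2-form with $i_ZB=0$ for all $Z\in\mathcal W$ and with $\mathrm{Id}+B^\flat\circ\pi_{\rm nh}^\sharp$ invertible. Then: 1. $\tfrac12[\pi_B,\pi_B]=-\pi_B^\sharp\big(dB+d\langle\mathcal J,\mathcal K_{\mathcal W}\rangle\big)-\psi_{\pi_B}$. 2. If $B$ is $G$-invariant, then $\pi_B$ induces a bivector field $\pi^B_{\rm red}$ on $\mathcal M/G$ with $T\rho(\pi_B^\sharp(\rho^*\alpha))=(\pi^B_{\rm red})^\sharp(\alpha)$, and $\tfrac12[\pi^B_{\rm red},\pi^B_{\rm red}]=-\pi_B^\sharp\big(dB+d\langle\mathcal J,\mathcal K_{\mathcal W}\rangle\big)\circ\rho^*$. 3. If $B$ is $G$-invariant and $dB+d\langle\mathcal J,\mathcal K_{\mathcal W}\rangle$ is basic with respect to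 $\rho$ ($G$-invariant and annihilated by contraction with vectors in $\mathcal V$), then there is a 3-form $\phi$ on $\mathcal M/G$ with $\rho^*\phi=-(dB+d\langle\mathcal J,\mathcal K_{\mathcal W}\rangle)$, and $\pi^B_{\rm red}$ is $\phi$-twisted Poisson: $d\phi=0$ and $\tfrac12[\pi^B_{\rm red},\pi^B_{\rm red}]=(\pi^B_{\rm red})^\sharp(\phi)$. -/

import Mathlib

open scoped Manifold ContDiff Topology

noncomputable section

namespace Nonholonomic

/-! ### Differential forms and bivector fields on a manifold without boundary -/

section Calculus

variable {E : Type*} [NormedAddCommGroup E] [NormedSpace ℝ E]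
  {H : Type*} [TopologicalSpace H] (I : ModelWithCorners ℝ E H)
  {M : Type*} [TopologicalSpace M] [ChartedSpace H M]
  {E' : Type*} [NormedAddCommGroup E'] [NormedSpace ℝ E']
  {H' : Type*} [TopologicalSpace H'] (I' : ModelWithCorners ℝ E' H')
  {M' : Type*} [TopologicalSpace M'] [ChartedSpace H' M']
  {F : Type*} [NormedAddCommGroup F] [NormedSpace ℝ F]

instance instT2SpaceTangentSpace (x : M) : T2Space (TangentSpace I x) :=
  inferInstanceAs (T2Space E)

instance instFiniteDimensionalTangentSpace [FiniteDimensional ℝ E] (x : M) :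
    FiniteDimensional ℝ (TangentSpace I x) :=
  inferInstanceAs (FiniteDimensional ℝ E)

/-- Covectors at `x`. -/
abbrev Covector (x : M) : Type _ := TangentSpace I x →L[ℝ] ℝ

variable (M F) in
/-- (Not necessarily smooth) `F`-valued differential forms of degree `k` on `M`. -/
abbrev DForm (k : ℕ) : Type _ := (x : M) → TangentSpace I x [⋀^Fin k]→L[ℝ] F

variable {I}

/-- A family of linear functionals, seen as a form of degree one. -/
def oneForm (a : (x : M) → TangentSpace I x →L[ℝ] F) : DForm I M F 1 :=
  fun x => ContinuousAlternatingMap.ofSubsingleton ℝ (TangentSpace I x) F (0 : Fin 1) (a x)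

/-- The form `η` read in the chart around `x₀`, i.e. its pullback under the inverse chart. -/
def DForm.inChart {k : ℕ} (η : DForm I M F k) (x₀ : M) : E → E [⋀^Fin k]→L[ℝ] F :=
  fun y => (η ((extChartAt I x₀).symm y)).compContinuousLinearMap
    (mfderiv 𝓘(ℝ, E) I (extChartAt I x₀).symm y)

/-- A form is smooth if it is smooth in all charts. -/
def DForm.IsSmooth {k : ℕ} (η : DForm I M F k) : Prop :=
  ∀ x₀ : M, ContDiffOn ℝ ∞ (η.inChart x₀) (extChartAt I x₀).target

/-- The exterior derivative, computed in the chart around each point: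
`dη (X₀, …, X_k) = ∑ (-1)^i X_i (η (…, X_i omitted, …)) ± …` without combinatorial factor. -/
def DForm.d {k : ℕ} (η : DForm I M F k) : DForm I M F (k + 1) :=
  fun x => (extDeriv (η.inChart x) (extChartAt I x x)).compContinuousLinearMap
    (mfderiv I 𝓘(ℝ, E) (extChartAt I x) x)

variable (I) in
/-- The pullback `f^* η`. -/
def DForm.pullback {k : ℕ} (f : M → M') (η : DForm I' M' F k) : DForm I M F k :=
  fun x => (η (f x)).compContinuousLinearMap (mfderiv I I' f x)

section Flat

variable [FiniteDimensional ℝ E]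

/-- `η^♭ : TM → T^*M`, `X ↦ i_X η`, for a two-form `η`. -/
def DForm.flat (η : DForm I M ℝ 2) (x : M) : TangentSpace I x →L[ℝ] Covector I x :=
  have e₁ (X Y Y' : TangentSpace I x) : Function.update ![X, Y] 1 Y' = ![X, Y'] := by
    ext i; fin_cases i <;> rfl
  have e₀ (X Y X' : TangentSpace I x) : Function.update ![X, Y] 0 X' = ![X', Y] := by
    ext i; fin_cases i <;> rfl
  LinearMap.toContinuousLinearMap
    { toFun := fun X => LinearMap.toContinuousLinearMap
        { toFun := fun Y => η x ![X, Y]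
          map_add' := fun Y Y' => by
            have h := (η x).map_update_add ![X, 0] 1 Y Y'
            rwa [e₁, e₁, e₁] at h
          map_smul' := fun c Y => by
            have h := (η x).map_update_smul ![X, 0] 1 c Y
            rwa [e₁, e₁] at h }
      map_add' := fun X X' => by
        ext Y
        have h := (η x).map_update_add ![0, Y] 0 X X'
        rwa [e₀, e₀, e₀] at h
      map_smul' := fun c X => by
        ext Y
        have h := (η x).map_update_smul ![0, Y] 0 c X
        rwa [e₀, e₀] at h }

end Flat

variable (I M) in
/-- Families of linear maps `π^♯ : T_x^* M → T_x M`. -/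
abbrev SharpMap : Type _ := (x : M) → Covector I x →L[ℝ] TangentSpace I x

/-- `π^♯` read in the chart `φ` around `x₀`: at `y = φ(x)` it is `T_xφ ∘ π^♯_x ∘ (T_xφ)^*`. -/
def SharpMap.inChart (π : SharpMap I M) (x₀ : M) : E → (E →L[ℝ] ℝ) →L[ℝ] E :=
  fun y =>
    let x : M := (extChartAt I x₀).symm y
    let T : TangentSpace I x →L[ℝ] E := mfderiv I 𝓘(ℝ, E) (extChartAt I x₀) x
    T ∘L π x ∘L ContinuousLinearMap.precomp ℝ T

variable (I M) in
/-- A smooth bivector field `π`, given through `π^♯`, where `β (π^♯ α) = π (α, β)`. -/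
structure BivectorField where
  sharp : SharpMap I M
  skew : ∀ (x : M) (α β : Covector I x), β (sharp x α) = - α (sharp x β)
  smooth : ∀ x₀ : M, ContDiffOn ℝ ∞ (sharp.inChart x₀) (extChartAt I x₀).target

/-- One half of the cyclic summand of the Schouten bracket of two bivectors: the derivative of the
component `σ (β, γ)` along `π^♯ α`, in the chart around `x`, where `α, β, γ` are extended to
one-forms with constant coefficients. -/
def schoutenTerm (π σ : BivectorField I M) (x : M) (α β γ : Covector I x) : ℝ :=
  let T : E →L[ℝ] TangentSpace I x :=
    ContinuousLinearMap.inverse (mfderiv I 𝓘(ℝ, E) (extChartAt I x) x)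
  fderiv ℝ (fun y => (γ ∘L T) (σ.sharp.inChart x y (β ∘L T))) (extChartAt I x x)
    (π.sharp.inChart x (extChartAt I x x) (α ∘L T))

/-- The Schouten bracket `[π, σ]` of bivector fields, as a trivector field: in coordinates,
`[π, σ]^{ijk} = ∑_{cycl (i,j,k)} ∑_l (π^{il} ∂_l σ^{jk} + σ^{il} ∂_l π^{jk})`. The sign is such that
`½ [π, π] (df, dg, dh) = {f, {g, h}} + {g, {h, f}} + {h, {f, g}}` for `{f, g} = π (df, dg)`. -/
def schouten (π σ : BivectorField I M) (x : M) (α β γ : Covector I x) : ℝ :=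
  (schoutenTerm π σ x α β γ + schoutenTerm σ π x α β γ) +
  (schoutenTerm π σ x β γ α + schoutenTerm σ π x β γ α) +
  (schoutenTerm π σ x γ α β + schoutenTerm σ π x γ α β)

/-- `π^♯(φ) (α₁, …, α_k) = (-1)^k φ (π^♯ α₁, …, π^♯ α_k)` for a `k`-form `φ`. -/
def SharpMap.onForm {k : ℕ} (π : SharpMap I M) (φ : DForm I M ℝ k) (x : M)
    (α : Fin k → Covector I x) : ℝ :=
  (-1) ^ k * φ x (fun i => π x (α i))

/-- `π` is `φ`-twisted Poisson: `φ` is a closed (smooth) three-form and `½ [π, π] = π^♯(φ)`. -/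
def IsTwistedPoisson (π : BivectorField I M) (φ : DForm I M ℝ 3) : Prop :=
  φ.IsSmooth ∧ (∀ x, φ.d x = 0) ∧
    ∀ (x : M) (α β γ : Covector I x),
      (1 / 2 : ℝ) * schouten π π x α β γ = π.sharp.onForm φ x ![α, β, γ]

variable (I M) in
/-- A (not necessarily smooth) distribution on `M`. -/
abbrev Distribution : Type _ := (x : M) → Submodule ℝ (TangentSpace I x)

/-- A regular smooth distribution, i.e. a smooth subbundle (of constant rank) of `TM`: it has
smooth local frames. -/
def Distribution.IsRegular [IsManifold I ∞ M] (D : Distribution I M) : Prop :=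
  ∃ r : ℕ, ∀ x₀ : M, ∃ U : Set M, IsOpen U ∧ x₀ ∈ U ∧
    ∃ X : Fin r → (x : M) → TangentSpace I x,
      (∀ i, ContMDiffOn I I.tangent ∞ (fun x => (⟨x, X i x⟩ : TangentBundle I M)) U) ∧
      ∀ x ∈ U, LinearIndependent ℝ (fun i => X i x) ∧
        Submodule.span ℝ (Set.range fun i => X i x) = D x

section Linear

variable [FiniteDimensional ℝ E]

/-- The projection `TM → C` along `W`, when `TM = C ⊕ W` (and `0` otherwise). -/
def proj (C W : Distribution I M) (x : M) : TangentSpace I x →L[ℝ] TangentSpace I x :=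
  open Classical in
  if h : IsCompl (C x) (W x) then LinearMap.toContinuousLinearMap ((C x).projection (W x) h)
  else 0

/-- The map `C → C^*`, `X ↦ (i_X Ω)|_C`. -/
def restrictFlat (C : Distribution I M) (Ω : DForm I M ℝ 2) (x : M) :
    (C x) →L[ℝ] ((C x) →L[ℝ] ℝ) :=
  ContinuousLinearMap.precomp ℝ (C x).subtypeL ∘L Ω.flat x ∘L (C x).subtypeL

/-- The bivector associated with a distribution `C` and a two-form `Ω` that is nondegenerate
on `C`: `π^♯ α = -X`, where `X ∈ C` is determined by `(i_X Ω)|_C = α|_C`. -/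
def bivectorOf (C : Distribution I M) (Ω : DForm I M ℝ 2) : SharpMap I M :=
  fun x => -((C x).subtypeL ∘L (restrictFlat C Ω x).inverse ∘L
    ContinuousLinearMap.precomp ℝ (C x).subtypeL)

/-- The endomorphism `Id + B^♭ ∘ π^♯` of `T^*M`. -/
def gaugeEndo (π : SharpMap I M) (B : DForm I M ℝ 2) (x : M) : Covector I x →L[ℝ] Covector I x :=
  ContinuousLinearMap.id ℝ (Covector I x) + B.flat x ∘L π x

/-- The gauge transformation of `π` by `B`: `π_B^♯ = π^♯ ∘ (Id + B^♭ ∘ π^♯)⁻¹`. -/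
def gauge (π : SharpMap I M) (B : DForm I M ℝ 2) : SharpMap I M :=
  fun x => π x ∘L (gaugeEndo π B x).inverse

end Linear

end Calculus

/-! ### Actions of Lie groups -/

/-- A smooth Lie group is regular enough for Mathlib's Lie algebra structure on its tangent space
at the identity. -/
instance instLEInftyMinSmoothness : ENat.LEInfty (minSmoothness ℝ 3) :=
  ⟨by rw [minSmoothness_of_isRCLikeNormedField]; exact ENat.LEInfty.out⟩

section Action

variable {EG : Type*} [NormedAddCommGroup EG] [NormedSpace ℝ EG]
  {HG : Type*} [TopologicalSpace HG] (IG : ModelWithCorners ℝ EG HG)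
  (G : Type*) [TopologicalSpace G] [ChartedSpace HG G] [Group G]
  {E : Type*} [NormedAddCommGroup E] [NormedSpace ℝ E]
  {H : Type*} [TopologicalSpace H] (I : ModelWithCorners ℝ E H)
  {M : Type*} [TopologicalSpace M] [ChartedSpace H M] [MulAction G M]

/-- The infinitesimal generator `ξ ↦ ξ_M(m)`, the derivative at `1` of `g ↦ g • m`. The Lie algebra
of `G` is the tangent space at `1`, whose underlying normed space is `EG`. -/
def infGen (m : M) : EG →L[ℝ] TangentSpace I m :=
  mfderiv IG I (fun g : G => g • m) 1

/-- The tangent spaces to the orbits. -/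
def verticalSpace : Distribution I M := fun m => LinearMap.range (infGen IG G I m).toLinearMap

variable {I}

/-- Invariance of a form: `φ_g^* η = η` for all `g`. -/
def DForm.IsInvariant {k : ℕ} (η : DForm I M ℝ k) : Prop :=
  ∀ g : G, DForm.pullback I I (fun m : M => g • m) η = η

/-- A form is basic for the orbit projection if it is invariant and is annihilated by contraction
with vectors tangent to the orbits. -/
def DForm.IsBasic {k : ℕ} (η : DForm I M ℝ (k + 1)) : Prop :=
  DForm.IsInvariant G η ∧
    ∀ (m : M), ∀ X ∈ verticalSpace IG G I m, ∀ Y : Fin k → TangentSpace I m,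
      η m (Matrix.vecCons X Y) = 0

/-- Invariance of a distribution: `Tφ_g (D_m) = D_{g m}`. -/
def Distribution.IsInvariant (D : Distribution I M) : Prop :=
  ∀ (g : G) (m : M),
    (D m).map (mfderiv I I (fun m : M => g • m) m).toLinearMap = D (g • m)

/-- `W` is an invariant vertical complement of `C`: an invariant regular distribution with
`TM = C ⊕ W` and `W` tangent to the orbits. -/
structure IsInvariantVerticalComplement [IsManifold I ∞ M] (C W : Distribution I M) : Prop where
  regular : W.IsRegular
  invariant : W.IsInvariant G
  isCompl : ∀ m, IsCompl (C m) (W m)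
  vertical : ∀ m, W m ≤ verticalSpace IG G I m

variable [FiniteDimensional ℝ E]

/-- The Lie algebra valued one-form `A_W`: for a free action and `W` tangent to the orbits,
`A_W(v)` is the unique `ξ` with `ξ_M(m) = P_W(v)`. -/
def connectionForm (C W : Distribution I M) : DForm I M EG 1 :=
  oneForm fun m => LinearMap.toContinuousLinearMap
    ((infGen IG G I m).toLinearMap.leftInverse ∘ₗ (proj W C m).toLinearMap)

/-- The `W`-curvature `K_W(X, Y) = dA_W (P_C X, P_C Y)`. -/
def curvature (C W : Distribution I M) : DForm I M EG 2 :=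
  fun m => ((connectionForm IG G C W).d m).compContinuousLinearMap (proj C W m)

/-- The trivector `ψ_π (α, β, γ) = cycl [ γ ((K_W (π^♯ α, π^♯ β))_M) ]`. -/
def psi (C W : Distribution I M) (π : SharpMap I M) (m : M) (α β γ : Covector I m) : ℝ :=
  γ (infGen IG G I m (curvature IG G C W m ![π m α, π m β])) +
  α (infGen IG G I m (curvature IG G C W m ![π m β, π m γ])) +
  β (infGen IG G I m (curvature IG G C W m ![π m γ, π m α]))

/-- The two-form `⟨J, K⟩` for `J : M → 𝔤^*` and a `𝔤`-valued two-form `K`. -/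
def pairing (J : M → (EG →L[ℝ] ℝ)) (K : DForm I M EG 2) : DForm I M ℝ 2 :=
  fun m => (J m).compContinuousAlternatingMap (K m)

/-- `(dJ ∧ K) (X, Y, Z) = cycl ⟨dJ(Z), K(X, Y)⟩`. -/
def dWedge (J : M → (EG →L[ℝ] ℝ)) (K : DForm I M EG 2) (m : M) (X Y Z : TangentSpace I m) : ℝ :=
  let dJ : TangentSpace I m →L[ℝ] (EG →L[ℝ] ℝ) := mfderiv I 𝓘(ℝ, EG →L[ℝ] ℝ) J m
  dJ Z (K m ![X, Y]) + dJ X (K m ![Y, Z]) + dJ Y (K m ![Z, X])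

end Action

/-! ### The cotangent bundle and nonholonomic systems -/

section Mechanics

variable {E : Type*} [NormedAddCommGroup E] [NormedSpace ℝ E]
  {H : Type*} [TopologicalSpace H] (I : ModelWithCorners ℝ E H)
  (Q : Type*) [TopologicalSpace Q] [ChartedSpace H Q] [IsManifold I ∞ Q]

/-- The total space of the cotangent bundle `T^*Q`. -/
abbrev CotangentBundle : Type _ :=
  Bundle.TotalSpace (E →L[ℝ] ℝ) (fun q : Q => TangentSpace I q →L[ℝ] ℝ)

/-- The model with corners of `T^*Q`. -/
abbrev cotangentModel : ModelWithCorners ℝ (E × (E →L[ℝ] ℝ)) (ModelProd H (E →L[ℝ] ℝ)) :=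
  I.prod 𝓘(ℝ, E →L[ℝ] ℝ)

/-- The Liouville one-form: `Θ_p (v) = p (Tτ_Q v)`. -/
def liouvilleForm : DForm (cotangentModel I) (CotangentBundle I Q) ℝ 1 :=
  oneForm fun p => p.2 ∘L
    mfderiv (cotangentModel I) I (Bundle.TotalSpace.proj : CotangentBundle I Q → Q) p

/-- The canonical symplectic form `Ω_Q = -dΘ_Q`. -/
def canonicalForm : DForm (cotangentModel I) (CotangentBundle I Q) ℝ 2 :=
  fun p => -(liouvilleForm I Q).d p

variable {I Q}

/-- The cotangent lift of an action: `g · p = p ∘ (T φ_g)⁻¹`, a covector at `g • q`. -/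
def cotangentLift {G : Type*} [Group G] [MulAction G Q] (g : G) (p : CotangentBundle I Q) :
    CotangentBundle I Q :=
  ⟨g • p.1, p.2 ∘L (mfderiv I I (fun q : Q => g • q) p.1).inverse⟩

/-- The Lagrangian: kinetic energy of the metric `κ` plus the potential term `U`. -/
def lagrangian (κ : Bundle.ContMDiffRiemannianMetric I ∞ E (TangentSpace I : Q → Type _))
    (U : Q → ℝ) (v : TangentBundle I Q) : ℝ :=
  (1 / 2 : ℝ) * κ.inner v.1 v.2 v.2 + U v.1

/-- The constraint set `Leg(D) ⊆ T^*Q`, where the Legendre transform is `v ↦ κ(v, ·)`. -/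
def constraintSet (κ : Bundle.ContMDiffRiemannianMetric I ∞ E (TangentSpace I : Q → Type _))
    (D : Distribution I Q) : Set (CotangentBundle I Q) :=
  {p | ∃ v ∈ D p.1, p.2 = κ.inner p.1 v}

variable {E' : Type*} [NormedAddCommGroup E'] [NormedSpace ℝ E']
  {H' : Type*} [TopologicalSpace H'] (I' : ModelWithCorners ℝ E' H')
  {M : Type*} [TopologicalSpace M] [ChartedSpace H' M]

/-- The distribution `C = {v ∈ TM | Tτ v ∈ D}` on the constraint manifold `ι : M → T^*Q`,
where `τ = τ_Q ∘ ι`. -/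
def constraintDistribution (D : Distribution I Q) (ι : M → CotangentBundle I Q) :
    Distribution I' M :=
  fun m => (D (ι m).1).comap (mfderiv I' I (fun m : M => (ι m).1) m).toLinearMap

/-- `Ω_M = ι^* Ω_Q`. -/
def omegaM (ι : M → CotangentBundle I Q) : DForm I' M ℝ 2 :=
  DForm.pullback I' (cotangentModel I) ι (canonicalForm I Q)

/-- `Θ_M = ι^* Θ_Q`. -/
def thetaM (ι : M → CotangentBundle I Q) : DForm I' M ℝ 1 :=
  DForm.pullback I' (cotangentModel I) ι (liouvilleForm I Q)

/-- The nonholonomic bivector `π_nh` on the constraint manifold, associated with `C` and `Ω_M`. -/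
def nonholonomicSharp [FiniteDimensional ℝ E'] (D : Distribution I Q)
    (ι : M → CotangentBundle I Q) : SharpMap I' M :=
  bivectorOf (constraintDistribution I' D ι) (omegaM I' ι)

/-- The momentum map `J : M → 𝔤^*`, `⟨J(m), η⟩ = Θ_M (η_M (m))`. -/
def momentum {EG : Type*} [NormedAddCommGroup EG] [NormedSpace ℝ EG]
    {HG : Type*} [TopologicalSpace HG] (IG : ModelWithCorners ℝ EG HG)
    (G : Type*) [TopologicalSpace G] [ChartedSpace HG G] [Group G] [MulAction G M]
    (ι : M → CotangentBundle I Q) (m : M) : EG →L[ℝ] ℝ :=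
  (ContinuousAlternatingMap.ofSubsingleton ℝ (TangentSpace I' m) ℝ (0 : Fin 1)).symm
    (thetaM I' ι m) ∘L infGen IG G I' m

end Mechanics

end Nonholonomic

end

noncomputable section

set_option linter.unusedSectionVars false

namespace Nonholonomic

/-! ### Calculus of differential forms on manifolds -/

section Charts

variable {E : Type*} [NormedAddCommGroup E] [NormedSpace ℝ E]
  {H : Type*} [TopologicalSpace H] {I : ModelWithCorners ℝ E H} [I.Boundaryless]
  {M : Type*} [TopologicalSpace M] [ChartedSpace H M] [IsManifold I ∞ M]
  {E' : Type*} [NormedAddCommGroup E'] [NormedSpace ℝ E']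
  {H' : Type*} [TopologicalSpace H'] {I' : ModelWithCorners ℝ E' H'} [I'.Boundaryless]
  {M' : Type*} [TopologicalSpace M'] [ChartedSpace H' M'] [IsManifold I' ∞ M']
  {F : Type*} [NormedAddCommGroup F] [NormedSpace ℝ F]

/-! Write `C`, `W`, `A`, `K`, `J` for the constraint distribution, its vertical complement, the
connection form, its curvature and the momentum map, and let `Θ`, `Ω = -dΘ` be the restricted
canonical forms. `Ω` is nondegenerate on `C` (`omegaM_nondegenerate`, by positivity of the metric),
and gauging by `B` replaces `Ω` by `Ω - B` on `C`. As `B` annihilates `W`, the form `ζ = Ω(P_C ·,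
P_C ·) - B` annihilates `W` too, and `π_B` is characterized by taking values in `C` and by `ζ(π_B^♯
α, v) = -α(P_C v)`. This is `SharpMap.Inverts`, and every property of `π_B` is derived from it.

Differentiating that identity in a chart (`cyclic_fderiv_bivector`) gives `½[π_B, π_B] = -dζ(π_B^♯
·, π_B^♯ ·, π_B^♯ ·) - ψ`. The term `ψ` measures the non-integrability of `C = ker A`: derivatives
of `π_B` leave `C`, and their vertical part is governed by `dA`. It remains to find `dζ`.

The tool is an infinitesimal Cartan formula, `d_apply_infGen_eq_zero`: `dη(ξ_M, Y) = 0` when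
`η(ξ_M)` is constant and `η` is constant on the translates of `Y`. Vertical symmetry provides this
constancy, since `A(ξ_M) = ξ` for the fixed elements `ξ` of `𝔤_W`. Applied to `A`, it shows that
`dA` has no mixed `C`-`W` part, so `K = dA - dA(P_W ·, P_W ·)`. The last term is quadratic in `P_W`,
which vanishes on `C`; hence `dK` vanishes on `C` (`d_curvature_apply`), and the Leibniz rule `d⟨J,
K⟩ = dJ ∧ K + ⟨J, dK⟩` gives the first assertion. Applied to `η = Θ ∘ P_C`, which is invariant and
annihilates `W`, it shows that `dη` is horizontal. On `C` one has `dη = dΘ - ⟨J, dA⟩` because `η = Θ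
- ⟨J, A⟩`. Therefore `Ω(P_C ·, P_C ·) = -dη - ⟨J, K⟩`, and `dζ = -dB - d⟨J, K⟩`.

For the reduction, `ζ` is invariant along with `B`, so `π_B` is invariant and descends. The
Jacobiator is natural under related maps (`half_schouten_related`), and `ψ` vanishes on covectors
pulled back from the quotient because they annihilate generators. Basic forms descend because the
kernel of `Tρ` is the vertical space (`ker_mfderiv_eq_verticalSpace`), which is a dimension count: a
fibre of `ρ` is a smooth image of `G`. -/

theorem two_le_infty' : minSmoothness ℝ 2 ≤ ∞ := by
  rw [minSmoothness_of_isRCLikeNormedField]; exact ENat.LEInfty.out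

theorem contMDiffAt_extChartAt_symm {x₀ : M} {y : E} (hy : y ∈ (extChartAt I x₀).target) :
    ContMDiffAt 𝓘(ℝ, E) I ∞ (extChartAt I x₀).symm y :=
  (contMDiffOn_extChartAt_symm x₀).contMDiffAt (extChartAt_target_mem_nhds' hy)

theorem mdifferentiableAt_extChartAt_symm {x₀ : M} {y : E} (hy : y ∈ (extChartAt I x₀).target) :
    MDifferentiableAt 𝓘(ℝ, E) I (extChartAt I x₀).symm y :=
  (contMDiffAt_extChartAt_symm hy).mdifferentiableAt (by simp)

theorem mdifferentiableAt_extChartAt' {x₀ x : M} (hx : x ∈ (extChartAt I x₀).source) :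
    MDifferentiableAt I 𝓘(ℝ, E) (extChartAt I x₀) x :=
  mdifferentiableAt_extChartAt (by simpa using hx)

theorem mfderiv_symm_comp_mfderiv {x₀ : M} {y : E} (hy : y ∈ (extChartAt I x₀).target) :
    (mfderiv 𝓘(ℝ, E) I (extChartAt I x₀).symm y) ∘L
      (mfderiv I 𝓘(ℝ, E) (extChartAt I x₀) ((extChartAt I x₀).symm y)) =
      ContinuousLinearMap.id ℝ _ := by
  have h := mfderivWithin_extChartAt_symm_comp_mfderiv_extChartAt (I := I) hy
  rwa [I.range_eq_univ, mfderivWithin_univ] at h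

theorem mfderiv_comp_mfderiv_symm {x₀ : M} {y : E} (hy : y ∈ (extChartAt I x₀).target) :
    (mfderiv I 𝓘(ℝ, E) (extChartAt I x₀) ((extChartAt I x₀).symm y)) ∘L
      (mfderiv 𝓘(ℝ, E) I (extChartAt I x₀).symm y) = ContinuousLinearMap.id ℝ _ := by
  have h := mfderiv_extChartAt_comp_mfderivWithin_extChartAt_symm (I := I) hy
  rwa [I.range_eq_univ, mfderivWithin_univ] at h

theorem mfderiv_symm_comp_mfderiv' {x₀ x : M} (hx : x ∈ (extChartAt I x₀).source) :
    (mfderiv 𝓘(ℝ, E) I (extChartAt I x₀).symm (extChartAt I x₀ x)) ∘L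
      (mfderiv I 𝓘(ℝ, E) (extChartAt I x₀) x) = ContinuousLinearMap.id ℝ _ := by
  have h := mfderivWithin_extChartAt_symm_comp_mfderiv_extChartAt' (I := I) hx
  rwa [I.range_eq_univ, mfderivWithin_univ] at h

theorem mfderiv_symm_self (x : M) :
    mfderiv 𝓘(ℝ, E) I (extChartAt I x).symm (extChartAt I x x) = ContinuousLinearMap.id ℝ E := by
  have h := mfderivWithin_range_extChartAt_symm (I := I) (x := x)
  rwa [I.range_eq_univ, mfderivWithin_univ] at h

variable (I I') in
/-- A map between manifolds, written in the charts around `x₀` and `x₁`. -/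
def inCharts (x₀ : M) (x₁ : M') (f : M → M') : E → E' :=
  extChartAt I' x₁ ∘ f ∘ (extChartAt I x₀).symm

variable (I I') in
/-- The derivative of a map between manifolds, written in the charts around `x₀` and `x₁`. -/
def derivInCharts (x₀ : M) (x₁ : M') (f : M → M') (y : E) : E →L[ℝ] E' :=
  (mfderiv I' 𝓘(ℝ, E') (extChartAt I' x₁) (f ((extChartAt I x₀).symm y))) ∘L
    (mfderiv I I' f ((extChartAt I x₀).symm y)) ∘L
    (mfderiv 𝓘(ℝ, E) I (extChartAt I x₀).symm y)

theorem hasFDerivAt_inCharts {x₀ : M} {x₁ : M'} {f : M → M'} {y : E}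
    (hy : y ∈ (extChartAt I x₀).target)
    (hf : MDifferentiableAt I I' f ((extChartAt I x₀).symm y))
    (h₁ : f ((extChartAt I x₀).symm y) ∈ (extChartAt I' x₁).source) :
    HasFDerivAt (inCharts I I' x₀ x₁ f) (derivInCharts I I' x₀ x₁ f y) y := by
  have h := (mdifferentiableAt_extChartAt' h₁).hasMFDerivAt.comp y
    (hf.hasMFDerivAt.comp y (mdifferentiableAt_extChartAt_symm hy).hasMFDerivAt)
  exact h.hasFDerivAt

theorem contDiffAt_inCharts {x₀ : M} {x₁ : M'} {f : M → M'} {y : E}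
    (hy : y ∈ (extChartAt I x₀).target)
    (hf : ContMDiffAt I I' ∞ f ((extChartAt I x₀).symm y))
    (h₁ : f ((extChartAt I x₀).symm y) ∈ (extChartAt I' x₁).source) :
    ContDiffAt ℝ ∞ (inCharts I I' x₀ x₁ f) y := by
  have h₂ : ContMDiffAt I' 𝓘(ℝ, E') ∞ (extChartAt I' x₁) (f ((extChartAt I x₀).symm y)) :=
    contMDiffAt_extChartAt' (by simpa using h₁)
  exact (h₂.comp y (hf.comp y (contMDiffAt_extChartAt_symm hy))).contDiffAt

theorem eventually_mem_target {x₀ : M} {y : E} (hy : y ∈ (extChartAt I x₀).target) :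
    ∀ᶠ z in 𝓝 y, z ∈ (extChartAt I x₀).target :=
  extChartAt_target_mem_nhds' hy

theorem eventually_mem_source {x₀ : M} {x₁ : M'} {f : M → M'} {y : E}
    (hy : y ∈ (extChartAt I x₀).target)
    (hf : ContinuousAt f ((extChartAt I x₀).symm y))
    (h₁ : f ((extChartAt I x₀).symm y) ∈ (extChartAt I' x₁).source) :
    ∀ᶠ z in 𝓝 y, f ((extChartAt I x₀).symm z) ∈ (extChartAt I' x₁).source := by
  have h₂ : ContinuousAt (f ∘ (extChartAt I x₀).symm) y :=
    hf.comp (contMDiffAt_extChartAt_symm hy).continuousAt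
  exact h₂.eventually_mem ((isOpen_extChartAt_source x₁).mem_nhds h₁)

theorem ContMDiffAt.eventually_inChart {x₀ : M} {f : M → M'} {y : E}
    (hy : y ∈ (extChartAt I x₀).target)
    (hf : ContMDiffAt I I' ∞ f ((extChartAt I x₀).symm y)) :
    ∀ᶠ z in 𝓝 y, MDifferentiableAt I I' f ((extChartAt I x₀).symm z) := by
  have h : ContMDiffAt I I' 1 f ((extChartAt I x₀).symm y) := hf.of_le (by simp)
  have h₁ := (contMDiffAt_iff_contMDiffAt_nhds (by simp)).1 h
  filter_upwards [(contMDiffAt_extChartAt_symm hy).continuousAt.eventually h₁] with z hz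
  exact hz.mdifferentiableAt (by simp)

/-- A form is smooth at a point if it is smooth there in the chart around this point. -/
def DForm.SmoothAt {k : ℕ} (η : DForm I M F k) (x : M) : Prop :=
  ContDiffAt ℝ ∞ (η.inChart x) (extChartAt I x x)

theorem DForm.inChart_pullback {k : ℕ} (η : DForm I' M' F k) {x₀ : M} {x₁ : M'} {f : M → M'} {y : E}
    (hy : y ∈ (extChartAt I x₀).target)
    (hf : MDifferentiableAt I I' f ((extChartAt I x₀).symm y))
    (h₁ : f ((extChartAt I x₀).symm y) ∈ (extChartAt I' x₁).source) :
    (DForm.pullback I I' f η).inChart x₀ y =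
      (η.inChart x₁ (inCharts I I' x₀ x₁ f y)).compContinuousLinearMap
        (fderiv ℝ (inCharts I I' x₀ x₁ f) y) := by
  rw [(hasFDerivAt_inCharts hy hf h₁).fderiv]
  have h₃ := mfderiv_symm_comp_mfderiv' (I := I') h₁
  ext v
  change η _ _ = η _ _
  have h₄ : (extChartAt I' x₁).symm (extChartAt I' x₁ (f ((extChartAt I x₀).symm y))) =
    f ((extChartAt I x₀).symm y) := (extChartAt I' x₁).left_inv h₁
  -- The two base points are equal only propositionally, so their tangent spaces are different
  -- types. Quantifying over a point `z` equal to the given one and substituting moves the statement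
  -- across; the same device recurs under the name `key` below.
  have key : ∀ (z : M') (hz : z = f ((extChartAt I x₀).symm y))
      (v : Fin k → TangentSpace I' z), η z v = η (f ((extChartAt I x₀).symm y)) v := by
    rintro z rfl v; rfl
  refine Eq.trans ?_ (key _ h₄ _).symm
  refine congrArg _ (funext fun i => ?_)
  exact (DFunLike.congr_fun h₃ _).symm

theorem DForm.pullback_id {k : ℕ} (η : DForm I M F k) : DForm.pullback I I id η = η := by
  funext x
  ext v
  simp [DForm.pullback]

theorem DForm.inChart_change {k : ℕ} (η : DForm I M F k) {x₀ x₁ : M} {y : E}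
    (hy : y ∈ (extChartAt I x₀).target)
    (h₁ : (extChartAt I x₀).symm y ∈ (extChartAt I x₁).source) :
    η.inChart x₀ y =
      (η.inChart x₁ (inCharts I I x₀ x₁ id y)).compContinuousLinearMap
        (fderiv ℝ (inCharts I I x₀ x₁ id) y) := by
  have h := DForm.inChart_pullback (I := I) (I' := I) η (x₁ := x₁) (f := id) hy mdifferentiableAt_id h₁
  rwa [DForm.pullback_id] at h

/-- The alternatization of continuous multilinear maps, as a continuous linear map. -/
def alternatizationCLM (k : ℕ) : ContinuousMultilinearMap ℝ (fun _ : Fin k => E) F →L[ℝ] E [⋀^Fin k]→L[ℝ] F :=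
  LinearMap.mkContinuous
    { toFun := ContinuousMultilinearMap.alternatization
      map_add' := map_add _
      map_smul' := fun c f => by
        ext v
        simp [ContinuousMultilinearMap.alternatization_apply_apply, Finset.smul_sum, smul_comm c] }
    (Nat.factorial k) (fun f => by
      refine ContinuousAlternatingMap.opNorm_le_bound _ (by positivity) fun v => ?_
      simp only [LinearMap.coe_mk, AddHom.coe_mk,
        ContinuousMultilinearMap.alternatization_apply_apply]
      refine (norm_sum_le _ _).trans ?_
      have h (σ : Equiv.Perm (Fin k)) : ‖Equiv.Perm.sign σ • f (v ∘ σ)‖ ≤ ‖f‖ * ∏ i, ‖v i‖ := by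
        rw [Units.smul_def, ← Equiv.prod_comp σ fun i => ‖v i‖]
        rcases Int.units_eq_one_or (Equiv.Perm.sign σ) with h | h <;> rw [h] <;>
          simpa using f.le_opNorm (v ∘ σ)
      refine (Finset.sum_le_sum fun σ _ => h σ).trans ?_
      simp [Fintype.card_perm, mul_assoc])

/-- An alternating map is recovered from its underlying multilinear map by alternating and dividing
by `k!`, which is a continuous linear operation. -/
theorem contDiffAt_of_toContinuousMultilinearMap {k : ℕ} {g : E' → E [⋀^Fin k]→L[ℝ] F} {y : E'}
    (hg : ContDiffAt ℝ ∞ (fun z => (g z).toContinuousMultilinearMap) y) : ContDiffAt ℝ ∞ g y := by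
  have h : g = fun z => ((Nat.factorial k : ℝ)⁻¹ • alternatizationCLM (E := E) (F := F) k)
      ((g z).toContinuousMultilinearMap) := by
    funext z
    ext v
    simp only [smul_apply, alternatizationCLM, LinearMap.mkContinuous_apply,
      LinearMap.coe_mk, AddHom.coe_mk, ContinuousAlternatingMap.smul_apply,
      ContinuousMultilinearMap.alternatization_apply_apply]
    have h (σ : Equiv.Perm (Fin k)) :
        Equiv.Perm.sign σ • (g z).toContinuousMultilinearMap (v ∘ σ) = g z v := by
      have : g z (v ∘ σ) = Equiv.Perm.sign σ • g z v := (g z).toAlternatingMap.map_perm v σ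
      rw [ContinuousAlternatingMap.coe_toContinuousMultilinearMap, this, smul_smul]
      simp
    simp only [h, Finset.sum_const, Finset.card_univ, Fintype.card_perm, Fintype.card_fin]
    rw [← Nat.cast_smul_eq_nsmul ℝ, smul_smul, inv_mul_cancel₀ (by positivity), one_smul]
  rw [h]
  exact (ContinuousLinearMap.contDiff _).contDiffAt.comp y hg

theorem contDiffAt_compContinuousLinearMap {X : Type*} [NormedAddCommGroup X] [NormedSpace ℝ X]
    {k : ℕ} {g : X → E' [⋀^Fin k]→L[ℝ] F} {T : X → E →L[ℝ] E'}
    {y : X} (hg : ContDiffAt ℝ ∞ g y) (hT : ContDiffAt ℝ ∞ T y) :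
    ContDiffAt ℝ ∞ (fun z => (g z).compContinuousLinearMap (T z)) y := by
  refine contDiffAt_of_toContinuousMultilinearMap ?_
  have h₁ : ContDiffAt ℝ ∞ (fun z => (g z).toContinuousMultilinearMap) y :=
    (ContinuousAlternatingMap.toContinuousMultilinearMapLI (𝕜 := ℝ) (ι := Fin k) (E := E')
      (F := F)).contDiff.contDiffAt.comp y hg
  have h₂ := (ContinuousMultilinearMap.compContinuousLinearMapContinuousMultilinear ℝ
        (fun _ : Fin k ↦ E) (fun _ ↦ E') F).contDiff (n := ∞)
  exact (h₂.contDiffAt.comp y (contDiffAt_pi.2 fun _ => hT)).clm_apply h₁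

theorem DForm.contDiffAt_inChart {k : ℕ} {η : DForm I M F k} {x₀ x : M}
    (hx : x ∈ (extChartAt I x₀).source) (h : η.SmoothAt x) :
    ContDiffAt ℝ ∞ (η.inChart x₀) (extChartAt I x₀ x) := by
  have hy : extChartAt I x₀ x ∈ (extChartAt I x₀).target := (extChartAt I x₀).map_source hx
  have hl : (extChartAt I x₀).symm (extChartAt I x₀ x) = x := (extChartAt I x₀).left_inv hx
  have h₁ : (extChartAt I x₀).symm (extChartAt I x₀ x) ∈ (extChartAt I x).source := by
    rw [hl]; exact mem_extChartAt_source x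
  have ht : ContDiffAt ℝ ∞ (inCharts I I x₀ x id) (extChartAt I x₀ x) :=
    contDiffAt_inCharts hy contMDiffAt_id h₁
  have h₂ : inCharts I I x₀ x id (extChartAt I x₀ x) = extChartAt I x x := by
    simp only [inCharts, Function.comp_apply, hl, id]
  have h₃ : η.inChart x₀ =ᶠ[𝓝 (extChartAt I x₀ x)] fun y =>
      (η.inChart x (inCharts I I x₀ x id y)).compContinuousLinearMap
        (fderiv ℝ (inCharts I I x₀ x id) y) := by
    filter_upwards [eventually_mem_target hy, eventually_mem_source (f := id) hy continuousAt_id h₁]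
      with z hz hz' using η.inChart_change hz hz'
  refine ContDiffAt.congr_of_eventuallyEq ?_ h₃
  refine contDiffAt_compContinuousLinearMap (ContDiffAt.comp (g := η.inChart _) _ ?_ ht)
    (ht.fderiv_right (by simp))
  rw [h₂]; exact h

theorem DForm.isSmooth_iff {k : ℕ} {η : DForm I M F k} : η.IsSmooth ↔ ∀ x, η.SmoothAt x := by
  refine ⟨fun h x => (h x).contDiffAt (extChartAt_target_mem_nhds x), fun h x₀ y hy => ?_⟩
  have := DForm.contDiffAt_inChart ((extChartAt I x₀).map_target hy) (h _)
  rw [(extChartAt I x₀).right_inv hy] at this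
  exact this.contDiffWithinAt

theorem DForm.SmoothAt.pullback {k : ℕ} {η : DForm I' M' F k} {f : M → M'} {x : M}
    (hη : η.SmoothAt (f x)) (hf : ContMDiffAt I I' ∞ f x) :
    (DForm.pullback I I' f η).SmoothAt x := by
  have hy : extChartAt I x x ∈ (extChartAt I x).target := mem_extChartAt_target x
  have hl : (extChartAt I x).symm (extChartAt I x x) = x := extChartAt_to_inv x
  have h₁ : f ((extChartAt I x).symm (extChartAt I x x)) ∈ (extChartAt I' (f x)).source := by
    rw [hl]; exact mem_extChartAt_source _
  rw [← hl] at hf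
  have ht : ContDiffAt ℝ ∞ (inCharts I I' x (f x) f) (extChartAt I x x) :=
    contDiffAt_inCharts hy hf h₁
  have h₂ : inCharts I I' x (f x) f (extChartAt I x x) = extChartAt I' (f x) (f x) := by
    simp [inCharts]
  refine ContDiffAt.congr_of_eventuallyEq (f := fun y =>
      (η.inChart (f x) (inCharts I I' x (f x) f y)).compContinuousLinearMap
        (fderiv ℝ (inCharts I I' x (f x) f) y)) ?_ ?_
  · refine contDiffAt_compContinuousLinearMap (ContDiffAt.comp (g := η.inChart _) _ ?_ ht)
      (ht.fderiv_right (by simp))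
    rw [h₂]; exact hη
  · filter_upwards [eventually_mem_target hy, eventually_mem_source hy hf.continuousAt h₁,
      ContMDiffAt.eventually_inChart hy hf] with z hz hz' hz''
      using η.inChart_pullback hz hz'' hz'

/-- The exterior derivative commutes with pullback. -/
theorem DForm.d_pullback {k : ℕ} {η : DForm I' M' F k} {f : M → M'} {x : M}
    (hη : η.SmoothAt (f x)) (hf : ContMDiffAt I I' ∞ f x) :
    (DForm.pullback I I' f η).d x = DForm.pullback I I' f η.d x := by
  have hy : extChartAt I x x ∈ (extChartAt I x).target := mem_extChartAt_target x
  have hl : (extChartAt I x).symm (extChartAt I x x) = x := extChartAt_to_inv x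
  have h₁ : f ((extChartAt I x).symm (extChartAt I x x)) ∈ (extChartAt I' (f x)).source := by
    rw [hl]; exact mem_extChartAt_source _
  have hf' := hf
  rw [← hl] at hf
  have ht : ContDiffAt ℝ ∞ (inCharts I I' x (f x) f) (extChartAt I x x) :=
    contDiffAt_inCharts hy hf h₁
  have h₂ : inCharts I I' x (f x) f (extChartAt I x x) = extChartAt I' (f x) (f x) := by
    simp [inCharts]
  have h₃ : (DForm.pullback I I' f η).inChart x =ᶠ[𝓝 (extChartAt I x x)] fun y =>
      (η.inChart (f x) (inCharts I I' x (f x) f y)).compContinuousLinearMap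
        (fderiv ℝ (inCharts I I' x (f x) f) y) := by
    filter_upwards [eventually_mem_target hy, eventually_mem_source hy hf.continuousAt h₁,
      ContMDiffAt.eventually_inChart hy hf] with z hz hz' hz''
      using η.inChart_pullback hz hz'' hz'
  have h₄ : DifferentiableAt ℝ (η.inChart (f x)) (inCharts I I' x (f x) f (extChartAt I x x)) := by
    rw [h₂]; exact ContDiffAt.differentiableAt hη (by simp)
  have h₅ := (hasFDerivAt_inCharts hy (hf.mdifferentiableAt (by simp)) h₁).fderiv
  rw [DForm.d, h₃.extDeriv_eq, extDeriv_pullback h₄ ht two_le_infty', h₂]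
  ext v
  refine congrArg (extDeriv (η.inChart (f x)) (extChartAt I' (f x) (f x))) (funext fun i => ?_)
  rw [h₅]
  -- At its own centre a chart has the identity as derivative, under the identification of the
  -- tangent space with `E`; the chart factors at `x` therefore disappear.
  have h₆ := DFunLike.congr_fun (mfderiv_symm_self (I := I) x)
    (mfderiv I 𝓘(ℝ, E) (extChartAt I x) x (v i))
  have h₇ := DFunLike.congr_fun (mfderiv_extChartAt_self (I := I) (x := x)) (v i)
  have key : ∀ z (hz : z = x) (w : E), mfderiv I' 𝓘(ℝ, E') (extChartAt I' (f x)) (f z)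
      (mfderiv I I' f z w) = mfderiv I' 𝓘(ℝ, E') (extChartAt I' (f x)) (f x)
      (mfderiv I I' f x w) := by
    rintro z rfl w; rfl
  refine (key _ hl _).trans ?_
  exact congrArg (fun w => mfderiv I' 𝓘(ℝ, E') (extChartAt I' (f x)) (f x)
      (mfderiv I I' f x w)) (h₆.trans h₇)

/-- `DForm.d` uses a different chart at each point. By naturality of `extDeriv` under changes of
coordinates these choices agree with a single fixed chart, which is what allows `d` to be
differentiated again. -/
theorem DForm.inChart_d {k : ℕ} {η : DForm I M F k} {x₀ : M} {y : E}
    (hy : y ∈ (extChartAt I x₀).target) (hη : η.SmoothAt ((extChartAt I x₀).symm y)) :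
    η.d.inChart x₀ y = extDeriv (η.inChart x₀) y := by
  set x := (extChartAt I x₀).symm y with hx
  have h₁ : (extChartAt I x₀).symm y ∈ (extChartAt I x).source := mem_extChartAt_source x
  have ht : ContDiffAt ℝ ∞ (inCharts I I x₀ x id) y := contDiffAt_inCharts hy contMDiffAt_id h₁
  have h₂ : inCharts I I x₀ x id y = extChartAt I x x := rfl
  have h₃ : η.inChart x₀ =ᶠ[𝓝 y] fun y =>
      (η.inChart x (inCharts I I x₀ x id y)).compContinuousLinearMap
        (fderiv ℝ (inCharts I I x₀ x id) y) := by
    filter_upwards [eventually_mem_target hy, eventually_mem_source (f := id) hy continuousAt_id h₁]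
      with z hz hz' using η.inChart_change hz hz'
  have h₄ : DifferentiableAt ℝ (η.inChart x) (inCharts I I x₀ x id y) := by
    rw [h₂]; exact ContDiffAt.differentiableAt hη (by simp)
  have h₅ := (hasFDerivAt_inCharts (f := id) hy mdifferentiableAt_id h₁).fderiv
  rw [h₃.extDeriv_eq, extDeriv_pullback h₄ ht two_le_infty', h₂, h₅]
  ext v
  refine congrArg (extDeriv (η.inChart x) (extChartAt I x x)) (funext fun i => ?_)
  have h₆ : mfderiv I I id x = ContinuousLinearMap.id ℝ _ := mfderiv_id
  exact congrArg (mfderiv I 𝓘(ℝ, E) (extChartAt I x) x) (DFunLike.congr_fun h₆ _).symm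

theorem DForm.SmoothAt.eventually {k : ℕ} {η : DForm I M F k} (hη : η.IsSmooth) {x₀ : M} {y : E}
    (hy : y ∈ (extChartAt I x₀).target) : η.d.inChart x₀ =ᶠ[𝓝 y] extDeriv (η.inChart x₀) := by
  filter_upwards [eventually_mem_target hy] with z hz
  exact DForm.inChart_d hz (DForm.isSmooth_iff.1 hη _)

theorem contDiffAt_extDeriv {k : ℕ} {ζ : E → E [⋀^Fin k]→L[ℝ] F} {y : E}
    (h : ContDiffAt ℝ ∞ ζ y) : ContDiffAt ℝ ∞ (extDeriv ζ) y := by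
  have h₁ : ContDiffAt ℝ ∞ (fderiv ℝ ζ) y := h.fderiv_right (by simp)
  exact (ContinuousAlternatingMap.alternatizeUncurryFinCLM ℝ E F (n := k)).contDiff.contDiffAt.comp
    y h₁

theorem DForm.IsSmooth.smoothAt {k : ℕ} {η : DForm I M F k} (hη : η.IsSmooth) (x : M) :
    η.SmoothAt x := DForm.isSmooth_iff.1 hη x

theorem DForm.IsSmooth.d {k : ℕ} {η : DForm I M F k} (hη : η.IsSmooth) : η.d.IsSmooth := by
  rw [DForm.isSmooth_iff]
  intro x
  exact (contDiffAt_extDeriv (hη.smoothAt x)).congr_of_eventuallyEq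
    (DForm.SmoothAt.eventually hη (mem_extChartAt_target x))

theorem DForm.d_d {k : ℕ} {η : DForm I M F k} (hη : η.IsSmooth) : η.d.d = 0 := by
  funext x
  rw [DForm.d, (DForm.SmoothAt.eventually hη (mem_extChartAt_target x)).extDeriv_eq,
    extDeriv_extDeriv_apply (hη.smoothAt x) two_le_infty']
  rfl

theorem DForm.IsSmooth.add {k : ℕ} {η θ : DForm I M F k} (hη : η.IsSmooth) (hθ : θ.IsSmooth) :
    (η + θ).IsSmooth := fun x₀ => (hη x₀).add (hθ x₀)

theorem DForm.IsSmooth.neg {k : ℕ} {η : DForm I M F k} (hη : η.IsSmooth) :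
    (-η).IsSmooth := fun x₀ => (hη x₀).neg

theorem DForm.IsSmooth.sub {k : ℕ} {η θ : DForm I M F k} (hη : η.IsSmooth) (hθ : θ.IsSmooth) :
    (η - θ).IsSmooth := fun x₀ => (hη x₀).sub (hθ x₀)

theorem DForm.d_add {k : ℕ} {η θ : DForm I M F k} {x : M} (hη : η.SmoothAt x) (hθ : θ.SmoothAt x) :
    (η + θ).d x = η.d x + θ.d x := by
  have h : extDeriv ((η + θ).inChart x) (extChartAt I x x) =
      extDeriv (η.inChart x) (extChartAt I x x) + extDeriv (θ.inChart x) (extChartAt I x x) :=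
    extDeriv_add (ContDiffAt.differentiableAt hη (by simp))
      (ContDiffAt.differentiableAt hθ (by simp))
  rw [DForm.d, h]
  rfl

theorem DForm.d_neg {k : ℕ} (η : DForm I M F k) : (-η).d = -η.d := by
  funext x
  have h : extDeriv ((-η).inChart x) (extChartAt I x x) =
      -extDeriv (η.inChart x) (extChartAt I x x) := by
    have := extDeriv_smul (𝕜 := ℝ) (x := extChartAt I x x) (-1) (η.inChart x)
    simp only [neg_smul, one_smul] at this
    exact this
  rw [DForm.d, h]
  rfl

theorem DForm.d_sub {k : ℕ} {η θ : DForm I M F k} {x : M} (hη : η.SmoothAt x) (hθ : θ.SmoothAt x) :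
    (η - θ).d x = η.d x - θ.d x := by
  have h : (-θ).SmoothAt x := ContDiffAt.neg hθ
  rw [sub_eq_add_neg, DForm.d_add hη h, DForm.d_neg, sub_eq_add_neg]
  rfl

/-- The exterior derivative at a point, in the chart around this point. -/
theorem DForm.d_apply {k : ℕ} (η : DForm I M F k) (x : M) (v : Fin (k + 1) → TangentSpace I x) :
    η.d x v = extDeriv (η.inChart x) (extChartAt I x x) v := by
  refine congrArg (extDeriv (η.inChart x) (extChartAt I x x)) (funext fun i => ?_)
  exact DFunLike.congr_fun (mfderiv_extChartAt_self (I := I) (x := x)) (v i)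

theorem DForm.inChart_self {k : ℕ} (η : DForm I M F k) (x : M) (v : Fin k → TangentSpace I x) :
    η.inChart x (extChartAt I x x) v = η x v := by
  have key : ∀ z (hz : z = x), η z (fun i => (v i : E)) = η x v := by
    rintro z rfl; rfl
  refine Eq.trans ?_ (key _ (extChartAt_to_inv (I := I) x))
  refine congrArg (η _) (funext fun i => ?_)
  exact DFunLike.congr_fun (mfderiv_symm_self (I := I) x) (v i)

/-- The arguments are constant vector fields, so the bracket term is absent. -/
theorem extDeriv_one_apply {ζ : E → E [⋀^Fin 1]→L[ℝ] F} {x : E} (h : DifferentiableAt ℝ ζ x)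
    (u v : E) : extDeriv ζ x ![u, v] =
      fderiv ℝ (fun y => ζ y ![v]) x u - fderiv ℝ (fun y => ζ y ![u]) x v := by
  rw [extDeriv_apply h, Fin.sum_univ_two]
  have h₀ : Fin.removeNth (0 : Fin 2) ![u, v] = ![v] := by ext i; fin_cases i; rfl
  have h₁ : Fin.removeNth (1 : Fin 2) ![u, v] = ![u] := by ext i; fin_cases i; rfl
  rw [h₀, h₁]
  simp [sub_eq_add_neg]

theorem extDeriv_two_apply {ζ : E → E [⋀^Fin 2]→L[ℝ] F} {x : E} (h : DifferentiableAt ℝ ζ x)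
    (u v w : E) : extDeriv ζ x ![u, v, w] =
      fderiv ℝ (fun y => ζ y ![v, w]) x u + fderiv ℝ (fun y => ζ y ![w, u]) x v +
        fderiv ℝ (fun y => ζ y ![u, v]) x w := by
  rw [extDeriv_apply h, Fin.sum_univ_three]
  have h₀ : Fin.removeNth (0 : Fin 3) ![u, v, w] = ![v, w] := by ext i; fin_cases i <;> rfl
  have h₁ : Fin.removeNth (1 : Fin 3) ![u, v, w] = ![u, w] := by ext i; fin_cases i <;> rfl
  have h₂ : Fin.removeNth (2 : Fin 3) ![u, v, w] = ![u, v] := by ext i; fin_cases i <;> rfl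
  -- Exchanging the two arguments absorbs the alternating sign and puts the sum in cyclic form.
  have h₃ : (fun y => ζ y ![u, w]) = -fun y => ζ y ![w, u] := by
    funext y
    have : ζ y (![w, u] ∘ Equiv.swap 0 1) = -ζ y ![w, u] :=
      (ζ y).toAlternatingMap.map_swap ![w, u] (i := 0) (j := 1) (by simp)
    rw [Pi.neg_apply, ← this]
    congr 1
    ext i; fin_cases i <;> rfl
  rw [h₀, h₁, h₂, h₃, fderiv_neg]
  simp

theorem DForm.swap (η : DForm I M F 2) (x : M) (u v : TangentSpace I x) :
    η x ![u, v] = -η x ![v, u] := by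
  have : η x (![v, u] ∘ Equiv.swap 0 1) = -η x ![v, u] :=
    (η x).toAlternatingMap.map_swap ![v, u] (i := 0) (j := 1) (by simp)
  rw [← this]
  congr 1
  ext i; fin_cases i <;> rfl

theorem DForm.ext₁ {x : M} {η θ : TangentSpace I x [⋀^Fin 1]→L[ℝ] F}
    (h : ∀ u, η ![u] = θ ![u]) : η = θ := by
  ext v
  have : v = ![v 0] := by ext i; fin_cases i; rfl
  rw [this]; exact h _

theorem DForm.ext₂ {x : M} {η θ : TangentSpace I x [⋀^Fin 2]→L[ℝ] F}
    (h : ∀ u v, η ![u, v] = θ ![u, v]) : η = θ := by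
  ext v
  have : v = ![v 0, v 1] := by ext i; fin_cases i <;> rfl
  rw [this]; exact h _ _

theorem oneForm_smoothAt_iff (a : (x : M) → TangentSpace I x →L[ℝ] F) (x : M) :
    (oneForm a).SmoothAt x ↔ ContDiffAt ℝ ∞ (fun y => (a ((extChartAt I x).symm y) ∘L
      mfderiv 𝓘(ℝ, E) I (extChartAt I x).symm y : E →L[ℝ] F)) (extChartAt I x x) := by
  have h : (oneForm a).inChart x = (ContinuousAlternatingMap.ofSubsingletonLIE (𝕜 := ℝ) (E := E)
    (F := F) (0 : Fin 1)) ∘ (fun y => (a ((extChartAt I x).symm y) ∘L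
      mfderiv 𝓘(ℝ, E) I (extChartAt I x).symm y : E →L[ℝ] F)) := rfl
  rw [DForm.SmoothAt, h]
  exact (ContinuousAlternatingMap.ofSubsingletonLIE (𝕜 := ℝ) (E := E)
    (F := F) (0 : Fin 1)).toContinuousLinearEquiv.comp_contDiffAt_iff

theorem contMDiffAt_iff_inChart {f : M → F} {x : M} :
    ContMDiffAt I 𝓘(ℝ, F) ∞ f x ↔
      ContDiffAt ℝ ∞ (fun y => f ((extChartAt I x).symm y)) (extChartAt I x x) := by
  constructor
  · intro h
    have hl : (extChartAt I x).symm (extChartAt I x x) = x := extChartAt_to_inv x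
    rw [← hl] at h
    exact (h.comp _ (contMDiffAt_extChartAt_symm (mem_extChartAt_target x))).contDiffAt
  · intro h
    have h₁ := h.contMDiffAt.comp x (contMDiffAt_extChartAt (I := I) (x := x))
    refine h₁.congr_of_eventuallyEq ?_
    filter_upwards [extChartAt_source_mem_nhds (I := I) x] with z hz
    simp only [Function.comp_apply, (extChartAt I x).left_inv hz]

end Charts

end Nonholonomic

end

noncomputable section

set_option linter.unusedSectionVars false

namespace Nonholonomic

/-! ### Bivectors on normed spaces -/

section Linear

variable {E : Type*} [NormedAddCommGroup E] [NormedSpace ℝ E]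
  {E' : Type*} [NormedAddCommGroup E'] [NormedSpace ℝ E']
  {F : Type*} [NormedAddCommGroup F] [NormedSpace ℝ F]
  {V : Type*} [NormedAddCommGroup V] [NormedSpace ℝ V]

variable (E F) in
/-- Alternating maps in two variables as bilinear maps. -/
def bilin : (E [⋀^Fin 2]→L[ℝ] F) →L[ℝ] E →L[ℝ] E →L[ℝ] F :=
  (ContinuousLinearMap.postcomp E
    (ContinuousAlternatingMap.ofSubsingletonLIE (𝕜 := ℝ) (E := E)
      (F := F) (0 : Fin 1)).symm.toContinuousLinearEquiv.toContinuousLinearMap) ∘L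
    (ContinuousAlternatingMap.curryLeftLI (𝕜 := ℝ) (E := E) (F := F) (n := 1)).toContinuousLinearMap

theorem bilin_apply (η : E [⋀^Fin 2]→L[ℝ] F) (u v : E) : bilin E F η u v = η ![u, v] := by
  have : Matrix.vecCons u (fun _ : Fin 1 => v) = ![u, v] := by ext i; fin_cases i <;> rfl
  rw [← this]
  rfl

theorem hasFDerivAt_two_form_apply {ζ : E → E' [⋀^Fin 2]→L[ℝ] F} {p q : E → E'} {x : E}
    (hζ : DifferentiableAt ℝ ζ x) (hp : DifferentiableAt ℝ p x) (hq : DifferentiableAt ℝ q x)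
    (X : E) : fderiv ℝ (fun y => ζ y ![p y, q y]) x X =
      fderiv ℝ (fun y => ζ y ![p x, q x]) x X + ζ x ![fderiv ℝ p x X, q x] +
        ζ x ![p x, fderiv ℝ q x X] := by
  have hb : HasFDerivAt (fun y => bilin E' F (ζ y)) (bilin E' F ∘L fderiv ℝ ζ x) x :=
    HasFDerivAt.comp (g := bilin E' F) x (bilin E' F).hasFDerivAt hζ.hasFDerivAt
  have h₁ := ((hb.clm_apply hp.hasFDerivAt).clm_apply hq.hasFDerivAt).fderiv
  have h₂ := ((hb.clm_apply (hasFDerivAt_const (p x) x)).clm_apply (hasFDerivAt_const (q x) x)).fderiv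
  simp only [bilin_apply] at h₁ h₂
  rw [h₁, h₂]
  simp [bilin_apply]
  abel

theorem differentiableAt_two_form_apply {ζ : E → E' [⋀^Fin 2]→L[ℝ] F} {p q : E → E'} {x : E}
    (hζ : DifferentiableAt ℝ ζ x) (hp : DifferentiableAt ℝ p x) (hq : DifferentiableAt ℝ q x) :
    DifferentiableAt ℝ (fun y => ζ y ![p y, q y]) x := by
  have hb : HasFDerivAt (fun y => bilin E' F (ζ y)) (bilin E' F ∘L fderiv ℝ ζ x) x :=
    HasFDerivAt.comp (g := bilin E' F) x (bilin E' F).hasFDerivAt hζ.hasFDerivAt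
  have h₁ := ((hb.clm_apply hp.hasFDerivAt).clm_apply hq.hasFDerivAt).differentiableAt
  simpa only [bilin_apply] using h₁

theorem two_form_swap (η : E [⋀^Fin 2]→L[ℝ] F) (u v : E) : η ![u, v] = -η ![v, u] := by
  have : η (![v, u] ∘ Equiv.swap 0 1) = -η ![v, u] :=
    η.toAlternatingMap.map_swap ![v, u] (i := 0) (j := 1) (by simp)
  rw [← this]
  congr 1
  ext i; fin_cases i <;> rfl

/-- The cyclic sum of the derivatives of a bivector `π`, when `π` inverts a two-form `ζ` on the
kernel of `A`. -/
theorem cyclic_fderiv_bivector {π : E → (E →L[ℝ] ℝ) →L[ℝ] E} {ζ : E → E [⋀^Fin 2]→L[ℝ] ℝ}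
    {A : E → E →L[ℝ] V} {G : V →L[ℝ] E} {x : E} (hπ : DifferentiableAt ℝ π x)
    (hζ : DifferentiableAt ℝ ζ x) (hA : DifferentiableAt ℝ A x)
    (hskew : ∀ᶠ y in 𝓝 x, ∀ β γ : E →L[ℝ] ℝ, β (π y γ) = -γ (π y β))
    (hinv : ∀ᶠ y in 𝓝 x, ∀ β γ : E →L[ℝ] ℝ, ζ y ![π y β, π y γ] = γ (π y β))
    (hinv' : ∀ (β : E →L[ℝ] ℝ) (v : E), ζ x ![π x β, v] = -β (v - G (A x v)))
    (hAπ : ∀ᶠ y in 𝓝 x, ∀ β : E →L[ℝ] ℝ, A y (π y β) = 0) (α β γ : E →L[ℝ] ℝ) :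
    fderiv ℝ (fun y => γ (π y β)) x (π x α) + fderiv ℝ (fun y => α (π y γ)) x (π x β) +
      fderiv ℝ (fun y => β (π y α)) x (π x γ) =
      -extDeriv ζ x ![π x α, π x β, π x γ] -
      (γ (G (fderiv ℝ A x (π x α) (π x β) - fderiv ℝ A x (π x β) (π x α))) +
       α (G (fderiv ℝ A x (π x β) (π x γ) - fderiv ℝ A x (π x γ) (π x β))) +
       β (G (fderiv ℝ A x (π x γ) (π x α) - fderiv ℝ A x (π x α) (π x γ)))) := by
  have hπ' (β : E →L[ℝ] ℝ) : HasFDerivAt (fun y => π y β) ((fderiv ℝ π x).flip β) x := by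
    have := hπ.hasFDerivAt.clm_apply (hasFDerivAt_const β x)
    simpa using this
  -- Differentiating `A (π β) = 0` computes by how much the derivative of `π β` leaves the kernel of
  -- `A`.
  have hAD (β : E →L[ℝ] ℝ) (X : E) :
      A x (fderiv ℝ π x X β) = -fderiv ℝ A x X (π x β) := by
    have h₁ := hA.hasFDerivAt.clm_apply (hπ' β)
    have h₂ : (fun y => A y (π y β)) =ᶠ[𝓝 x] fun _ => 0 := hAπ.mono fun y hy => hy β
    have h₃ := DFunLike.congr_fun (h₁.unique ((hasFDerivAt_const (0 : V) x).congr_of_eventuallyEq h₂)) X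
    simp only [add_apply, ContinuousLinearMap.comp_apply,
      ContinuousLinearMap.flip_apply, zero_apply] at h₃
    exact eq_neg_of_add_eq_zero_left h₃
  have hf (β γ : E →L[ℝ] ℝ) (X : E) :
      fderiv ℝ (fun y => γ (π y β)) x X = γ (fderiv ℝ π x X β) := by
    exact DFunLike.congr_fun (HasFDerivAt.comp (g := γ) x γ.hasFDerivAt (hπ' β)).fderiv X
  have hskew' (β γ : E →L[ℝ] ℝ) (X : E) : β (fderiv ℝ π x X γ) = -γ (fderiv ℝ π x X β) := by
    rw [← hf, ← hf]
    have : (fun y => β (π y γ)) =ᶠ[𝓝 x] -fun y => γ (π y β) := hskew.mono fun y hy => hy β γ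
    rw [this.fderiv_eq, fderiv_neg]; rfl
  -- The product rule for `ζ (π β, π γ) = γ (π β)` along `π α` has the wanted derivative once on the
  -- left and, by skewness, twice on the right, so it can be solved for. The components outside the
  -- kernel of `A` contribute the terms in the derivative of `A`.
  have key (α β γ : E →L[ℝ] ℝ) : γ (fderiv ℝ π x (π x α) β) =
      -fderiv ℝ (fun y => ζ y ![π x β, π x γ]) x (π x α)
      - γ (G (fderiv ℝ A x (π x α) (π x β))) + β (G (fderiv ℝ A x (π x α) (π x γ))) := by
    have h₁ := hasFDerivAt_two_form_apply hζ (hπ' β).differentiableAt (hπ' γ).differentiableAt (π x α)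
    have h₂ : (fun y => ζ y ![π y β, π y γ]) =ᶠ[𝓝 x] fun y => γ (π y β) :=
      hinv.mono fun y hy => hy β γ
    rw [h₂.fderiv_eq, hf, (hπ' β).fderiv, (hπ' γ).fderiv, ContinuousLinearMap.flip_apply,
      ContinuousLinearMap.flip_apply, two_form_swap _ _ (π x γ), hinv', hinv', map_sub, map_sub,
      hAD, hAD, map_neg, map_neg, map_neg, map_neg] at h₁
    have h₃ := hskew' β γ (π x α)
    linarith
  -- In the cyclic sum the derivatives of `ζ` assemble to its exterior derivative and those of `A`
  -- are antisymmetrized.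
  rw [extDeriv_two_apply hζ, hf, hf, hf, key α β γ, key β γ α, key γ α β]
  simp only [map_sub]
  ring

/-- The cyclic sum of the derivatives of a bivector does not change under related maps. -/
theorem cyclic_fderiv_bivector_related {π : E → (E →L[ℝ] ℝ) →L[ℝ] E}
    {σ : E' → (E' →L[ℝ] ℝ) →L[ℝ] E'} {f : E → E'} {x : E} (hπ : DifferentiableAt ℝ π x)
    (hσ : DifferentiableAt ℝ σ (f x)) (hf : ContDiffAt ℝ ∞ f x)
    (hskew : ∀ β γ : E →L[ℝ] ℝ, β (π x γ) = -γ (π x β))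
    (hrel : ∀ᶠ y in 𝓝 x, ∀ β : E' →L[ℝ] ℝ, σ (f y) β = fderiv ℝ f y (π y (β ∘L fderiv ℝ f y)))
    (α β γ : E' →L[ℝ] ℝ) :
    fderiv ℝ (fun y => γ (σ y β)) (f x) (σ (f x) α) +
      fderiv ℝ (fun y => α (σ y γ)) (f x) (σ (f x) β) +
      fderiv ℝ (fun y => β (σ y α)) (f x) (σ (f x) γ) =
    fderiv ℝ (fun y => (γ ∘L fderiv ℝ f x) (π y (β ∘L fderiv ℝ f x))) x (π x (α ∘L fderiv ℝ f x)) +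
      fderiv ℝ (fun y => (α ∘L fderiv ℝ f x) (π y (γ ∘L fderiv ℝ f x))) x
        (π x (β ∘L fderiv ℝ f x)) +
      fderiv ℝ (fun y => (β ∘L fderiv ℝ f x) (π y (α ∘L fderiv ℝ f x))) x
        (π x (γ ∘L fderiv ℝ f x)) := by
  have hdf : DifferentiableAt ℝ f x := hf.differentiableAt (by simp)
  have hD : HasFDerivAt (fderiv ℝ f) (fderiv ℝ (fderiv ℝ f) x) x :=
    ((hf.fderiv_right (m := ∞) (by simp)).differentiableAt (by simp)).hasFDerivAt
  have hsymm (u v : E) : fderiv ℝ (fderiv ℝ f) x u v = fderiv ℝ (fderiv ℝ f) x v u :=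
    (hf.isSymmSndFDerivAt two_le_infty') u v
  have hrelx := hrel.self_of_nhds
  have key (α β γ : E' →L[ℝ] ℝ) : fderiv ℝ (fun y => γ (σ y β)) (f x) (σ (f x) α) =
      fderiv ℝ (fun y => (γ ∘L fderiv ℝ f x) (π y (β ∘L fderiv ℝ f x))) x
        (π x (α ∘L fderiv ℝ f x)) +
      γ (fderiv ℝ (fderiv ℝ f) x (π x (α ∘L fderiv ℝ f x)) (π x (β ∘L fderiv ℝ f x))) -
      β (fderiv ℝ (fderiv ℝ f) x (π x (α ∘L fderiv ℝ f x)) (π x (γ ∘L fderiv ℝ f x))) := by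
    have h₁ : DifferentiableAt ℝ (fun y => γ (σ y β)) (f x) :=
      γ.differentiableAt.comp (f x) (hσ.clm_apply (differentiableAt_const β))
    have h₂ : (fun y => γ (σ (f y) β)) =ᶠ[𝓝 x]
        fun y => γ (fderiv ℝ f y (π y (β ∘L fderiv ℝ f y))) :=
      hrel.mono fun y hy => congrArg γ (hy β)
    have h₃ : fderiv ℝ (fun y => γ (σ (f y) β)) x (π x (α ∘L fderiv ℝ f x)) =
        fderiv ℝ (fun y => γ (σ y β)) (f x) (σ (f x) α) := by
      rw [hrelx α]
      have := fderiv_comp x h₁ hdf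
      exact DFunLike.congr_fun this _
    have h₄ : HasFDerivAt (fun y => β ∘L fderiv ℝ f y)
        ((ContinuousLinearMap.postcomp E β) ∘L (fderiv ℝ (fderiv ℝ f) x)) x :=
      HasFDerivAt.comp (g := ContinuousLinearMap.postcomp E β) x
        (ContinuousLinearMap.postcomp E β).hasFDerivAt hD
    have h₅ := γ.hasFDerivAt.comp x (hD.clm_apply (hπ.hasFDerivAt.clm_apply h₄))
    have h₆ := hπ.hasFDerivAt.clm_apply (hasFDerivAt_const (β ∘L fderiv ℝ f x) x)
    have h₇ := (γ ∘L fderiv ℝ f x).hasFDerivAt.comp x h₆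
    have h₈ : (fun y => (γ ∘L fderiv ℝ f x) (π y (β ∘L fderiv ℝ f x))) =
      ⇑(γ ∘L fderiv ℝ f x) ∘ (fun y => π y (β ∘L fderiv ℝ f x)) := rfl
    have h₉ : (fun y => γ (fderiv ℝ f y (π y (β ∘L fderiv ℝ f y)))) =
      ⇑γ ∘ (fun y => fderiv ℝ f y (π y (β ∘L fderiv ℝ f y))) := rfl
    rw [← h₃, h₂.fderiv_eq, h₈, h₇.fderiv, h₉, h₅.fderiv]
    -- Skewness moves the derivative of `β ∘ Df`, which sits inside `π`, onto the other argument.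
    have h₁₀ := hskew (γ ∘L fderiv ℝ f x)
      (β ∘L fderiv ℝ (fderiv ℝ f) x (π x (α ∘L fderiv ℝ f x)))
    simp only [ContinuousLinearMap.comp_apply, add_apply,
      ContinuousLinearMap.flip_apply, map_add, ContinuousLinearMap.postcomp_apply,
      zero_apply, map_zero] at h₁₀ ⊢
    linarith
  rw [key α β γ, key β γ α, key γ α β]
  -- Each second derivative of `f` now occurs twice in the cyclic sum, with opposite signs and
  -- exchanged arguments, so symmetry cancels them all.
  rw [hsymm (π x (α ∘L fderiv ℝ f x)) (π x (β ∘L fderiv ℝ f x)),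
    hsymm (π x (β ∘L fderiv ℝ f x)) (π x (γ ∘L fderiv ℝ f x)),
    hsymm (π x (γ ∘L fderiv ℝ f x)) (π x (α ∘L fderiv ℝ f x))]
  ring

end Linear

end Nonholonomic

end

noncomputable section

set_option linter.unusedSectionVars false

namespace Nonholonomic

/-! ### Bivector fields on manifolds -/

section Bivectors

variable {E : Type*} [NormedAddCommGroup E] [NormedSpace ℝ E]
  {H : Type*} [TopologicalSpace H] {I : ModelWithCorners ℝ E H} [I.Boundaryless]
  {M : Type*} [TopologicalSpace M] [ChartedSpace H M] [IsManifold I ∞ M]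
  {E' : Type*} [NormedAddCommGroup E'] [NormedSpace ℝ E']
  {H' : Type*} [TopologicalSpace H'] {I' : ModelWithCorners ℝ E' H'} [I'.Boundaryless]
  {M' : Type*} [TopologicalSpace M'] [ChartedSpace H' M'] [IsManifold I' ∞ M']

variable (E E') in
/-- The map `T ↦ T^*`, as a continuous linear map. -/
def precompCLM : (E →L[ℝ] E') →L[ℝ] (E' →L[ℝ] ℝ) →L[ℝ] (E →L[ℝ] ℝ) :=
  (ContinuousLinearMap.compL ℝ E E' ℝ).flip

theorem contDiffAt_precomp {X : Type*} [NormedAddCommGroup X] [NormedSpace ℝ X]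
    {T : X → E →L[ℝ] E'} {x : X} (hT : ContDiffAt ℝ ∞ T x) :
    ContDiffAt ℝ ∞ (fun y => (ContinuousLinearMap.precomp ℝ (T y) : (E' →L[ℝ] ℝ) →L[ℝ] (E →L[ℝ] ℝ))) x := by
  have h : ContDiff ℝ ∞ (precompCLM E E') := by fun_prop
  exact ContDiffAt.comp (g := precompCLM E E') x h.contDiffAt hT

/-- Smoothness at a point of a family of maps `T^*M → TM`. -/
def SharpMap.SmoothAt (π : SharpMap I M) (x : M) : Prop :=
  ContDiffAt ℝ ∞ (π.inChart x) (extChartAt I x x)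

/-- Relatedness of bivectors under a map, at a point. -/
def SharpMap.RelatedAt (f : M → M') (π : SharpMap I M) (σ : SharpMap I' M') (x : M) : Prop :=
  ∀ β : Covector I' (f x), σ (f x) β = mfderiv I I' f x (π x (β ∘L mfderiv I I' f x))

theorem SharpMap.inChart_self (π : SharpMap I M) (x : M) (α : Covector I x) :
    π.inChart x (extChartAt I x x) α = π x α := by
  have key : ∀ z (hz : z = x), (mfderiv I 𝓘(ℝ, E) (extChartAt I x) z : E →L[ℝ] E)
      (π z ((α : E →L[ℝ] ℝ) ∘L (mfderiv I 𝓘(ℝ, E) (extChartAt I x) z : E →L[ℝ] E))) = π x α := by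
    rintro z rfl
    have h : (mfderiv I 𝓘(ℝ, E) (extChartAt I z) z : E →L[ℝ] E) = ContinuousLinearMap.id ℝ E :=
      mfderiv_extChartAt_self
    rw [h]; rfl
  exact key _ (extChartAt_to_inv (I := I) x)

theorem SharpMap.inChart_related {π : SharpMap I M} {σ : SharpMap I' M'} {f : M → M'} {x₀ : M}
    {x₁ : M'} {y : E} (hy : y ∈ (extChartAt I x₀).target)
    (h₁ : f ((extChartAt I x₀).symm y) ∈ (extChartAt I' x₁).source)
    (hrel : SharpMap.RelatedAt f π σ ((extChartAt I x₀).symm y)) (β : E' →L[ℝ] ℝ) :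
    σ.inChart x₁ (inCharts I I' x₀ x₁ f y) β = derivInCharts I I' x₀ x₁ f y
      (π.inChart x₀ y (β ∘L derivInCharts I I' x₀ x₁ f y)) := by
  set z := (extChartAt I x₀).symm y with hz
  have hST := mfderiv_symm_comp_mfderiv (I := I) hy
  rw [← hz] at hST
  have hDT (u : TangentSpace I z) :
      derivInCharts I I' x₀ x₁ f y (mfderiv I 𝓘(ℝ, E) (extChartAt I x₀) z u) =
      mfderiv I' 𝓘(ℝ, E') (extChartAt I' x₁) (f z) (mfderiv I I' f z u) :=
    congrArg (fun w => mfderiv I' 𝓘(ℝ, E') (extChartAt I' x₁) (f z) (mfderiv I I' f z w))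
      (DFunLike.congr_fun hST u)
  have h₂ : (extChartAt I' x₁).symm (extChartAt I' x₁ (f z)) = f z := (extChartAt I' x₁).left_inv h₁
  have key : ∀ (w : M') (hw : w = f z),
      (mfderiv I' 𝓘(ℝ, E') (extChartAt I' x₁) w : E' →L[ℝ] E')
      (σ w (β ∘L (mfderiv I' 𝓘(ℝ, E') (extChartAt I' x₁) w : E' →L[ℝ] E'))) =
      derivInCharts I I' x₀ x₁ f y (π.inChart x₀ y (β ∘L derivInCharts I I' x₀ x₁ f y)) := by
    rintro w rfl
    have h₃ : π.inChart x₀ y (β ∘L derivInCharts I I' x₀ x₁ f y) =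
        mfderiv I 𝓘(ℝ, E) (extChartAt I x₀) z (π z (β ∘L (mfderiv I' 𝓘(ℝ, E') (extChartAt I' x₁) (f z) ∘L
          mfderiv I I' f z))) := by
      refine congrArg (fun α => mfderiv I 𝓘(ℝ, E) (extChartAt I x₀) z (π z α)) ?_
      ext u
      exact congrArg β (hDT u)
    rw [h₃, hDT]
    refine congrArg (mfderiv I' 𝓘(ℝ, E') (extChartAt I' x₁) (f z)) ?_
    exact hrel _
  exact key _ h₂

/-- Along a local section `s` of `f`, relatedness expresses `σ` as `Tf ∘ π ∘ (Tf)^*` evaluated at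
`s`, a composition of smooth families. It serves both for changing charts and for descending to the
orbit space. -/
theorem SharpMap.contDiffAt_of_related {π : SharpMap I M} {σ : SharpMap I' M'} {f : M → M'}
    {s : M' → M} {x x₁ : M'} (hx : x ∈ (extChartAt I' x₁).source) (hπ : π.SmoothAt (s x))
    (hs : ContMDiffAt I' I ∞ s x) (hf : ContMDiffAt I I' ∞ f (s x))
    (hfs : ∀ᶠ z in 𝓝 x, f (s z) = z) (hrel : ∀ᶠ z in 𝓝 x, SharpMap.RelatedAt f π σ (s z)) :
    ContDiffAt ℝ ∞ (σ.inChart x₁) (extChartAt I' x₁ x) := by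
  have hy : extChartAt I' x₁ x ∈ (extChartAt I' x₁).target := (extChartAt I' x₁).map_source hx
  have hl : (extChartAt I' x₁).symm (extChartAt I' x₁ x) = x := (extChartAt I' x₁).left_inv hx
  have hs' : ContMDiffAt I' I ∞ s ((extChartAt I' x₁).symm (extChartAt I' x₁ x)) := by rwa [hl]
  have h₁ : s ((extChartAt I' x₁).symm (extChartAt I' x₁ x)) ∈ (extChartAt I (s x)).source := by
    rw [hl]; exact mem_extChartAt_source _
  have hfx : f (s x) = x := hfs.self_of_nhds
  have hsc : ContDiffAt ℝ ∞ (inCharts I' I x₁ (s x) s) (extChartAt I' x₁ x) :=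
    contDiffAt_inCharts hy hs' h₁
  have h₂ : inCharts I' I x₁ (s x) s (extChartAt I' x₁ x) = extChartAt I (s x) (s x) := by
    simp only [inCharts, Function.comp_apply, hl]
  have h₃ : (extChartAt I (s x)).symm (extChartAt I (s x) (s x)) = s x := extChartAt_to_inv _
  have hfc : ContDiffAt ℝ ∞ (inCharts I I' (s x) x₁ f) (extChartAt I (s x) (s x)) := by
    refine contDiffAt_inCharts (mem_extChartAt_target _) (by rwa [h₃]) ?_
    rwa [h₃, hfx]
  rw [← h₂] at hfc
  have hD : ContDiffAt ℝ ∞ (fun y => fderiv ℝ (inCharts I I' (s x) x₁ f)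
      (inCharts I' I x₁ (s x) s y)) (extChartAt I' x₁ x) :=
    ContDiffAt.comp (g := fderiv ℝ (inCharts I I' (s x) x₁ f)) _ (hfc.fderiv_right (by simp)) hsc
  have hπ' : ContDiffAt ℝ ∞ (fun y => π.inChart (s x) (inCharts I' I x₁ (s x) s y))
      (extChartAt I' x₁ x) := by
    refine ContDiffAt.comp (g := π.inChart (s x)) _ ?_ hsc
    rw [h₂]; exact hπ
  have hpre : ContDiffAt ℝ ∞ (fun y => ContinuousLinearMap.precomp ℝ
      (fderiv ℝ (inCharts I I' (s x) x₁ f) (inCharts I' I x₁ (s x) s y))) (extChartAt I' x₁ x) :=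
    contDiffAt_precomp hD
  refine (hD.clm_comp (hπ'.clm_comp hpre)).congr_of_eventuallyEq ?_
  have hc : ContinuousAt (extChartAt I' x₁).symm (extChartAt I' x₁ x) :=
    (contMDiffAt_extChartAt_symm hy).continuousAt
  have hc' : Filter.Tendsto (extChartAt I' x₁).symm (𝓝 (extChartAt I' x₁ x)) (𝓝 x) := by
    have := hc.tendsto; rwa [hl] at this
  have hf1 : ∀ᶠ w in 𝓝 (s x), MDifferentiableAt I I' f w := by
    have := (contMDiffAt_iff_contMDiffAt_nhds (n := 1) (by simp)).1 (hf.of_le (by simp))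
    exact this.mono fun w hw => hw.mdifferentiableAt (by simp)
  filter_upwards [eventually_mem_target hy, eventually_mem_source hy hs'.continuousAt h₁,
    hc'.eventually hfs, hc'.eventually hrel, (hs.continuousAt.tendsto.comp hc').eventually hf1]
    with y hy₁ hy₂ hy₃ hy₄ hy₅
  have h₄ : (extChartAt I (s x)).symm (inCharts I' I x₁ (s x) s y) = s ((extChartAt I' x₁).symm y) :=
    (extChartAt I (s x)).left_inv hy₂
  have h₅ : inCharts I I' (s x) x₁ f (inCharts I' I x₁ (s x) s y) = y := by
    rw [inCharts, Function.comp_apply, Function.comp_apply, h₄, hy₃, (extChartAt I' x₁).right_inv hy₁]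
  have h₆ : inCharts I' I x₁ (s x) s y ∈ (extChartAt I (s x)).target :=
    (extChartAt I (s x)).map_source hy₂
  have h₇ : f ((extChartAt I (s x)).symm (inCharts I' I x₁ (s x) s y)) ∈
      (extChartAt I' x₁).source := by
    rw [h₄, hy₃]; exact (extChartAt I' x₁).map_target hy₁
  have h₈ : SharpMap.RelatedAt f π σ
      ((extChartAt I (s x)).symm (inCharts I' I x₁ (s x) s y)) := by rw [h₄]; exact hy₄
  have h₉ := (hasFDerivAt_inCharts h₆ (by rw [h₄]; exact hy₅) h₇).fderiv
  ext β : 1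
  have := SharpMap.inChart_related h₆ h₇ h₈ β
  rw [h₅] at this
  rw [this, h₉]
  rfl

theorem SharpMap.contDiffOn_inChart {π : SharpMap I M} (h : ∀ x, π.SmoothAt x) (x₀ : M) :
    ContDiffOn ℝ ∞ (π.inChart x₀) (extChartAt I x₀).target := by
  intro y hy
  -- With both the map and its section equal to the identity, the lemma becomes a change of chart.
  have := SharpMap.contDiffAt_of_related (π := π) (σ := π) (f := id) (s := id)
    ((extChartAt I x₀).map_target hy) (h _) contMDiffAt_id contMDiffAt_id (by simp)
    (Filter.Eventually.of_forall fun z β => by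
      have h : mfderiv I I id z = ContinuousLinearMap.id ℝ _ := mfderiv_id
      change _ = mfderiv I I id z (π z (_ ∘L mfderiv I I id z))
      rw [h]; rfl)
  rw [(extChartAt I x₀).right_inv hy] at this
  exact this.contDiffWithinAt

theorem BivectorField.smoothAt (π : BivectorField I M) (x : M) : π.sharp.SmoothAt x :=
  (π.smooth x).contDiffAt (extChartAt_target_mem_nhds x)

theorem half_schouten_self (π : BivectorField I M) (x : M) (α β γ : Covector I x) :
    (1 / 2 : ℝ) * schouten π π x α β γ =
    fderiv ℝ (fun y => (γ : E →L[ℝ] ℝ) (π.sharp.inChart x y β)) (extChartAt I x x)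
      (π.sharp.inChart x (extChartAt I x x) α) +
    fderiv ℝ (fun y => (α : E →L[ℝ] ℝ) (π.sharp.inChart x y γ)) (extChartAt I x x)
      (π.sharp.inChart x (extChartAt I x x) β) +
    fderiv ℝ (fun y => (β : E →L[ℝ] ℝ) (π.sharp.inChart x y α)) (extChartAt I x x)
      (π.sharp.inChart x (extChartAt I x x) γ) := by
  have key (α β γ : Covector I x) : schoutenTerm π π x α β γ =
      fderiv ℝ (fun y => (γ : E →L[ℝ] ℝ) (π.sharp.inChart x y β)) (extChartAt I x x)
      (π.sharp.inChart x (extChartAt I x x) α) := by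
    have h : ContinuousLinearMap.inverse (mfderiv I 𝓘(ℝ, E) (extChartAt I x) x) =
        (ContinuousLinearMap.id ℝ E : E →L[ℝ] TangentSpace I x) := by
      have := mfderiv_extChartAt_self (I := I) (x := x)
      rw [this]; exact ContinuousLinearMap.inverse_id
    have h' : ∀ T : E →L[ℝ] TangentSpace I x,
        T = (ContinuousLinearMap.id ℝ E : E →L[ℝ] TangentSpace I x) →
        fderiv ℝ (fun y => (γ ∘L T) (π.sharp.inChart x y (β ∘L T))) (extChartAt I x x)
          (π.sharp.inChart x (extChartAt I x x) (α ∘L T)) =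
        fderiv ℝ (fun y => (γ : E →L[ℝ] ℝ) (π.sharp.inChart x y β)) (extChartAt I x x)
          (π.sharp.inChart x (extChartAt I x x) α) := by
      rintro T rfl; rfl
    exact h' _ h
  rw [schouten, key, key, key]
  ring

theorem BivectorField.skew_inChart (π : BivectorField I M) (x₀ : M) (y : E) (β γ : E →L[ℝ] ℝ) :
    β (π.sharp.inChart x₀ y γ) = -γ (π.sharp.inChart x₀ y β) :=
  π.skew ((extChartAt I x₀).symm y)
    (γ ∘L (mfderiv I 𝓘(ℝ, E) (extChartAt I x₀) ((extChartAt I x₀).symm y) :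
      TangentSpace I ((extChartAt I x₀).symm y) →L[ℝ] E))
    (β ∘L (mfderiv I 𝓘(ℝ, E) (extChartAt I x₀) ((extChartAt I x₀).symm y) :
      TangentSpace I ((extChartAt I x₀).symm y) →L[ℝ] E))

/-- Naturality of the Schouten bracket of a bivector field with itself. -/
theorem half_schouten_related {π : BivectorField I M} {σ : BivectorField I' M'} {f : M → M'} {x : M}
    (hf : ContMDiffAt I I' ∞ f x) (hrel : ∀ z, SharpMap.RelatedAt f π.sharp σ.sharp z)
    (α β γ : Covector I' (f x)) :
    (1 / 2 : ℝ) * schouten σ σ (f x) α β γ =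
      (1 / 2 : ℝ) * schouten π π x (α ∘L mfderiv I I' f x) (β ∘L mfderiv I I' f x)
        (γ ∘L mfderiv I I' f x) := by
  have hy : extChartAt I x x ∈ (extChartAt I x).target := mem_extChartAt_target x
  have hl : (extChartAt I x).symm (extChartAt I x x) = x := extChartAt_to_inv x
  have h₁ : f ((extChartAt I x).symm (extChartAt I x x)) ∈ (extChartAt I' (f x)).source := by
    rw [hl]; exact mem_extChartAt_source _
  have hf' := hf
  rw [← hl] at hf
  have h₂ : inCharts I I' x (f x) f (extChartAt I x x) = extChartAt I' (f x) (f x) := by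
    simp [inCharts]
  have hσ : DifferentiableAt ℝ (σ.sharp.inChart (f x)) (inCharts I I' x (f x) f (extChartAt I x x)) := by
    rw [h₂]; exact ContDiffAt.differentiableAt (σ.smoothAt (f x)) (by simp)
  have h := cyclic_fderiv_bivector_related (π := π.sharp.inChart x) (σ := σ.sharp.inChart (f x))
    (f := inCharts I I' x (f x) f) (ContDiffAt.differentiableAt (π.smoothAt x) (by simp)) hσ
    (contDiffAt_inCharts hy hf h₁) (fun β γ => π.skew_inChart x _ β γ) (by
      filter_upwards [eventually_mem_target hy, eventually_mem_source hy hf.continuousAt h₁,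
        ContMDiffAt.eventually_inChart hy hf] with y hy₁ hy₂ hy₃ β
      rw [(hasFDerivAt_inCharts hy₁ hy₃ hy₂).fderiv]
      exact SharpMap.inChart_related hy₁ hy₂ (hrel _) β) α β γ
  have h₃ : fderiv ℝ (inCharts I I' x (f x) f) (extChartAt I x x) =
      (mfderiv I I' f x : E →L[ℝ] E') := by
    have h := hf'.mdifferentiableAt (by simp)
    rw [h.mfderiv, I.range_eq_univ, fderivWithin_univ]
    rfl
  rw [h₂, h₃] at h
  refine (half_schouten_self σ (f x) α β γ).trans (h.trans ?_)
  exact (half_schouten_self π x _ _ _).symm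

end Bivectors

end Nonholonomic

end

noncomputable section

set_option linter.unusedSectionVars false

namespace Nonholonomic

/-! ### Smooth actions and invariant one-forms -/

section NormedSpaceForms

variable {E : Type*} [NormedAddCommGroup E] [NormedSpace ℝ E]
  {F : Type*} [NormedAddCommGroup F] [NormedSpace ℝ F]

theorem DForm.inChart_normedSpace {k : ℕ} (η : DForm 𝓘(ℝ, E) E F k) (x₀ : E) :
    η.inChart x₀ = fun y => (η y : E [⋀^Fin k]→L[ℝ] F) := by
  funext y
  ext v
  refine congrArg (η y) (funext fun i => ?_)
  have : mfderiv 𝓘(ℝ, E) 𝓘(ℝ, E) (id : E → E) y = ContinuousLinearMap.id ℝ _ := mfderiv_id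
  exact DFunLike.congr_fun this (v i)

theorem fderiv_inl_eq_zero {E₁ E₂ : Type*} [NormedAddCommGroup E₁] [NormedSpace ℝ E₁]
    [NormedAddCommGroup E₂] [NormedSpace ℝ E₂] {f : E₁ × E₂ → F} {a : E₁} {b : E₂} {c : F}
    (hf : DifferentiableAt ℝ f (a, b)) (h : ∀ᶠ z in 𝓝 a, f (z, b) = c) (u : E₁) :
    fderiv ℝ f (a, b) (u, 0) = 0 := by
  have h₁ := HasFDerivAt.comp (f := fun z => (z, b)) a hf.hasFDerivAt (hasFDerivAt_prodMk_left a b)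
  have h₂ : (f ∘ fun z => (z, b)) =ᶠ[𝓝 a] fun _ => c := h
  have h₃ := h₁.unique ((hasFDerivAt_const c a).congr_of_eventuallyEq h₂)
  simpa using DFunLike.congr_fun h₃ u

theorem fderiv_inr_eq_zero {E₁ E₂ : Type*} [NormedAddCommGroup E₁] [NormedSpace ℝ E₁]
    [NormedAddCommGroup E₂] [NormedSpace ℝ E₂] {f : E₁ × E₂ → F} {a : E₁} {b : E₂} {c : F}
    (hf : DifferentiableAt ℝ f (a, b)) (h : ∀ᶠ z in 𝓝 b, f (a, z) = c) (u : E₂) :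
    fderiv ℝ f (a, b) (0, u) = 0 := by
  have h₁ := HasFDerivAt.comp (f := fun z => (a, z)) b hf.hasFDerivAt (hasFDerivAt_prodMk_right a b)
  have h₂ : (f ∘ fun z => (a, z)) =ᶠ[𝓝 b] fun _ => c := h
  have h₃ := h₁.unique ((hasFDerivAt_const c b).congr_of_eventuallyEq h₂)
  simpa using DFunLike.congr_fun h₃ u

end NormedSpaceForms

section Actions

variable {EG : Type*} [NormedAddCommGroup EG] [NormedSpace ℝ EG]
  {HG : Type*} [TopologicalSpace HG] {IG : ModelWithCorners ℝ EG HG} [IG.Boundaryless]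
  {G : Type*} [TopologicalSpace G] [ChartedSpace HG G] [Group G] [IsManifold IG ∞ G]
  {E : Type*} [NormedAddCommGroup E] [NormedSpace ℝ E]
  {H : Type*} [TopologicalSpace H] {I : ModelWithCorners ℝ E H} [I.Boundaryless]
  {M : Type*} [TopologicalSpace M] [ChartedSpace H M] [IsManifold I ∞ M] [MulAction G M]
  {F : Type*} [NormedAddCommGroup F] [NormedSpace ℝ F]

theorem contMDiff_smul_right (hsm : ContMDiff (IG.prod I) I ∞ (fun p : G × M => p.1 • p.2)) (m : M) :
    ContMDiff IG I ∞ (fun g : G => g • m) :=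
  hsm.comp (contMDiff_id.prodMk contMDiff_const)

theorem contMDiff_smul_left (hsm : ContMDiff (IG.prod I) I ∞ (fun p : G × M => p.1 • p.2)) (g : G) :
    ContMDiff I I ∞ (fun m : M => g • m) :=
  hsm.comp (contMDiff_const.prodMk contMDiff_id)

/-- An infinitesimal Cartan formula: contraction of `dη` with a generator `ξ_M`, when `η (ξ_M)` is
constant and `η` is constant on the orbit of `Y`. -/
theorem d_apply_infGen_eq_zero (hsm : ContMDiff (IG.prod I) I ∞ (fun p : G × M => p.1 • p.2))
    {η : DForm I M F 1} {m : M} (hη : η.SmoothAt m) {ξ : EG} {Y : TangentSpace I m} {c c' : F}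
    (hY : ∀ g : G, η (g • m) ![mfderiv I I (fun m : M => g • m) m Y] = c)
    (hξ : ∀ m' : M, η m' ![infGen IG G I m' ξ] = c') :
    η.d m ![infGen IG G I m ξ, Y] = 0 := by
  set χ := extChartAt IG (1 : G) with hχ
  set φ := extChartAt I m with hφ
  set p₀ : EG × E := (χ 1, φ m) with hp₀
  -- The action map in charts of `G` at `1` and of `M` at `m`. Its derivative sends `(ξ, 0)` to the
  -- generator and `(0, Y)` to the translate of `Y`, so pulling `η` back replaces flows and Lie
  -- derivatives by two partial derivatives.
  set f : EG × E → M := fun p => χ.symm p.1 • φ.symm p.2 with hf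
  have hχ1 : χ.symm (χ 1) = 1 := extChartAt_to_inv _
  have hφm : φ.symm (φ m) = m := extChartAt_to_inv _
  have hfp₀ : f p₀ = m := by
    change χ.symm (χ 1) • φ.symm (φ m) = m
    rw [hχ1, hφm, one_smul]
  have hsmooth (a : EG) (y : E) (ha : a ∈ χ.target) (hy : y ∈ φ.target) :
      ContMDiffAt 𝓘(ℝ, EG × E) I ∞ f (a, y) := by
    have h₁ : ContMDiffAt 𝓘(ℝ, EG × E) IG ∞ (fun p : EG × E => χ.symm p.1) (a, y) :=
      ContMDiffAt.comp (g := χ.symm) (a, y) (contMDiffAt_extChartAt_symm ha)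
        contDiffAt_fst.contMDiffAt
    have h₂ : ContMDiffAt 𝓘(ℝ, EG × E) I ∞ (fun p : EG × E => φ.symm p.2) (a, y) :=
      ContMDiffAt.comp (g := φ.symm) (a, y) (contMDiffAt_extChartAt_symm hy)
        contDiffAt_snd.contMDiffAt
    exact ContMDiffAt.comp (g := fun p : G × M => p.1 • p.2) (a, y) hsm.contMDiffAt (h₁.prodMk h₂)
  have ht₁ : χ 1 ∈ χ.target := mem_extChartAt_target _
  have ht₂ : φ m ∈ φ.target := mem_extChartAt_target _
  have hinr (a : EG) (ha : a ∈ χ.target) (Y : E) : mfderiv 𝓘(ℝ, EG × E) I f (a, φ m) ((0, Y) : EG × E) =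
      mfderiv I I (fun m : M => χ.symm a • m) (φ.symm (φ m)) Y := by
    have h₁ : HasMFDerivAt 𝓘(ℝ, E) 𝓘(ℝ, EG × E) (fun y : E => (a, y)) (φ m)
        (ContinuousLinearMap.inr ℝ EG E) := (hasFDerivAt_prodMk_right a (φ m)).hasMFDerivAt
    have h₂ := (((hsmooth a (φ m) ha ht₂).mdifferentiableAt (by simp)).hasMFDerivAt.comp (φ m)
      h₁).mfderiv
    have h₃ := (((contMDiff_smul_left hsm (χ.symm a)).contMDiffAt
      (x := φ.symm (φ m))).mdifferentiableAt (by simp)).hasMFDerivAt.comp (φ m)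
      (mdifferentiableAt_extChartAt_symm ht₂).hasMFDerivAt |>.mfderiv
    have h₄ := DFunLike.congr_fun (h₂.symm.trans h₃) Y
    refine Eq.trans ?_ (h₄.trans ?_)
    · rfl
    · exact congrArg (mfderiv I I (fun m : M => χ.symm a • m) (φ.symm (φ m)))
        (DFunLike.congr_fun (mfderiv_symm_self (I := I) m) Y)
  have hinl (y : E) (hy : y ∈ φ.target) : mfderiv 𝓘(ℝ, EG × E) I f (χ 1, y) ((ξ, 0) : EG × E) =
      mfderiv IG I (fun g : G => g • φ.symm y) (χ.symm (χ 1)) ξ := by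
    have h₁ : HasMFDerivAt 𝓘(ℝ, EG) 𝓘(ℝ, EG × E) (fun a : EG => (a, y)) (χ 1)
        (ContinuousLinearMap.inl ℝ EG E) := (hasFDerivAt_prodMk_left (χ 1) y).hasMFDerivAt
    have h₂ := (((hsmooth (χ 1) y ht₁ hy).mdifferentiableAt (by simp)).hasMFDerivAt.comp (χ 1)
      h₁).mfderiv
    have h₃ := (((contMDiff_smul_right hsm (φ.symm y)).contMDiffAt
      (x := χ.symm (χ 1))).mdifferentiableAt (by simp)).hasMFDerivAt.comp (χ 1)
      (mdifferentiableAt_extChartAt_symm ht₁).hasMFDerivAt |>.mfderiv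
    have h₄ := DFunLike.congr_fun (h₂.symm.trans h₃) ξ
    refine Eq.trans ?_ (h₄.trans ?_)
    · rfl
    · exact congrArg (mfderiv IG I (fun g : G => g • φ.symm y) (χ.symm (χ 1)))
        (DFunLike.congr_fun (mfderiv_symm_self (I := IG) (1 : G)) ξ)
  have hηf : η.SmoothAt (f p₀) := by rw [hfp₀]; exact hη
  have hfs : ContMDiffAt 𝓘(ℝ, EG × E) I ∞ f p₀ := hsmooth _ _ ht₁ ht₂
  have hd := DFunLike.congr_fun (DForm.d_pullback hηf hfs)
    (![((ξ, 0) : EG × E), ((0, Y) : EG × E)] : Fin 2 → EG × E)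
  let ζ : EG × E → (EG × E) [⋀^Fin 1]→L[ℝ] F := DForm.pullback 𝓘(ℝ, EG × E) I f η
  have hsm' : DifferentiableAt ℝ ζ p₀ := by
    have h := ContDiffAt.differentiableAt (hηf.pullback hfs) (by simp)
    rw [DForm.inChart_normedSpace] at h
    exact h
  have hD (v : EG × E) : DifferentiableAt ℝ (fun y => ζ y ![v]) p₀ :=
    (hsm'.hasFDerivAt.continuousAlternatingMap_apply_const ![v]).differentiableAt
  have hl : (DForm.pullback 𝓘(ℝ, EG × E) I f η).d p₀
      (![((ξ, 0) : EG × E), ((0, Y) : EG × E)] : Fin 2 → EG × E) = 0 := by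
    have e₀ : (DForm.pullback 𝓘(ℝ, EG × E) I f η).inChart p₀ = ζ := DForm.inChart_normedSpace _ _
    refine (DForm.d_apply (DForm.pullback 𝓘(ℝ, EG × E) I f η) p₀ _).trans ?_
    rw [e₀]
    refine (extDeriv_one_apply hsm' _ _).trans ?_
    -- Along the group direction the function is `η` on translates of `Y`, constant by `hY`; in
    -- `e₂`, along the manifold direction, it is `η` on the generator, constant by `hξ`.
    have e₁ := fderiv_inl_eq_zero (c := c) (hD (0, Y)) (by
      filter_upwards [extChartAt_target_mem_nhds (I := IG) (1 : G)] with a ha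
      have key : ∀ z : M, z = m → ∀ g : G,
          η (g • z) ![mfderiv I I (fun m : M => g • m) z (Y : E)] = c := by
        rintro z rfl g; exact hY g
      rw [← key (φ.symm (φ m)) hφm (χ.symm a)]
      refine congrArg (η (χ.symm a • φ.symm (φ m))) (funext fun i => ?_)
      fin_cases i
      exact hinr a ha Y) ξ
    have e₂ := fderiv_inr_eq_zero (c := c') (hD (ξ, 0)) (by
      filter_upwards [extChartAt_target_mem_nhds (I := I) m] with y hy
      have key : ∀ z : G, z = 1 →
          η (z • φ.symm y) ![mfderiv IG I (fun g : G => g • φ.symm y) z (ξ : EG)] = c' := by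
        rintro z rfl
        have key' : ∀ w : M, w = φ.symm y → η w ![(infGen IG G I (φ.symm y) ξ : E)] = c' := by
          rintro w rfl; exact hξ _
        exact key' _ (one_smul G _)
      rw [← key (χ.symm (χ 1)) hχ1]
      refine congrArg (η (χ.symm (χ 1) • φ.symm y)) (funext fun i => ?_)
      fin_cases i
      exact hinl y hy) Y
    exact (congrArg₂ _ e₁ e₂).trans (sub_zero _)
  have hd' := hl.symm.trans hd
  have h₁ : mfderiv 𝓘(ℝ, EG × E) I f p₀ ((ξ, 0) : EG × E) = infGen IG G I m ξ := by
    have key : ∀ z : G, z = 1 → ∀ w : M, w = m →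
        (mfderiv IG I (fun g : G => g • w) z (ξ : EG) : E) = infGen IG G I m ξ := by
      rintro z rfl w rfl; rfl
    exact (hinl _ ht₂).trans (key _ hχ1 _ hφm)
  have h₂ : mfderiv 𝓘(ℝ, EG × E) I f p₀ ((0, Y) : EG × E) = (Y : E) := by
    have key : ∀ z : G, z = 1 → ∀ w : M, w = m →
        (mfderiv I I (fun m : M => z • m) w (Y : E) : E) = Y := by
      rintro z rfl w rfl
      have : (fun m : M => (1 : G) • m) = id := by funext m; exact one_smul G m
      rw [this]
      exact DFunLike.congr_fun (mfderiv_id (I := I) (x := w)) Y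
    exact (hinr _ ht₁ Y).trans (key _ hχ1 _ hφm)
  have key : ∀ w : M, w = m → η.d w (![(infGen IG G I m ξ : E), (Y : E)] : Fin 2 → E) =
      η.d m ![infGen IG G I m ξ, Y] := by
    rintro w rfl; rfl
  refine (key _ hfp₀).symm.trans (Eq.trans ?_ hd'.symm)
  refine congrArg (η.d (f p₀)) (funext fun i => ?_)
  fin_cases i
  · exact h₁.symm
  · exact h₂.symm

end Actions

end Nonholonomic

end

noncomputable section

set_option linter.unusedSectionVars false

namespace Nonholonomic

/-! ### Local kernels of subbundles -/

section LocalKernel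

variable {X : Type*} [NormedAddCommGroup X] [NormedSpace ℝ X]
  {V : Type*} [NormedAddCommGroup V] [NormedSpace ℝ V] [FiniteDimensional ℝ V]
  {R : Type*} [NormedAddCommGroup R] [NormedSpace ℝ R] [FiniteDimensional ℝ R]

theorem contDiffAt_inverse {S : X → R →L[ℝ] R} {x : X} (hS : ContDiffAt ℝ ∞ S x)
    (h : (S x).IsInvertible) : ContDiffAt ℝ ∞ (fun y => (S y).inverse) x :=
  ContDiffAt.comp (g := ContinuousLinearMap.inverse) x h.contDiffAt_map_inverse hS

theorem eventually_isInvertible {S : X → R →L[ℝ] R} {x : X} (hS : ContinuousAt S x)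
    (h : (S x).IsInvertible) : ∀ᶠ y in 𝓝 x, (S y).IsInvertible := by
  obtain ⟨e, he⟩ := h
  have := ContinuousLinearEquiv.nhds e
  rw [he] at this
  exact hS.eventually this

/-- A smooth family of injective maps has smooth families of left inverses. -/
theorem exists_contDiffAt_leftInverse {Y : X → R →L[ℝ] V} {x : X} (hY : ContDiffAt ℝ ∞ Y x)
    (hinj : Function.Injective (Y x)) :
    ∃ L : X → V →L[ℝ] R, ContDiffAt ℝ ∞ L x ∧ ∀ᶠ y in 𝓝 x, ∀ c, L y (Y y c) = c := by
  obtain ⟨L₀, hL₀⟩ := LinearMap.exists_leftInverse_of_injective (Y x).toLinearMap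
    (LinearMap.ker_eq_bot.2 hinj)
  set L : V →L[ℝ] R := LinearMap.toContinuousLinearMap L₀
  have h₁ : L ∘L Y x = ContinuousLinearMap.id ℝ R := by
    ext c; exact LinearMap.congr_fun hL₀ c
  have hS : ContDiffAt ℝ ∞ (fun y => L ∘L Y y) x := contDiffAt_const.clm_comp hY
  have hinv : (L ∘L Y x).IsInvertible := by rw [h₁]; exact ⟨ContinuousLinearEquiv.refl ℝ R, rfl⟩
  -- A left inverse `L` at the centre is corrected nearby by the inverse of `L ∘ Y`, an endomorphism
  -- close to the identity.
  refine ⟨fun y => (L ∘L Y y).inverse ∘L L, (contDiffAt_inverse hS hinv).clm_comp contDiffAt_const, ?_⟩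
  filter_upwards [eventually_isInvertible hS.continuousAt hinv] with y hy c
  exact DFunLike.congr_fun hy.inverse_comp_self c

/-- The ranges of a smooth family of injective maps are locally the kernels of a smooth family. -/
theorem exists_contDiffAt_ker_eq_range {Y : X → R →L[ℝ] V} {x : X} (hY : ContDiffAt ℝ ∞ Y x)
    (hinj : Function.Injective (Y x)) :
    ∃ e : X → V →L[ℝ] V, ContDiffAt ℝ ∞ e x ∧ ∀ᶠ y in 𝓝 x, ∀ v, e y v = 0 ↔ ∃ c, Y y c = v := by
  obtain ⟨L, hL, hLY⟩ := exists_contDiffAt_leftInverse hY hinj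
  -- `Y L` is a projection onto the range of `Y`, so the complementary projection has that range as
  -- its kernel.
  refine ⟨fun y => ContinuousLinearMap.id ℝ V - Y y ∘L L y,
    contDiffAt_const.sub (hY.clm_comp hL), ?_⟩
  filter_upwards [hLY] with y hy v
  constructor
  · intro h
    exact ⟨L y v, (sub_eq_zero.1 h).symm⟩
  · rintro ⟨c, rfl⟩
    change Y y c - Y y (L y (Y y c)) = 0
    rw [hy, sub_self]

end LocalKernel

/-! ### Immersions and submersions -/

section ImmersionSubmersion

variable {E : Type*} [NormedAddCommGroup E] [NormedSpace ℝ E]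
  {H : Type*} [TopologicalSpace H] {I : ModelWithCorners ℝ E H} [I.Boundaryless]
  {M : Type*} [TopologicalSpace M] [ChartedSpace H M] [IsManifold I ∞ M]
  {E' : Type*} [NormedAddCommGroup E'] [NormedSpace ℝ E']
  {H' : Type*} [TopologicalSpace H'] {I' : ModelWithCorners ℝ E' H'} [I'.Boundaryless]
  {N : Type*} [TopologicalSpace N] [ChartedSpace H' N] [IsManifold I' ∞ N]

theorem contMDiffAt_extend_symm {c : OpenPartialHomeomorph M H}
    (hc : c ∈ IsManifold.maximalAtlas I ∞ M) {y : E} (hy : y ∈ (c.extend I).target) :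
    ContMDiffAt 𝓘(ℝ, E) I ∞ (c.extend I).symm y := by
  refine (contMDiffOn_extend_symm hc).contMDiffAt ?_
  rw [← OpenPartialHomeomorph.extend_target']
  rw [OpenPartialHomeomorph.extend_target, I.range_eq_univ, Set.inter_univ] at hy ⊢
  exact (c.open_target.preimage I.continuous_symm).mem_nhds hy

/-- In adapted charts an immersion is `u ↦ (u, 0)`, and the projection to the first factor undoes
it. -/
theorem exists_local_leftInverse {f : M → N} {x : M} (hf : Manifold.IsImmersionAt I I' ∞ f x) :
    ∃ r : N → M, ContMDiffAt I' I ∞ r (f x) ∧ ∀ᶠ y in 𝓝 x, r (f y) = y := by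
  refine ⟨fun z => (hf.domChart.extend I).symm (hf.equiv.symm (hf.codChart.extend I' z)).1, ?_, ?_⟩
  · have h₁ : ContMDiffAt I' 𝓘(ℝ, E') ∞ (hf.codChart.extend I') (f x) :=
      hf.codChart.contMDiffAt_extend hf.codChart_mem_maximalAtlas hf.mem_codChart_source
    have h₂ : ContMDiffAt I' 𝓘(ℝ, E) ∞
        (fun z => (hf.equiv.symm (hf.codChart.extend I' z)).1) (f x) :=
      (ContDiff.contMDiff (f := fun w => (hf.equiv.symm w).1)
        (hf.equiv.symm.contDiff.fst)).contMDiffAt.comp (f x) h₁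
    have h₃ : (hf.equiv.symm (hf.codChart.extend I' (f x))).1 = hf.domChart.extend I x := by
      have := hf.writtenInCharts ((hf.domChart.extend I).map_source
        (by rw [OpenPartialHomeomorph.extend_source]; exact hf.mem_domChart_source))
      simp only [Function.comp_apply] at this
      rw [(hf.domChart.extend I).left_inv
        (by rw [OpenPartialHomeomorph.extend_source]; exact hf.mem_domChart_source)] at this
      rw [this, ContinuousLinearEquiv.symm_apply_apply]
    refine ContMDiffAt.comp (g := (hf.domChart.extend I).symm) (f x) ?_ h₂
    rw [h₃]
    exact contMDiffAt_extend_symm hf.domChart_mem_maximalAtlas ((hf.domChart.extend I).map_source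
      (by rw [OpenPartialHomeomorph.extend_source]; exact hf.mem_domChart_source))
  · filter_upwards [hf.domChart.open_source.mem_nhds hf.mem_domChart_source] with y hy
    have hy' : y ∈ (hf.domChart.extend I).source := by
      rwa [OpenPartialHomeomorph.extend_source]
    have := hf.writtenInCharts ((hf.domChart.extend I).map_source hy')
    simp only [Function.comp_apply] at this
    rw [(hf.domChart.extend I).left_inv hy'] at this
    rw [this, ContinuousLinearEquiv.symm_apply_apply, (hf.domChart.extend I).left_inv hy']

theorem injective_mfderiv_of_isImmersionAt {f : M → N} {x : M}
    (hf : Manifold.IsImmersionAt I I' ∞ f x) : Function.Injective (mfderiv I I' f x) := by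
  obtain ⟨r, hr, hrf⟩ := exists_local_leftInverse hf
  have h₁ := ((hr.mdifferentiableAt (by simp)).hasMFDerivAt.comp x
    (hf.contMDiffAt.mdifferentiableAt (by simp)).hasMFDerivAt).congr_of_eventuallyEq
      (f₁ := id) (hrf.mono fun y hy => hy.symm)
  have h₂ := h₁.mfderiv.symm.trans (mfderiv_id (I := I) (x := x))
  intro u v huv
  have h₃ := DFunLike.congr_fun h₂
  exact (h₃ u).symm.trans ((congrArg (mfderiv I' I r (f x)) huv).trans (h₃ v))

/-- A submersion looks like a projection in a local parametrization. -/
theorem exists_local_parametrization {f : M → N} {x : M}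
    (hf : Manifold.IsSubmersionAt I I' ∞ f x) :
    ∃ (p₀ : E' × hf.complement) (Ψ : E' × hf.complement → M) (Φ : M → E' × hf.complement)
      (σ : E' → N) (c : N → E'), Φ x = p₀ ∧ Ψ p₀ = x ∧ c (f x) = p₀.1 ∧
      ContMDiffAt 𝓘(ℝ, E' × hf.complement) I ∞ Ψ p₀ ∧
      ContMDiffAt I 𝓘(ℝ, E' × hf.complement) ∞ Φ x ∧
      ContMDiffAt I' 𝓘(ℝ, E') ∞ c (f x) ∧
      (∀ᶠ y in 𝓝 x, Ψ (Φ y) = y) ∧ (∀ᶠ p in 𝓝 p₀, Φ (Ψ p) = p) ∧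
      (∀ᶠ z in 𝓝 (f x), σ (c z) = z) ∧ (∀ᶠ p in 𝓝 p₀, f (Ψ p) = σ p.1) ∧
      (∀ᶠ y in 𝓝 x, c (f y) = (Φ y).1) := by
  have hx : x ∈ (hf.domChart.extend I).source := by
    rw [OpenPartialHomeomorph.extend_source]; exact hf.mem_domChart_source
  have hxt := (hf.domChart.extend I).map_source hx
  have hsrc : ∀ᶠ y in 𝓝 x, y ∈ (hf.domChart.extend I).source := by
    rw [OpenPartialHomeomorph.extend_source]
    exact hf.domChart.open_source.mem_nhds hf.mem_domChart_source
  have hsrc' : ∀ᶠ z in 𝓝 (f x), z ∈ (hf.codChart.extend I').source := by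
    rw [OpenPartialHomeomorph.extend_source]
    exact hf.codChart.open_source.mem_nhds hf.mem_codChart_source
  have htgt : ∀ᶠ p in 𝓝 (hf.equiv (hf.domChart.extend I x)),
      hf.equiv.symm p ∈ (hf.domChart.extend I).target := by
    refine hf.equiv.symm.continuous.continuousAt.eventually_mem ?_
    rw [ContinuousLinearEquiv.symm_apply_apply, OpenPartialHomeomorph.extend_target,
      I.range_eq_univ, Set.inter_univ] at *
    exact (hf.domChart.open_target.preimage I.continuous_symm).mem_nhds hxt
  have hwr (y : M) (hy : y ∈ (hf.domChart.extend I).source) :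
      hf.codChart.extend I' (f y) = (hf.equiv (hf.domChart.extend I y)).1 := by
    have := hf.writtenInCharts ((hf.domChart.extend I).map_source hy)
    simp only [Function.comp_apply] at this
    rwa [(hf.domChart.extend I).left_inv hy] at this
  refine ⟨hf.equiv (hf.domChart.extend I x), fun p => (hf.domChart.extend I).symm (hf.equiv.symm p),
    fun y => hf.equiv (hf.domChart.extend I y), (hf.codChart.extend I').symm,
    hf.codChart.extend I', rfl, ?_, hwr x hx, ?_, ?_, ?_, ?_, ?_, ?_, ?_, ?_⟩
  · beta_reduce
    rw [ContinuousLinearEquiv.symm_apply_apply, (hf.domChart.extend I).left_inv hx]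
  · refine ContMDiffAt.comp (g := (hf.domChart.extend I).symm) _ ?_
      hf.equiv.symm.contDiff.contMDiff.contMDiffAt
    rw [ContinuousLinearEquiv.symm_apply_apply]
    exact contMDiffAt_extend_symm hf.domChart_mem_maximalAtlas hxt
  · exact ContMDiffAt.comp (g := hf.equiv) _ hf.equiv.contDiff.contMDiff.contMDiffAt
      (hf.domChart.contMDiffAt_extend hf.domChart_mem_maximalAtlas hf.mem_domChart_source)
  · exact hf.codChart.contMDiffAt_extend hf.codChart_mem_maximalAtlas hf.mem_codChart_source
  · filter_upwards [hsrc] with y hy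
    rw [ContinuousLinearEquiv.symm_apply_apply, (hf.domChart.extend I).left_inv hy]
  · filter_upwards [htgt] with p hp
    rw [(hf.domChart.extend I).right_inv hp, ContinuousLinearEquiv.apply_symm_apply]
  · filter_upwards [hsrc'] with z hz using (hf.codChart.extend I').left_inv hz
  · filter_upwards [htgt] with p hp
    have h₁ := (hf.domChart.extend I).map_target hp
    have h₂ := hwr _ h₁
    rw [(hf.domChart.extend I).right_inv hp, ContinuousLinearEquiv.apply_symm_apply] at h₂
    rw [← h₂, (hf.codChart.extend I').left_inv]
    rw [OpenPartialHomeomorph.extend_source] at h₁ ⊢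
    exact hf.source_subset_preimage_source h₁
  · filter_upwards [hsrc] with y hy using hwr y hy

end ImmersionSubmersion

/-! ### The cotangent bundle in coordinates -/

section Cotangent

variable {E : Type*} [NormedAddCommGroup E] [NormedSpace ℝ E]
  {H : Type*} [TopologicalSpace H] {I : ModelWithCorners ℝ E H} [I.Boundaryless]
  {Q : Type*} [TopologicalSpace Q] [ChartedSpace H Q] [IsManifold I ∞ Q]
  {E' : Type*} [NormedAddCommGroup E'] [NormedSpace ℝ E']
  {H' : Type*} [TopologicalSpace H'] {I' : ModelWithCorners ℝ E' H'} [I'.Boundaryless]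
  {M : Type*} [TopologicalSpace M] [ChartedSpace H' M] [IsManifold I' ∞ M]
  {EX : Type*} [NormedAddCommGroup EX] [NormedSpace ℝ EX]
  {HX : Type*} [TopologicalSpace HX] {IX : ModelWithCorners ℝ EX HX}
  {X : Type*} [TopologicalSpace X] [ChartedSpace HX X]

/-- The topological embedding gives continuity of `f` and the immersion then gives smoothness.
Everything about the constraint manifold is thereby checked in the cotangent bundle. -/
theorem contMDiffAt_of_comp_embedding {EN : Type*} [NormedAddCommGroup EN] [NormedSpace ℝ EN]
    {HN : Type*} [TopologicalSpace HN] {J : ModelWithCorners ℝ EN HN}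
    {N : Type*} [TopologicalSpace N] [ChartedSpace HN N] {ι : M → N}
    (hι : Manifold.IsSmoothEmbedding I' J ∞ ι) {f : X → M} {x : X}
    (h : ContMDiffAt IX J ∞ (ι ∘ f) x) : ContMDiffAt IX I' ∞ f x :=
  (ContMDiffAt.iff_comp_isImmersionAtOfComplement
    (hι.isImmersion.isImmersionAt (f x)).isImmersionAtOfComplement_complement).2
    ⟨hι.isEmbedding.continuousAt_iff.2 h.continuousAt, h⟩

/-- A covector at `q`, in the coordinates around `q₀`. -/
def localCovector (q₀ q : Q) (p : TangentSpace I q →L[ℝ] ℝ) : E →L[ℝ] ℝ :=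
  (p : E →L[ℝ] ℝ) ∘L (mfderiv 𝓘(ℝ, E) I (extChartAt I q₀).symm (extChartAt I q₀ q) : E →L[ℝ] E)

theorem localCovector_self (q : Q) (p : TangentSpace I q →L[ℝ] ℝ) : localCovector q q p = p := by
  ext v
  exact congrArg (p : E →L[ℝ] ℝ) (DFunLike.congr_fun (mfderiv_symm_self (I := I) q) v)

theorem localCovector_apply {q₀ q : Q} (hq : q ∈ (extChartAt I q₀).source)
    (p : TangentSpace I q →L[ℝ] ℝ) (v : TangentSpace I q) :
    localCovector q₀ q p (mfderiv I 𝓘(ℝ, E) (extChartAt I q₀) q v) = p v :=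
  congrArg (p : E →L[ℝ] ℝ) (DFunLike.congr_fun (mfderiv_symm_comp_mfderiv' (I := I) hq) v)

/-- This provides coordinates `(q, p)` on the cotangent bundle: in the trivialization a covector is
precomposed with the derivative of the inverse chart. -/
theorem contMDiffAt_cotangent_iff {f : X → CotangentBundle I Q} {x : X} :
    ContMDiffAt IX (cotangentModel I) ∞ f x ↔ ContMDiffAt IX I ∞ (fun y => (f y).1) x ∧
      ContMDiffAt IX 𝓘(ℝ, E →L[ℝ] ℝ) ∞ (fun y => localCovector (f x).1 (f y).1 (f y).2) x := by
  rw [contMDiffAt_hom_bundle]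
  refine and_congr_right fun h => Filter.EventuallyEq.contMDiffAt_iff ?_
  have h₁ : ∀ᶠ y in 𝓝 x, (f y).1 ∈ (chartAt H (f x).1).source :=
    h.continuousAt.eventually_mem ((chartAt H (f x).1).open_source.mem_nhds (mem_chart_source _ _))
  filter_upwards [h₁] with y hy
  have h₂ := TangentBundle.symmL_trivializationAt (I := I) hy
  rw [I.range_eq_univ, mfderivWithin_univ] at h₂
  rw [ContinuousLinearMap.inCoordinates, h₂]
  have h₃ := Bundle.Trivial.continuousLinearMapAt_trivialization ℝ Q ℝ (f y).1
  ext v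
  exact DFunLike.congr_fun h₃ _

end Cotangent

end Nonholonomic

end

noncomputable section

set_option linter.unusedSectionVars false

namespace Nonholonomic

/-! ### The Liouville form and its restriction -/

section Liouville

variable {E : Type*} [NormedAddCommGroup E] [NormedSpace ℝ E]
  {H : Type*} [TopologicalSpace H] {I : ModelWithCorners ℝ E H} [I.Boundaryless]
  {Q : Type*} [TopologicalSpace Q] [ChartedSpace H Q] [IsManifold I ∞ Q]
  {E' : Type*} [NormedAddCommGroup E'] [NormedSpace ℝ E']
  {H' : Type*} [TopologicalSpace H'] {I' : ModelWithCorners ℝ E' H'} [I'.Boundaryless]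
  {M : Type*} [TopologicalSpace M] [ChartedSpace H' M] [IsManifold I' ∞ M]
  {F : Type*} [NormedAddCommGroup F] [NormedSpace ℝ F]

theorem mfderiv_eq_fderiv_inChart {f : M → F} {x : M} (hf : MDifferentiableAt I' 𝓘(ℝ, F) f x) :
    (mfderiv I' 𝓘(ℝ, F) f x : E' →L[ℝ] F) =
      fderiv ℝ (fun y => f ((extChartAt I' x).symm y)) (extChartAt I' x x) := by
  rw [hf.mfderiv, I'.range_eq_univ, fderivWithin_univ]
  rfl

theorem fderiv_inCharts_self {f : M → Q} {x : M} (hf : MDifferentiableAt I' I f x) :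
    fderiv ℝ (inCharts I' I x (f x) f) (extChartAt I' x x) = (mfderiv I' I f x : E' →L[ℝ] E) := by
  rw [hf.mfderiv, I'.range_eq_univ, fderivWithin_univ]
  rfl

/-- The exterior derivative of a form `P dF` on a normed space. -/
theorem extDeriv_comp_fderiv {ζ : E' → E' [⋀^Fin 1]→L[ℝ] ℝ} {P : E' → E →L[ℝ] ℝ} {f : E' → E}
    {x : E'} (hζ : ζ =ᶠ[𝓝 x] fun y => ContinuousAlternatingMap.ofSubsingletonLIE (𝕜 := ℝ) (E := E')
      (F := ℝ) (0 : Fin 1) (P y ∘L fderiv ℝ f y)) (hP : DifferentiableAt ℝ P x)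
    (hf : ContDiffAt ℝ ∞ f x) (u v : E') :
    extDeriv ζ x ![u, v] = fderiv ℝ P x u (fderiv ℝ f x v) - fderiv ℝ P x v (fderiv ℝ f x u) := by
  have hD : DifferentiableAt ℝ (fderiv ℝ f) x :=
    (hf.fderiv_right (m := ∞) (by simp)).differentiableAt (by simp)
  have h₀ := hP.hasFDerivAt.clm_comp hD.hasFDerivAt
  rw [hζ.extDeriv_eq, extDeriv_one_apply ((LinearIsometryEquiv.differentiable _ _).comp x
    h₀.differentiableAt)]
  have key (u v : E') : fderiv ℝ (fun y => (P y ∘L fderiv ℝ f y) v) x u =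
      fderiv ℝ P x u (fderiv ℝ f x v) + P x (fderiv ℝ (fderiv ℝ f) x u v) := by
    have h₁ := hP.hasFDerivAt.clm_apply (hD.hasFDerivAt.clm_apply (hasFDerivAt_const v x))
    refine (DFunLike.congr_fun h₁.fderiv u).trans ?_
    simp [add_comm]
  refine (congrArg₂ (· - ·) (key u v) (key v u)).trans ?_
  -- Symmetry of second derivatives is `d(df) = 0`, leaving only `dP ∧ df`.
  rw [hf.isSymmSndFDerivAt two_le_infty' u v]
  ring

variable {q : M → Q} {p : (m : M) → TangentSpace I (q m) →L[ℝ] ℝ} {x : M}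

/-- Base points `q` and covectors `p` are arbitrary, so that one computation covers both the
Liouville form on the cotangent bundle and its restriction to the constraint manifold. -/
theorem inChart_tautological (hq : ContMDiffAt I' I ∞ q x) :
    (oneForm fun m => p m ∘L mfderiv I' I q m : DForm I' M ℝ 1).inChart x =ᶠ[𝓝 (extChartAt I' x x)]
      fun y => ContinuousAlternatingMap.ofSubsingletonLIE (𝕜 := ℝ) (E := E') (F := ℝ) (0 : Fin 1)
        (localCovector (q x) (q ((extChartAt I' x).symm y)) (p ((extChartAt I' x).symm y)) ∘L
          fderiv ℝ (inCharts I' I x (q x) q) y) := by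
  have hl : (extChartAt I' x).symm (extChartAt I' x x) = x := extChartAt_to_inv x
  have hy := mem_extChartAt_target (I := I') x
  rw [← hl] at hq
  have h₁ : q ((extChartAt I' x).symm (extChartAt I' x x)) ∈ (extChartAt I (q x)).source := by
    rw [hl]; exact mem_extChartAt_source _
  filter_upwards [eventually_mem_target hy, eventually_mem_source hy hq.continuousAt h₁,
    ContMDiffAt.eventually_inChart hy hq] with y hy₁ hy₂ hy₃
  rw [(hasFDerivAt_inCharts hy₁ hy₃ hy₂).fderiv]
  ext v
  exact (localCovector_apply hy₂ _ _).symm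

theorem contDiffAt_fderiv_inCharts (hq : ContMDiffAt I' I ∞ q x) :
    ContDiffAt ℝ ∞ (inCharts I' I x (q x) q) (extChartAt I' x x) := by
  have hl : (extChartAt I' x).symm (extChartAt I' x x) = x := extChartAt_to_inv x
  refine contDiffAt_inCharts (mem_extChartAt_target x) (by rwa [hl]) ?_
  rw [hl]; exact mem_extChartAt_source _

/-- A form `p dq` is smooth. -/
theorem smoothAt_tautological (hq : ContMDiffAt I' I ∞ q x)
    (hp : ContMDiffAt I' 𝓘(ℝ, E →L[ℝ] ℝ) ∞ (fun y => localCovector (q x) (q y) (p y)) x) :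
    (oneForm fun m => p m ∘L mfderiv I' I q m : DForm I' M ℝ 1).SmoothAt x := by
  refine ContDiffAt.congr_of_eventuallyEq ?_ (inChart_tautological hq)
  refine (LinearIsometryEquiv.contDiff _).contDiffAt.comp _ ?_
  exact (contMDiffAt_iff_inChart.1 hp).clm_comp
    ((contDiffAt_fderiv_inCharts hq).fderiv_right (by simp))

variable (q p x) in
/-- The derivative of a family of covectors, in the coordinates around `q x`. -/
def covectorDeriv : TangentSpace I' x →L[ℝ] (E →L[ℝ] ℝ) :=
  mfderiv I' 𝓘(ℝ, E →L[ℝ] ℝ) (fun y => localCovector (q x) (q y) (p y)) x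

/-- The exterior derivative of a form `p dq` is `dp ∧ dq`. -/
theorem d_tautological (hq : ContMDiffAt I' I ∞ q x)
    (hp : ContMDiffAt I' 𝓘(ℝ, E →L[ℝ] ℝ) ∞ (fun y => localCovector (q x) (q y) (p y)) x)
    (u v : TangentSpace I' x) :
    (oneForm fun m => p m ∘L mfderiv I' I q m : DForm I' M ℝ 1).d x ![u, v] =
      covectorDeriv q p x u (mfderiv I' I q x v) - covectorDeriv q p x v (mfderiv I' I q x u) := by
  have h := extDeriv_comp_fderiv (inChart_tautological (p := p) hq)
    ((contMDiffAt_iff_inChart.1 hp).differentiableAt (by simp)) (contDiffAt_fderiv_inCharts hq) u v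
  rw [← mfderiv_eq_fderiv_inChart (hp.mdifferentiableAt (by simp)),
    fderiv_inCharts_self (hq.mdifferentiableAt (by simp))] at h
  exact (DForm.d_apply _ x _).trans h

/-- The restriction of the Liouville form is `p dq`. -/
theorem thetaM_eq {ι : M → CotangentBundle I Q} (hι : ContMDiff I' (cotangentModel I) ∞ ι) :
    thetaM I' ι = oneForm fun m => (ι m).2 ∘L mfderiv I' I (fun m => (ι m).1) m := by
  funext m
  have h₁ : MDifferentiableAt (cotangentModel I) I
      (Bundle.TotalSpace.proj : CotangentBundle I Q → Q) (ι m) :=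
    (Bundle.contMDiff_proj (fun q : Q => TangentSpace I q →L[ℝ] ℝ) (n := ∞) (IB := I)
      (F := E →L[ℝ] ℝ)).mdifferentiable (by simp) _
  have h₂ := (h₁.hasMFDerivAt.comp m ((hι m).mdifferentiableAt (by simp)).hasMFDerivAt).mfderiv
  ext v
  exact congrArg (ι m).2 (DFunLike.congr_fun h₂ (v 0)).symm

theorem thetaM_smoothAt {ι : M → CotangentBundle I Q} (hι : ContMDiff I' (cotangentModel I) ∞ ι)
    (m : M) : (thetaM I' ι).SmoothAt m := by
  rw [thetaM_eq hι]
  have h := contMDiffAt_cotangent_iff.1 (hι m)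
  exact smoothAt_tautological h.1 h.2

theorem omegaM_eq {ι : M → CotangentBundle I Q} (hι : ContMDiff I' (cotangentModel I) ∞ ι) :
    omegaM I' ι = -(thetaM I' ι).d := by
  funext m
  have h := contMDiffAt_cotangent_iff.1 (contMDiff_id (I := cotangentModel I)
    (M := CotangentBundle I Q) (n := ∞) (ι m))
  have h₁ : (liouvilleForm I Q).SmoothAt (ι m) := smoothAt_tautological h.1 h.2
  have h₂ := DForm.d_pullback h₁ (hι m)
  rw [Pi.neg_apply]
  refine Eq.trans ?_ (congrArg Neg.neg h₂.symm)
  rfl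

/-- This is `-d(p dq) = dq ∧ dp`, the form in which nondegeneracy is tested. -/
theorem omegaM_apply {ι : M → CotangentBundle I Q} (hι : ContMDiff I' (cotangentModel I) ∞ ι)
    (m : M) (u v : TangentSpace I' m) :
    omegaM I' ι m ![u, v] =
      covectorDeriv (fun m => (ι m).1) (fun m => (ι m).2) m v
          (mfderiv I' I (fun m => (ι m).1) m u) -
        covectorDeriv (fun m => (ι m).1) (fun m => (ι m).2) m u
          (mfderiv I' I (fun m => (ι m).1) m v) := by
  have h := contMDiffAt_cotangent_iff.1 (hι m)
  have h₁ := d_tautological h.1 h.2 u v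
  rw [omegaM_eq hι, thetaM_eq hι]
  exact (congrArg Neg.neg h₁).trans (neg_sub _ _)

theorem eventually_localCovector_eq {ι : M → CotangentBundle I Q} {m : M}
    (hι : ContMDiffAt I' (cotangentModel I) ∞ ι m) :
    (fun y => extChartAt (cotangentModel I) (ι m) (ι y)) =ᶠ[𝓝 m] fun y =>
      (extChartAt I (ι m).1 (ι y).1, localCovector (ι m).1 (ι y).1 (ι y).2) := by
  have h := (contMDiffAt_cotangent_iff.1 hι).1
  have h₁ : ∀ᶠ y in 𝓝 m, (ι y).1 ∈ (chartAt H (ι m).1).source :=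
    h.continuousAt.eventually_mem ((chartAt H (ι m).1).open_source.mem_nhds (mem_chart_source _ _))
  filter_upwards [h₁] with y hy
  have h₂ := TangentBundle.symmL_trivializationAt (I := I) hy
  rw [I.range_eq_univ, mfderivWithin_univ] at h₂
  have h₃ := Bundle.Trivial.continuousLinearMapAt_trivialization ℝ Q ℝ (ι y).1
  rw [FiberBundle.extChartAt]
  have h₄ := hom_trivializationAt_apply (RingHom.id ℝ) (F₁ := E) (E₁ := fun q : Q => TangentSpace I q)
    (F₂ := ℝ) (E₂ := fun _ : Q => ℝ) (ι m).1 (ι y)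
  have h₅ : ContinuousLinearMap.inCoordinates E (fun q : Q => TangentSpace I q) ℝ (fun _ : Q => ℝ)
      (ι m).1 (ι y).1 (ι m).1 (ι y).1 (ι y).2 = localCovector (ι m).1 (ι y).1 (ι y).2 := by
    rw [ContinuousLinearMap.inCoordinates, h₂]
    ext v
    exact DFunLike.congr_fun h₃ _
  refine Prod.ext ?_ ?_
  · exact congrArg (fun z => extChartAt I (ι m).1 z.1) h₄
  · exact (congrArg Prod.snd h₄).trans h₅

/-- The two vanishing quantities are the `q` and `p` components of `Tι u` in the cotangent chart. -/
theorem eq_zero_of_covectorDeriv {ι : M → CotangentBundle I Q} {m : M}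
    (hι : ContMDiffAt I' (cotangentModel I) ∞ ι m)
    (hinj : Function.Injective (mfderiv I' (cotangentModel I) ι m)) {u : TangentSpace I' m}
    (h₁ : mfderiv I' I (fun m => (ι m).1) m u = 0)
    (h₂ : covectorDeriv (fun m => (ι m).1) (fun m => (ι m).2) m u = 0) : u = 0 := by
  have h := contMDiffAt_cotangent_iff.1 hι
  have ha := (mdifferentiableAt_extChartAt (I := cotangentModel I)
    (mem_chart_source _ (ι m))).hasMFDerivAt.comp m
    (hι.mdifferentiableAt (by simp)).hasMFDerivAt
  have hb := (mdifferentiableAt_extChartAt (I := I) (mem_chart_source _ (ι m).1)).hasMFDerivAt.comp m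
    (f := fun m => (ι m).1) (h.1.mdifferentiableAt (by simp)).hasMFDerivAt
  have h₃ := (ContinuousLinearMap.fst ℝ E (E →L[ℝ] ℝ)).hasMFDerivAt
    (x := extChartAt (cotangentModel I) (ι m) (ι m)) |>.comp m ha
  have h₄ := (ContinuousLinearMap.snd ℝ E (E →L[ℝ] ℝ)).hasMFDerivAt
    (x := extChartAt (cotangentModel I) (ι m) (ι m)) |>.comp m ha
  have h₅ := (h₃.congr_of_eventuallyEq (f₁ := extChartAt I (ι m).1 ∘ fun m => (ι m).1)
    ((eventually_localCovector_eq hι).mono fun y hy => (congrArg Prod.fst hy).symm)).mfderiv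
  have h₆ := (h₄.congr_of_eventuallyEq (f₁ := fun y => localCovector (ι m).1 (ι y).1 (ι y).2)
    ((eventually_localCovector_eq hι).mono fun y hy => (congrArg Prod.snd hy).symm)).mfderiv
  have h₇ := DFunLike.congr_fun (mfderiv_extChartAt_self (I := cotangentModel I) (x := ι m))
    (mfderiv I' (cotangentModel I) ι m u)
  refine hinj (h₇.symm.trans (Eq.trans ?_ (map_zero _).symm))
  refine Prod.ext ?_ ?_
  · refine (DFunLike.congr_fun (h₅.symm.trans hb.mfderiv) u).trans ?_
    exact (congrArg (mfderiv I 𝓘(ℝ, E) (extChartAt I (ι m).1) (ι m).1) h₁).trans (map_zero _)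
  · exact (DFunLike.congr_fun h₆ u).symm.trans h₂

end Liouville

end Nonholonomic

end

noncomputable section

set_option linter.unusedSectionVars false

namespace Nonholonomic

/-! ### Regular distributions and their local annihilators -/

section Frames

variable {X : Type*} [NormedAddCommGroup X] [NormedSpace ℝ X]
  {V : Type*} [NormedAddCommGroup V] [NormedSpace ℝ V]

/-- The linear map with given values on the standard basis. -/
def frameMap {r : ℕ} (Z : Fin r → X → V) (y : X) : (Fin r → ℝ) →L[ℝ] V :=
  ∑ i, (ContinuousLinearMap.proj i : (Fin r → ℝ) →L[ℝ] ℝ).smulRight (Z i y)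

theorem frameMap_apply {r : ℕ} (Z : Fin r → X → V) (y : X) (c : Fin r → ℝ) :
    frameMap Z y c = ∑ i, c i • Z i y := by
  simp [frameMap]

theorem contDiffAt_frameMap {r : ℕ} {Z : Fin r → X → V} {y : X}
    (h : ∀ i, ContDiffAt ℝ ∞ (Z i) y) : ContDiffAt ℝ ∞ (frameMap Z) y := by
  unfold frameMap
  exact ContDiffAt.sum fun i _ => contDiffAt_const.smulRight (h i)

end Frames

section Distributions

variable {E : Type*} [NormedAddCommGroup E] [NormedSpace ℝ E]
  {H : Type*} [TopologicalSpace H] {I : ModelWithCorners ℝ E H} [I.Boundaryless]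
  {Q : Type*} [TopologicalSpace Q] [ChartedSpace H Q] [IsManifold I ∞ Q]
  {E' : Type*} [NormedAddCommGroup E'] [NormedSpace ℝ E']
  {H' : Type*} [TopologicalSpace H'] {I' : ModelWithCorners ℝ E' H'} [I'.Boundaryless]
  {M : Type*} [TopologicalSpace M] [ChartedSpace H' M] [IsManifold I' ∞ M]

theorem contDiffAt_section_inChart {X : (q : Q) → TangentSpace I q} {q₀ : Q}
    (h : ContMDiffAt I I.tangent ∞ (fun q => (⟨q, X q⟩ : TangentBundle I Q)) q₀) :
    ContDiffAt ℝ ∞ (fun y => (mfderiv I 𝓘(ℝ, E) (extChartAt I q₀) ((extChartAt I q₀).symm y)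
      (X ((extChartAt I q₀).symm y)) : E)) (extChartAt I q₀ q₀) := by
  have h₁ := (contMDiffAt_iff_inChart (I := I)).1 ((Bundle.contMDiffAt_section q₀).1 h)
  refine h₁.congr_of_eventuallyEq ?_
  filter_upwards [extChartAt_target_mem_nhds (I := I) q₀] with y hy
  have h₂ : (extChartAt I q₀).symm y ∈ (chartAt H q₀).source := by
    simpa using (extChartAt I q₀).map_target hy
  have h₃ : (extChartAt I q₀).symm y ∈
      (trivializationAt E (TangentSpace I : Q → Type _) q₀).baseSet := by simpa using h₂
  refine (DFunLike.congr_fun (TangentBundle.continuousLinearMapAt_trivializationAt h₂) _).symm.trans ?_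
  exact congrFun (Bundle.Trivialization.coe_linearMapAt_of_mem (R := ℝ)
    (trivializationAt E (TangentSpace I : Q → Type _) q₀) h₃) _

/-- A distribution is locally the kernel of a smooth one-form with values in `F`. -/
def Distribution.IsLocallyKer (F : Type*) [NormedAddCommGroup F] [NormedSpace ℝ F]
    (D : Distribution I Q) : Prop :=
  ∀ q₀, ∃ a : (q : Q) → TangentSpace I q →L[ℝ] F, (oneForm a).SmoothAt q₀ ∧
    ∀ᶠ q in 𝓝 q₀, ∀ v, v ∈ D q ↔ a q v = 0

/-- A local frame is an injective family of maps, and the projection off its range cuts out `D`.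
Local equations are preferred to frames because they pull back: the constraint distribution is the
preimage of `D` under the derivative of the base projection. -/
theorem Distribution.IsRegular.isLocallyKer [FiniteDimensional ℝ E] {D : Distribution I Q}
    (hD : D.IsRegular) : D.IsLocallyKer E := by
  intro q₀
  obtain ⟨r, hr⟩ := hD
  obtain ⟨U, hU, hqU, X, hX, hXU⟩ := hr q₀
  let Z : Fin r → E → E := fun i y => mfderiv I 𝓘(ℝ, E) (extChartAt I q₀)
    ((extChartAt I q₀).symm y) (X i ((extChartAt I q₀).symm y))
  have hZ (i) : ContDiffAt ℝ ∞ (Z i) (extChartAt I q₀ q₀) :=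
    contDiffAt_section_inChart ((hX i).contMDiffAt (hU.mem_nhds hqU))
  have hZX (q : Q) (hq : q ∈ (extChartAt I q₀).source) (c : Fin r → ℝ) :
      frameMap Z (extChartAt I q₀ q) c =
        mfderiv I 𝓘(ℝ, E) (extChartAt I q₀) q (∑ i, c i • X i q) := by
    have key : ∀ z, z = q → ∀ i, (mfderiv I 𝓘(ℝ, E) (extChartAt I q₀) z (X i z) : E) =
      mfderiv I 𝓘(ℝ, E) (extChartAt I q₀) q (X i q) := by rintro z rfl i; rfl
    rw [frameMap_apply, map_sum]
    refine Finset.sum_congr rfl fun i _ => ?_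
    rw [map_smul]
    exact congrArg (c i • ·) (key _ ((extChartAt I q₀).left_inv hq) i)
  have hinj (q : Q) (hq : q ∈ (extChartAt I q₀).source) :
      Function.Injective (mfderiv I 𝓘(ℝ, E) (extChartAt I q₀) q) := fun u v huv =>
    (DFunLike.congr_fun (mfderiv_symm_comp_mfderiv' (I := I) hq) u).symm.trans
      ((congrArg (mfderiv 𝓘(ℝ, E) I (extChartAt I q₀).symm (extChartAt I q₀ q)) huv).trans
        (DFunLike.congr_fun (mfderiv_symm_comp_mfderiv' (I := I) hq) v))
  have hZi : Function.Injective (frameMap Z (extChartAt I q₀ q₀)) := by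
    refine (injective_iff_map_eq_zero _).2 fun c hc => ?_
    have h₁ := hinj q₀ (mem_extChartAt_source q₀)
      (((hZX q₀ (mem_extChartAt_source q₀) c).symm.trans hc).trans (map_zero _).symm)
    exact funext (Fintype.linearIndependent_iff.1 (hXU q₀ hqU).1 c h₁)
  obtain ⟨e, he, heY⟩ := exists_contDiffAt_ker_eq_range (contDiffAt_frameMap hZ) hZi
  refine ⟨fun q => e (extChartAt I q₀ q) ∘L mfderiv I 𝓘(ℝ, E) (extChartAt I q₀) q, ?_, ?_⟩
  · rw [oneForm_smoothAt_iff]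
    refine he.congr_of_eventuallyEq ?_
    filter_upwards [extChartAt_target_mem_nhds (I := I) q₀] with y hy
    ext v
    have h₁ := DFunLike.congr_fun (mfderiv_comp_mfderiv_symm (I := I) hy) v
    exact (congrArg (e (extChartAt I q₀ ((extChartAt I q₀).symm y))) h₁).trans
      (congrArg (fun z => e z v) ((extChartAt I q₀).right_inv hy))
  · have h₁ := (continuousAt_extChartAt (I := I) q₀).eventually heY
    filter_upwards [h₁, hU.mem_nhds hqU, extChartAt_source_mem_nhds (I := I) q₀] with q hq hqU hqs v
    rw [← (hXU q hqU).2]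
    refine Iff.trans ?_ (hq (mfderiv I 𝓘(ℝ, E) (extChartAt I q₀) q v)).symm
    rw [Submodule.mem_span_range_iff_exists_fun]
    refine exists_congr fun c => ?_
    rw [hZX q hqs]
    exact ⟨fun h => congrArg _ h, fun h => hinj q hqs h⟩

theorem Distribution.IsLocallyKer.comap {F : Type*} [NormedAddCommGroup F] [NormedSpace ℝ F]
    {D : Distribution I Q} (hD : D.IsLocallyKer F) {f : M → Q} (hf : ContMDiff I' I ∞ f) :
    Distribution.IsLocallyKer (I := I') F
      (fun m => (D (f m)).comap (mfderiv I' I f m).toLinearMap) := by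
  intro m₀
  obtain ⟨a, ha, haD⟩ := hD (f m₀)
  refine ⟨fun m => a (f m) ∘L mfderiv I' I f m, ha.pullback (hf m₀), ?_⟩
  filter_upwards [hf.continuous.continuousAt.eventually haD] with m hm v using hm _

/-- Local sections of a regular distribution through a given vector. -/
theorem Distribution.IsRegular.exists_section {D : Distribution I Q} (hD : D.IsRegular) {q₀ : Q}
    {v : TangentSpace I q₀} (hv : v ∈ D q₀) :
    ∃ s : (q : Q) → TangentSpace I q, (∀ q, s q ∈ D q) ∧ s q₀ = v ∧
      ContMDiffAt I I.tangent ∞ (fun q => (⟨q, s q⟩ : TangentBundle I Q)) q₀ := by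
  obtain ⟨r, hr⟩ := hD
  obtain ⟨U, hU, hqU, X, hX, hXU⟩ := hr q₀
  rw [← (hXU q₀ hqU).2, Submodule.mem_span_range_iff_exists_fun] at hv
  obtain ⟨c, rfl⟩ := hv
  classical
  refine ⟨fun q => if q ∈ U then ∑ i, c i • X i q else 0, fun q => ?_, if_pos hqU, ?_⟩
  · beta_reduce
    split_ifs with h
    · rw [← (hXU q h).2]
      exact Submodule.sum_mem _ fun i _ => Submodule.smul_mem _ _
        (Submodule.subset_span (Set.mem_range_self i))
    · exact zero_mem _
  · have h₁ : ContMDiffAt I I.tangent ∞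
        (fun q => (⟨q, ∑ i, c i • X i q⟩ : TangentBundle I Q)) q₀ :=
      ContMDiffAt.sum_section (t := fun i q => c i • X i q) fun i _ =>
        ContMDiffAt.const_smul_section ((hX i).contMDiffAt (hU.mem_nhds hqU))
    refine h₁.congr_of_eventuallyEq ?_
    filter_upwards [hU.mem_nhds hqU] with q hq
    rw [if_pos hq]

end Distributions

end Nonholonomic

end

noncomputable section

set_option linter.unusedSectionVars false

namespace Nonholonomic

/-! ### Nonholonomic constraint manifolds -/

section Normed

variable {E : Type*} [NormedAddCommGroup E] [NormedSpace ℝ E]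
  {X : Type*} [NormedAddCommGroup X] [NormedSpace ℝ X]
  {V : Type*} [NormedAddCommGroup V] [NormedSpace ℝ V]

/-- In a direction that does not move the base point the linear equations are constant to first
order, so the derivative of a solution solves them as well. -/
theorem fderiv_mem_ker {e : X → V →L[ℝ] V} {f : E → X} {P : E → V} {y : E}
    (h : (fun z => e (f z) (P z)) =ᶠ[𝓝 y] fun _ => 0) (he : DifferentiableAt ℝ e (f y))
    (hf : DifferentiableAt ℝ f y) (hP : DifferentiableAt ℝ P y) {u : E} (hu : fderiv ℝ f y u = 0) :
    e (f y) (fderiv ℝ P y u) = 0 := by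
  have hcomp := HasFDerivAt.comp (g := e) y he.hasFDerivAt hf.hasFDerivAt
  have h₂ := (hcomp.clm_apply hP.hasFDerivAt).unique
    ((hasFDerivAt_const _ _).congr_of_eventuallyEq h)
  simpa [hu] using DFunLike.congr_fun h₂ u

theorem hasFDerivAt_line (a b : V) (t : ℝ) :
    HasFDerivAt (fun t : ℝ => a + t • b) ((ContinuousLinearMap.id ℝ ℝ).smulRight b) t :=
  ((hasFDerivAt_id t).smul_const b).const_add a

end Normed

section Constraint

variable {E : Type*} [NormedAddCommGroup E] [NormedSpace ℝ E]
  {H : Type*} [TopologicalSpace H] {I : ModelWithCorners ℝ E H} [I.Boundaryless]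
  {Q : Type*} [TopologicalSpace Q] [ChartedSpace H Q] [IsManifold I ∞ Q]
  {E' : Type*} [NormedAddCommGroup E'] [NormedSpace ℝ E']
  {H' : Type*} [TopologicalSpace H'] {I' : ModelWithCorners ℝ E' H'} [I'.Boundaryless]
  {M : Type*} [TopologicalSpace M] [ChartedSpace H' M] [IsManifold I' ∞ M]
  {κ : Bundle.ContMDiffRiemannianMetric I ∞ E (TangentSpace I : Q → Type _)}
  {D : Distribution I Q} {ι : M → CotangentBundle I Q}

theorem contMDiffAt_legendre {s : (q : Q) → TangentSpace I q} {q₀ : Q}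
    (hs : ContMDiffAt I I.tangent ∞ (fun q => (⟨q, s q⟩ : TangentBundle I Q)) q₀) :
    ContMDiffAt I (cotangentModel I) ∞
      (fun q => (⟨q, κ.inner q (s q)⟩ : CotangentBundle I Q)) q₀ :=
  ContMDiffAt.clm_bundle_apply (F₁ := E) (F₂ := E →L[ℝ] ℝ) (b := fun q : Q => q)
    (E₁ := (TangentSpace I : Q → Type _)) (E₂ := fun q : Q => TangentSpace I q →L[ℝ] ℝ)
    κ.contMDiff.contMDiffAt hs

theorem inner_injective (κ : Bundle.ContMDiffRiemannianMetric I ∞ E (TangentSpace I : Q → Type _))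
    {q : Q} {v : TangentSpace I q} (h : κ.inner q v v = 0) : v = 0 := by
  by_contra hv
  exact (κ.pos q v hv).ne' h

/-- This produces curves and local sections in the constraint manifold from explicit ones in the
cotangent bundle; their derivatives are the test vectors for nondegeneracy. -/
theorem exists_lift (hι : Manifold.IsSmoothEmbedding I' (cotangentModel I) ∞ ι)
    {EX : Type*} [NormedAddCommGroup EX] [NormedSpace ℝ EX]
    {HX : Type*} [TopologicalSpace HX] {IX : ModelWithCorners ℝ EX HX}
    {X : Type*} [TopologicalSpace X] [ChartedSpace HX X] {f : X → CotangentBundle I Q} {x : X}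
    (hf : ContMDiffAt IX (cotangentModel I) ∞ f x) (hfι : ∀ y, f y ∈ Set.range ι) {m : M}
    (hm : ι m = f x) :
    ∃ g : X → M, g x = m ∧ ContMDiffAt IX I' ∞ g x ∧ ∀ y, ι (g y) = f y := by
  choose g hg using hfι
  have h : ι ∘ g = f := funext hg
  exact ⟨g, hι.isEmbedding.injective ((hg x).trans hm.symm),
    contMDiffAt_of_comp_embedding hι (by rwa [h]), hg⟩

variable [FiniteDimensional ℝ E]

/-- Covectors in the constraint manifold satisfy linear equations, so vertical tangent vectors
are Legendre transforms of constrained vectors. -/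
theorem covectorDeriv_mem (hι : ContMDiff I' (cotangentModel I) ∞ ι)
    (hιD : Set.range ι = constraintSet κ D) (hD : D.IsRegular) {m : M} {u : TangentSpace I' m}
    (hu : mfderiv I' I (fun m => (ι m).1) m u = 0) :
    ∃ w ∈ D (ι m).1, covectorDeriv (fun m => (ι m).1) (fun m => (ι m).2) m u = κ.inner (ι m).1 w := by
  obtain ⟨r, hr⟩ := hD
  set q₀ := (ι m).1 with hq₀
  obtain ⟨U, hU, hqU, X, hX, hXU⟩ := hr q₀
  let Z' : Fin r → Q → E →L[ℝ] ℝ := fun i q => localCovector q₀ q (κ.inner q (X i q))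
  let Z : Fin r → E → E →L[ℝ] ℝ := fun i y => Z' i ((extChartAt I q₀).symm y)
  have hZ (i) : ContDiffAt ℝ ∞ (Z i) (extChartAt I q₀ q₀) := by
    have h := (contMDiffAt_cotangent_iff.1 (contMDiffAt_legendre (κ := κ)
      ((hX i).contMDiffAt (hU.mem_nhds hqU)))).2
    exact (contMDiffAt_iff_inChart (I := I)).1 h
  have hZX (q : Q) (hq : q ∈ (extChartAt I q₀).source) (c : Fin r → ℝ) :
      frameMap Z (extChartAt I q₀ q) c = localCovector q₀ q (κ.inner q (∑ i, c i • X i q)) := by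
    have h₁ : ∀ i, Z i (extChartAt I q₀ q) = Z' i q := fun i =>
      congrArg (Z' i) ((extChartAt I q₀).left_inv hq)
    let L : TangentSpace I q →ₗ[ℝ] E →L[ℝ] ℝ :=
      { toFun := fun v => localCovector q₀ q (κ.inner q v)
        map_add' := fun v w => by rw [map_add]; rfl
        map_smul' := fun c v => by rw [map_smul]; rfl }
    simp only [frameMap_apply, h₁]
    refine Eq.trans ?_ (map_sum L _ _).symm
    refine Finset.sum_congr rfl fun i _ => ?_
    exact (map_smul L _ _).symm
  have hs : q₀ ∈ (extChartAt I q₀).source := mem_extChartAt_source q₀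
  have hZi : Function.Injective (frameMap Z (extChartAt I q₀ q₀)) := by
    refine (injective_iff_map_eq_zero _).2 fun c hc => ?_
    rw [hZX q₀ hs, localCovector_self] at hc
    have h := inner_injective κ (DFunLike.congr_fun hc (∑ i, c i • X i q₀))
    exact funext (Fintype.linearIndependent_iff.1 (hXU q₀ hqU).1 c h)
  -- The family `e` gives local linear equations for the covectors `κ(v, ·)` with `v` in `D`.
  obtain ⟨e, he, heY⟩ := exists_contDiffAt_ker_eq_range (contDiffAt_frameMap hZ) hZi
  have hb := contMDiffAt_cotangent_iff.1 (hι m)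
  have h₁ : (fun y => e (inCharts I' I m q₀ (fun m => (ι m).1) y)
      (localCovector q₀ (ι ((extChartAt I' m).symm y)).1 (ι ((extChartAt I' m).symm y)).2))
      =ᶠ[𝓝 (extChartAt I' m m)] fun _ => 0 := by
    have h₂ := (hb.1.continuousAt.eventually ((continuousAt_extChartAt (I := I) q₀).eventually heY))
    have h₃ := hb.1.continuousAt.eventually (extChartAt_source_mem_nhds (I := I) q₀)
    have h₄ := hb.1.continuousAt.eventually (hU.mem_nhds hqU)
    have h₅ : Filter.Tendsto (extChartAt I' m).symm (𝓝 (extChartAt I' m m)) (𝓝 m) := by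
      have := (contMDiffAt_extChartAt_symm (mem_extChartAt_target (I := I') m)).continuousAt.tendsto
      rwa [extChartAt_to_inv] at this
    filter_upwards [h₅.eventually (h₂.and (h₃.and h₄))] with y ⟨hy₁, hy₂, hy₃⟩
    refine (hy₁ _).2 ?_
    have h₆ : ι ((extChartAt I' m).symm y) ∈ constraintSet κ D := hιD ▸ Set.mem_range_self _
    obtain ⟨v, hv, hpv⟩ := h₆
    rw [← (hXU _ hy₃).2, Submodule.mem_span_range_iff_exists_fun] at hv
    obtain ⟨c, rfl⟩ := hv
    exact ⟨c, (hZX _ hy₂ c).trans (congrArg (localCovector q₀ _) hpv.symm)⟩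
  have hF := contDiffAt_fderiv_inCharts hb.1
  have hFm : inCharts I' I m q₀ (fun m => (ι m).1) (extChartAt I' m m) = extChartAt I q₀ q₀ := by
    simp [inCharts, hq₀]
  have he' : DifferentiableAt ℝ e (inCharts I' I m q₀ (fun m => (ι m).1) (extChartAt I' m m)) := by
    rw [hFm]; exact he.differentiableAt (by simp)
  have h₄ := fderiv_mem_ker h₁ he' (hF.differentiableAt (by simp))
    ((contMDiffAt_iff_inChart.1 hb.2).differentiableAt (by simp)) (u := u)
    ((DFunLike.congr_fun (fderiv_inCharts_self (hb.1.mdifferentiableAt (by simp))) u).trans hu)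
  rw [← mfderiv_eq_fderiv_inChart (hb.2.mdifferentiableAt (by simp)), hFm] at h₄
  obtain ⟨c, hc⟩ := (heY.self_of_nhds _).1 h₄
  rw [hZX q₀ hs, localCovector_self] at hc
  refine ⟨∑ i, c i • X i q₀, ?_, hc.symm⟩
  rw [← (hXU q₀ hqU).2]
  exact Submodule.sum_mem _ fun i _ => Submodule.smul_mem _ _
    (Submodule.subset_span (Set.mem_range_self i))

/-- `Ω_M` is nondegenerate on the constraint distribution. -/
theorem omegaM_nondegenerate (hι : Manifold.IsSmoothEmbedding I' (cotangentModel I) ∞ ι)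
    (hιD : Set.range ι = constraintSet κ D) (hD : D.IsRegular) {m : M} {u : TangentSpace I' m}
    (hu : u ∈ constraintDistribution I' D ι m)
    (h : ∀ v ∈ constraintDistribution I' D ι m, omegaM I' ι m ![u, v] = 0) : u = 0 := by
  have hιs := hι.contMDiff
  obtain ⟨v₀, hv₀, hmv₀⟩ : ι m ∈ constraintSet κ D := hιD ▸ Set.mem_range_self _
  have hb := contMDiffAt_cotangent_iff.1 (hιs m)
  have hu₀ : mfderiv I' I (fun m => (ι m).1) m u = 0 := by
    set w : TangentSpace I (ι m).1 := mfderiv I' I (fun m => (ι m).1) m u with hw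
    have hwD : w ∈ D (ι m).1 := hu
    -- A line inside the fibre of the constraint set in the direction of the base velocity `w` of
    -- `u`. Its velocity is vertical, hence in `C`, and pairs with `u` to `κ(w, w)`.
    let f : ℝ → CotangentBundle I Q := fun t => ⟨(ι m).1, κ.inner (ι m).1 (v₀ + t • w)⟩
    obtain ⟨a, ha⟩ : ∃ a : E →L[ℝ] ℝ, a = κ.inner (ι m).1 v₀ := ⟨_, rfl⟩
    obtain ⟨b, hb'⟩ : ∃ b : E →L[ℝ] ℝ, b = κ.inner (ι m).1 w := ⟨_, rfl⟩
    have hloc : (fun t => localCovector (f 0).1 (f t).1 (f t).2) = fun t : ℝ => a + t • b := by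
      funext t
      refine (localCovector_self _ _).trans ?_
      rw [ha, hb']
      exact (map_add (κ.inner (ι m).1) _ _).trans
        (congrArg _ (map_smul (κ.inner (ι m).1) _ _))
    have hf : ContMDiffAt 𝓘(ℝ, ℝ) (cotangentModel I) ∞ f 0 := by
      refine contMDiffAt_cotangent_iff.2 ⟨contMDiffAt_const, ?_⟩
      rw [hloc]
      exact ContDiffAt.contMDiffAt (contDiffAt_const.add (contDiffAt_id.smul contDiffAt_const))
    obtain ⟨c, hc₀, hc, hcf⟩ := exists_lift hι hf (m := m)
      (fun t => hιD ▸ ⟨v₀ + t • w, (D _).add_mem hv₀ ((D _).smul_mem _ hwD), rfl⟩) (by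
        refine Bundle.TotalSpace.ext rfl (heq_of_eq ?_)
        change (ι m).2 = κ.inner (ι m).1 (v₀ + (0 : ℝ) • w)
        rw [hmv₀, zero_smul, add_zero])
    subst hc₀
    have hX₁ := (HasMFDerivAt.comp (g := fun m => (ι m).1) 0
      (hb.1.mdifferentiableAt (by simp)).hasMFDerivAt
      (hc.mdifferentiableAt (by simp)).hasMFDerivAt).mfderiv
    have hX₂ := (HasMFDerivAt.comp
      (g := fun y => localCovector (ι (c 0)).1 (ι y).1 (ι y).2) 0
      (hb.2.mdifferentiableAt (by simp)).hasMFDerivAt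
      (hc.mdifferentiableAt (by simp)).hasMFDerivAt)
    have hX₃ : (fun m => (ι m).1) ∘ c = fun _ => (ι (c 0)).1 :=
      funext fun t => (congrArg (·.1) (hcf t))
    have hX₄ : (fun y => localCovector (ι (c 0)).1 (ι y).1 (ι y).2) ∘ c = fun t : ℝ => a + t • b := by
      rw [← hloc]
      funext t
      exact congrArg (fun z : CotangentBundle I Q => localCovector (ι (c 0)).1 z.1 z.2) (hcf t)
    rw [hX₃, mfderiv_const] at hX₁
    rw [hX₄] at hX₂
    set x : TangentSpace I' (c 0) := mfderiv 𝓘(ℝ, ℝ) I' c 0 (1 : ℝ) with hx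
    have hx₁ : mfderiv I' I (fun m => (ι m).1) (c 0) x = 0 := (DFunLike.congr_fun hX₁ (1 : ℝ)).symm
    have hx₂ : covectorDeriv (fun m => (ι m).1) (fun m => (ι m).2) (c 0) x =
        κ.inner (ι (c 0)).1 w := by
      have h₁ := hasMFDerivAt_unique hX₂ (hasFDerivAt_line a b 0).hasMFDerivAt
      exact (DFunLike.congr_fun h₁ (1 : ℝ)).trans ((one_smul ℝ b).trans hb')
    have hxC : x ∈ constraintDistribution I' D ι (c 0) := by
      change mfderiv I' I (fun m => (ι m).1) (c 0) x ∈ D _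
      rw [hx₁]; exact zero_mem _
    have h₁ := sub_eq_zero.1 ((omegaM_apply hιs _ _ _).symm.trans (h x hxC))
    exact inner_injective κ ((DFunLike.congr_fun hx₂ w).symm.trans (h₁.trans
      ((congrArg (covectorDeriv (fun m => (ι m).1) (fun m => (ι m).2) (c 0) u) hx₁).trans
        (map_zero _))))
  refine eq_zero_of_covectorDeriv (hιs m)
    (injective_mfderiv_of_isImmersionAt (hι.isImmersion.isImmersionAt m)) hu₀ ?_
  -- Now `u` is vertical, with fibre component `κ(w, ·)` for some `w` in `D`. The Legendre transform
  -- of a section of `D` through `v₀` is a local section of the constraint manifold over `Q`; it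
  -- lifts `w` to a vector of `C` that pairs with `u` to `-κ(w, w)`.
  obtain ⟨w, hw, hwu⟩ := covectorDeriv_mem hιs hιD hD hu₀
  obtain ⟨s, hsD, hs₀, hs⟩ := hD.exists_section hv₀
  obtain ⟨σ, hσ₀, hσ, hσι⟩ := exists_lift hι (contMDiffAt_legendre (κ := κ) hs) (m := m)
    (fun q => hιD ▸ ⟨s q, hsD q, rfl⟩) (by
      refine Bundle.TotalSpace.ext rfl (heq_of_eq ?_)
      change (ι m).2 = κ.inner (ι m).1 (s (ι m).1)
      rw [hmv₀, hs₀])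
  have hσ' := hσ.mdifferentiableAt (by simp)
  have h₁ : HasMFDerivAt I I ((fun m => (ι m).1) ∘ σ) (ι m).1
      (mfderiv I' I (fun m => (ι m).1) m ∘L
        (mfderiv I I' σ (ι m).1 : TangentSpace I (ι m).1 →L[ℝ] E')) := by
    have h₂ := hb.1.mdifferentiableAt (by simp)
    have key : ∀ z, z = m → MDifferentiableAt I' I (fun m => (ι m).1) z →
      HasMFDerivAt I' I (fun m => (ι m).1) z
        (mfderiv I' I (fun m => (ι m).1) m : E' →L[ℝ] E) := by
      rintro z rfl hz; exact hz.hasMFDerivAt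
    exact HasMFDerivAt.comp (g := fun m => (ι m).1) (ι m).1
      (key _ hσ₀ (by rw [hσ₀]; exact h₂)) hσ'.hasMFDerivAt
  have h₂ : (fun m => (ι m).1) ∘ σ = id := funext fun q => congrArg (·.1) (hσι q)
  rw [h₂] at h₁
  have h₃ := DFunLike.congr_fun (h₁.mfderiv.symm.trans mfderiv_id) w
  set x : TangentSpace I' m := (mfderiv I I' σ (ι m).1 w : E') with hx
  have h₄ : mfderiv I' I (fun m => (ι m).1) m x = w := h₃
  have h₅ := h x (by
    change mfderiv I' I (fun m => (ι m).1) m x ∈ D _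
    rw [h₄]; exact hw)
  have h₆ := sub_eq_zero.1 ((omegaM_apply hιs _ _ _).symm.trans h₅)
  have h₇ : κ.inner (ι m).1 w w = 0 := by
    refine (DFunLike.congr_fun hwu w).symm.trans (Eq.trans ?_ (h₆.symm.trans
      ((congrArg (covectorDeriv (fun m => (ι m).1) (fun m => (ι m).2) m x) hu₀).trans
        (map_zero _))))
    exact (congrArg (covectorDeriv (fun m => (ι m).1) (fun m => (ι m).2) m u) h₄).symm
  refine hwu.trans ?_
  rw [inner_injective κ h₇, map_zero]
  rfl

end Constraint

end Nonholonomic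

end

noncomputable section

set_option linter.unusedSectionVars false

namespace Nonholonomic

/-! ### Lifted actions -/

section SmoothActions

variable {EG : Type*} [NormedAddCommGroup EG] [NormedSpace ℝ EG]
  {HG : Type*} [TopologicalSpace HG] {IG : ModelWithCorners ℝ EG HG} [IG.Boundaryless]
  {G : Type*} [TopologicalSpace G] [ChartedSpace HG G] [Group G] [IsManifold IG ∞ G]
  {E : Type*} [NormedAddCommGroup E] [NormedSpace ℝ E]
  {H : Type*} [TopologicalSpace H] {I : ModelWithCorners ℝ E H} [I.Boundaryless]
  {M : Type*} [TopologicalSpace M] [ChartedSpace H M] [IsManifold I ∞ M] [MulAction G M]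

theorem mfderiv_smul_smul (hsm : ∀ g : G, ContMDiff I I ∞ (fun m : M => g • m)) (g h : G) (m : M)
    (u : TangentSpace I m) :
    mfderiv I I (fun m : M => g • m) (h • m) (mfderiv I I (fun m : M => h • m) m u) =
      (mfderiv I I (fun m : M => (g * h) • m) m u : E) := by
  have h₁ := ((((hsm g) (h • m)).mdifferentiableAt (by simp)).hasMFDerivAt.comp m
    (((hsm h) m).mdifferentiableAt (by simp)).hasMFDerivAt).mfderiv
  have h₂ : (fun m : M => g • m) ∘ (fun m : M => h • m) = fun m : M => (g * h) • m :=
    funext fun m => (mul_smul g h m).symm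
  rw [h₂] at h₁
  exact (DFunLike.congr_fun h₁ u).symm

theorem mfderiv_one_smul (m : M) (u : TangentSpace I m) :
    (mfderiv I I (fun m : M => (1 : G) • m) m u : E) = u := by
  have : (fun m : M => (1 : G) • m) = id := by funext m; exact one_smul G m
  rw [this]
  exact DFunLike.congr_fun (mfderiv_id (I := I) (x := m)) u

theorem mfderiv_inv_smul_smul (hsm : ∀ g : G, ContMDiff I I ∞ (fun m : M => g • m)) (g : G) (m : M)
    (u : TangentSpace I m) :
    mfderiv I I (fun m : M => g⁻¹ • m) (g • m) (mfderiv I I (fun m : M => g • m) m u) =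
      (u : E) := by
  refine (mfderiv_smul_smul hsm g⁻¹ g m u).trans ?_
  rw [inv_mul_cancel]
  exact mfderiv_one_smul m u

theorem mfderiv_smul_inv_smul (hsm : ∀ g : G, ContMDiff I I ∞ (fun m : M => g • m)) (g : G) (m : M)
    (u : TangentSpace I (g • m)) :
    mfderiv I I (fun m : M => g • m) m (mfderiv I I (fun m : M => g⁻¹ • m) (g • m) u : E) =
      (u : E) := by
  have h₁ := mfderiv_inv_smul_smul hsm g⁻¹ (g • m) u
  have key : ∀ z, z = m → ∀ w : E, (mfderiv I I (fun m : M => g • m) m w : E) =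
    (mfderiv I I (fun m : M => g • m) z w : E) := by rintro z rfl w; rfl
  rw [inv_inv] at h₁
  exact (key _ (inv_smul_smul g m) _).trans h₁

theorem inverse_mfderiv_smul (hsm : ∀ g : G, ContMDiff I I ∞ (fun m : M => g • m)) (g : G) (m : M) :
    ((mfderiv I I (fun m : M => g • m) m).inverse : E →L[ℝ] E) =
      (mfderiv I I (fun m : M => g⁻¹ • m) (g • m) : E →L[ℝ] E) := by
  refine ContinuousLinearMap.inverse_eq (f := (mfderiv I I (fun m : M => g • m) m : E →L[ℝ] E)) ?_ ?_
  · ext u; exact mfderiv_smul_inv_smul hsm g m u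
  · ext u; exact mfderiv_inv_smul_smul hsm g m u

/-- The derivative of an action in the group direction, at an arbitrary point of the group. -/
theorem mfderiv_smul_infGen (hsm : ContMDiff (IG.prod I) I ∞ (fun p : G × M => p.1 • p.2)) (g : G)
    (m : M) (ξ : EG) :
    mfderiv I I (fun m : M => g • m) m (infGen IG G I m ξ) =
      (mfderiv IG I (fun h : G => (g * h) • m) 1 ξ : E) := by
  have h₁ : HasMFDerivAt IG I ((fun m : M => g • m) ∘ fun h : G => h • m) 1
      ((mfderiv I I (fun m : M => g • m) m : E →L[ℝ] E) ∘L (infGen IG G I m : EG →L[ℝ] E)) := by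
    refine HasMFDerivAt.comp (g := fun m : M => g • m) (1 : G) ?_
      (((contMDiff_smul_right hsm m) 1).mdifferentiableAt (by simp)).hasMFDerivAt
    have key : ∀ z, z = m → HasMFDerivAt I I (fun m : M => g • m) z
      (mfderiv I I (fun m : M => g • m) m : E →L[ℝ] E) := by
      rintro z rfl
      exact (((contMDiff_smul_left hsm g) z).mdifferentiableAt (by simp)).hasMFDerivAt
    exact key _ (one_smul G m)
  have h₂ : ((fun m : M => g • m) ∘ fun h : G => h • m) = fun h : G => (g * h) • m :=
    funext fun h => (mul_smul g h m).symm
  rw [h₂] at h₁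
  exact (DFunLike.congr_fun h₁.mfderiv ξ).symm

end SmoothActions

/-! ### The lifted action on the constraint manifold -/

section Cotangent

variable {EG : Type*} [NormedAddCommGroup EG] [NormedSpace ℝ EG]
  {HG : Type*} [TopologicalSpace HG] {IG : ModelWithCorners ℝ EG HG} [IG.Boundaryless]
  {G : Type*} [TopologicalSpace G] [ChartedSpace HG G] [Group G] [LieGroup IG ∞ G]
  {E : Type*} [NormedAddCommGroup E] [NormedSpace ℝ E]
  {H : Type*} [TopologicalSpace H] {I : ModelWithCorners ℝ E H} [I.Boundaryless]
  {Q : Type*} [TopologicalSpace Q] [ChartedSpace H Q] [IsManifold I ∞ Q] [MulAction G Q]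
  {E' : Type*} [NormedAddCommGroup E'] [NormedSpace ℝ E']
  {H' : Type*} [TopologicalSpace H'] {I' : ModelWithCorners ℝ E' H'} [I'.Boundaryless]
  {M : Type*} [TopologicalSpace M] [ChartedSpace H' M] [IsManifold I' ∞ M] [MulAction G M]
  {ι : M → CotangentBundle I Q}

/-- The lifted action on an embedded invariant submanifold of the cotangent bundle is smooth. -/
theorem contMDiff_lifted_smul (hsm : ContMDiff (IG.prod I) I ∞ (fun p : G × Q => p.1 • p.2))
    (hι : Manifold.IsSmoothEmbedding I' (cotangentModel I) ∞ ι)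
    (hact : ∀ (g : G) (m : M), ι (g • m) = cotangentLift g (ι m)) :
    ContMDiff (IG.prod I') I' ∞ (fun p : G × M => p.1 • p.2) := by
  rintro ⟨g₀, m₀⟩
  refine contMDiffAt_of_comp_embedding hι ?_
  have h₀ : ι ∘ (fun p : G × M => p.1 • p.2) = fun p => cotangentLift p.1 (ι p.2) :=
    funext fun p => hact p.1 p.2
  rw [h₀]
  have hb := contMDiffAt_cotangent_iff.1 (hι.contMDiff m₀)
  have hsnd : ContMDiffAt (IG.prod I') I' ∞ (Prod.snd : G × M → M) (g₀, m₀) := contMDiffAt_snd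
  have hbs : ContMDiffAt (IG.prod I') I ∞ (fun p : G × M => (ι p.2).1) (g₀, m₀) :=
    ContMDiffAt.comp (g := fun m => (ι m).1) (g₀, m₀) hb.1 hsnd
  have hbase : ContMDiffAt (IG.prod I') I ∞ (fun p : G × M => p.1 • (ι p.2).1) (g₀, m₀) :=
    ContMDiffAt.comp (g := fun p : G × Q => p.1 • p.2) (g₀, m₀) (hsm _)
      (contMDiffAt_fst.prodMk hbs)
  refine contMDiffAt_cotangent_iff.2 ⟨hbase, ?_⟩
  set q₀ := (ι m₀).1 with hq₀
  -- The lift precomposes a covector with the derivative of the inverse translation. Read in charts,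
  -- this is a partial derivative of a jointly smooth function, hence smooth in the parameters `(g,
  -- m)`.
  let f : G × M → E → E := fun p y => extChartAt I q₀ (p.1⁻¹ • (extChartAt I (g₀ • q₀)).symm y)
  have hf : ContMDiffAt ((IG.prod I').prod 𝓘(ℝ, E)) 𝓘(ℝ, E) ∞ (Function.uncurry f)
      ((g₀, m₀), extChartAt I (g₀ • q₀) (g₀ • q₀)) := by
    have h₁ : ContMDiffAt ((IG.prod I').prod 𝓘(ℝ, E)) IG ∞
        (fun z : (G × M) × E => z.1.1⁻¹) ((g₀, m₀), extChartAt I (g₀ • q₀) (g₀ • q₀)) :=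
      ((contMDiff_inv IG ∞).contMDiffAt.comp _
        (contMDiffAt_fst.comp _ contMDiffAt_fst))
    have h₂ : ContMDiffAt ((IG.prod I').prod 𝓘(ℝ, E)) I ∞
        (fun z : (G × M) × E => (extChartAt I (g₀ • q₀)).symm z.2)
        ((g₀, m₀), extChartAt I (g₀ • q₀) (g₀ • q₀)) :=
      ContMDiffAt.comp (g := (extChartAt I (g₀ • q₀)).symm) _
        (contMDiffAt_extChartAt_symm (mem_extChartAt_target _)) contMDiffAt_snd
    have h₃ := ContMDiffAt.comp (g := fun p : G × Q => p.1 • p.2)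
      ((g₀, m₀), extChartAt I (g₀ • q₀) (g₀ • q₀)) (hsm _) (h₁.prodMk h₂)
    refine ContMDiffAt.comp (g := extChartAt I q₀) _ ?_ h₃
    have h₄ : g₀⁻¹ • (extChartAt I (g₀ • q₀)).symm (extChartAt I (g₀ • q₀) (g₀ • q₀)) = q₀ := by
      rw [extChartAt_to_inv, inv_smul_smul]
    change ContMDiffAt I 𝓘(ℝ, E) ∞ (extChartAt I q₀)
      (g₀⁻¹ • (extChartAt I (g₀ • q₀)).symm (extChartAt I (g₀ • q₀) (g₀ • q₀)))
    rw [h₄]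
    exact contMDiffAt_extChartAt
  have hy : ContMDiffAt (IG.prod I') 𝓘(ℝ, E) ∞
      (fun p : G × M => extChartAt I (g₀ • q₀) (p.1 • (ι p.2).1)) (g₀, m₀) :=
    ContMDiffAt.comp (g := extChartAt I (g₀ • q₀)) _ contMDiffAt_extChartAt hbase
  have hT := hf.mfderiv f (fun p : G × M => extChartAt I (g₀ • q₀) (p.1 • (ι p.2).1)) hy (m := ∞)
    (by simp)
  have hT' : ContMDiffAt (IG.prod I') 𝓘(ℝ, E →L[ℝ] E) ∞ (fun p : G × M =>
      fderiv ℝ (f p) (extChartAt I (g₀ • q₀) (p.1 • (ι p.2).1))) (g₀, m₀) := by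
    have e := inTangentCoordinates_model_space (I := 𝓘(ℝ, E)) (I' := 𝓘(ℝ, E))
      (fun p : G × M => extChartAt I (g₀ • q₀) (p.1 • (ι p.2).1))
      (fun p => f p (extChartAt I (g₀ • q₀) (p.1 • (ι p.2).1)))
      (fun p => fderiv ℝ (f p) (extChartAt I (g₀ • q₀) (p.1 • (ι p.2).1))) (g₀, m₀)
    rw [← e]
    simp only [mfderiv_eq_fderiv] at hT
    exact hT
  have hP : ContMDiffAt (IG.prod I') 𝓘(ℝ, E →L[ℝ] ℝ) ∞
      (fun p : G × M => localCovector q₀ (ι p.2).1 (ι p.2).2) (g₀, m₀) := hb.2.comp (g₀, m₀) hsnd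
  refine (hP.clm_comp hT').congr_of_eventuallyEq ?_
  have h₁ : ∀ᶠ p in 𝓝 (g₀, m₀), p.1 • (ι p.2).1 ∈ (extChartAt I (g₀ • q₀)).source :=
    hbase.continuousAt.eventually (extChartAt_source_mem_nhds (I := I) (g₀ • q₀))
  have h₂ : ∀ᶠ p in 𝓝 (g₀, m₀), (ι p.2).1 ∈ (extChartAt I q₀).source :=
    hbs.continuousAt.eventually (extChartAt_source_mem_nhds (I := I) q₀)
  filter_upwards [h₁, h₂] with p hp₁ hp₂
  have hsm' := contMDiff_smul_left hsm
  have h₃ : (extChartAt I (g₀ • q₀)).symm (extChartAt I (g₀ • q₀) (p.1 • (ι p.2).1)) =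
    p.1 • (ι p.2).1 := (extChartAt I (g₀ • q₀)).left_inv hp₁
  have hy₁ := (extChartAt I (g₀ • q₀)).map_source hp₁
  have h₄ : HasMFDerivAt 𝓘(ℝ, E) 𝓘(ℝ, E) (f p) (extChartAt I (g₀ • q₀) (p.1 • (ι p.2).1))
      ((mfderiv I 𝓘(ℝ, E) (extChartAt I q₀) (ι p.2).1 : E →L[ℝ] E) ∘L
        (mfderiv I I (fun q : Q => p.1⁻¹ • q) (p.1 • (ι p.2).1) : E →L[ℝ] E) ∘L
        (mfderiv 𝓘(ℝ, E) I (extChartAt I (g₀ • q₀)).symm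
          (extChartAt I (g₀ • q₀) (p.1 • (ι p.2).1)) : E →L[ℝ] E)) := by
    have k₁ : ∀ z, z = p.1 • (ι p.2).1 → HasMFDerivAt I I (fun q : Q => p.1⁻¹ • q) z
        (mfderiv I I (fun q : Q => p.1⁻¹ • q) (p.1 • (ι p.2).1) : E →L[ℝ] E) := by
      rintro z rfl
      exact ((hsm' p.1⁻¹ _).mdifferentiableAt (by simp)).hasMFDerivAt
    have k₂ : ∀ z, z = (ι p.2).1 → HasMFDerivAt I 𝓘(ℝ, E) (extChartAt I q₀) z
        (mfderiv I 𝓘(ℝ, E) (extChartAt I q₀) (ι p.2).1 : E →L[ℝ] E) := by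
      rintro z rfl
      exact (mdifferentiableAt_extChartAt' hp₂).hasMFDerivAt
    have k₃ := HasMFDerivAt.comp (g := fun q : Q => p.1⁻¹ • q)
      (extChartAt I (g₀ • q₀) (p.1 • (ι p.2).1)) (k₁ _ h₃)
      (mdifferentiableAt_extChartAt_symm (I := I) hy₁).hasMFDerivAt
    exact HasMFDerivAt.comp (g := extChartAt I q₀) _
      (k₂ _ ((congrArg (p.1⁻¹ • ·) h₃).trans (inv_smul_smul _ _))) k₃
  have h₅ := mfderiv_eq_fderiv.symm.trans h₄.mfderiv
  ext v
  have h₆ := DFunLike.congr_fun (inverse_mfderiv_smul hsm' p.1 (ι p.2).1)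
    (mfderiv 𝓘(ℝ, E) I (extChartAt I (g₀ • q₀)).symm
          (extChartAt I (g₀ • q₀) (p.1 • (ι p.2).1)) v)
  refine (congrArg (ι p.2).2 h₆).trans ?_
  refine (localCovector_apply hp₂ _ _).symm.trans ?_
  exact congrArg (localCovector q₀ (ι p.2).1 (ι p.2).2) (DFunLike.congr_fun h₅ v).symm

theorem mfderiv_proj_smul (hsm : ContMDiff (IG.prod I) I ∞ (fun p : G × Q => p.1 • p.2))
    (hι : Manifold.IsSmoothEmbedding I' (cotangentModel I) ∞ ι)
    (hact : ∀ (g : G) (m : M), ι (g • m) = cotangentLift g (ι m)) (g : G) (m : M)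
    (u : TangentSpace I' m) :
    mfderiv I' I (fun m => (ι m).1) (g • m) (mfderiv I' I' (fun m : M => g • m) m u) =
      (mfderiv I I (fun q : Q => g • q) (ι m).1 (mfderiv I' I (fun m => (ι m).1) m u) : E) := by
  have hb (m : M) := (contMDiffAt_cotangent_iff.1 (hι.contMDiff m)).1.mdifferentiableAt (by simp)
  have hsM := contMDiff_smul_left (contMDiff_lifted_smul hsm hι hact) g
  have h₁ := (HasMFDerivAt.comp (g := fun m => (ι m).1) m (hb (g • m)).hasMFDerivAt
    ((hsM m).mdifferentiableAt (by simp)).hasMFDerivAt).mfderiv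
  have h₂ := (HasMFDerivAt.comp (f := fun m => (ι m).1) (g := fun q : Q => g • q) m
    ((contMDiff_smul_left hsm g _).mdifferentiableAt (by simp)).hasMFDerivAt
    (hb m).hasMFDerivAt).mfderiv
  have h₃ : (fun m => (ι m).1) ∘ (fun m : M => g • m) = (fun q : Q => g • q) ∘ fun m => (ι m).1 :=
    funext fun m => congrArg (·.1) (hact g m)
  rw [h₃] at h₁
  exact DFunLike.congr_fun (h₁.symm.trans h₂) u

/-- The inverse derivative in the cotangent lift cancels the derivative produced by equivariance of
the base projection. -/
theorem thetaM_smul (hsm : ContMDiff (IG.prod I) I ∞ (fun p : G × Q => p.1 • p.2))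
    (hι : Manifold.IsSmoothEmbedding I' (cotangentModel I) ∞ ι)
    (hact : ∀ (g : G) (m : M), ι (g • m) = cotangentLift g (ι m)) (g : G) (m : M)
    (u : TangentSpace I' m) :
    thetaM I' ι (g • m) ![mfderiv I' I' (fun m : M => g • m) m u] = thetaM I' ι m ![u] := by
  rw [thetaM_eq hι.contMDiff]
  have h₁ := mfderiv_proj_smul hsm hι hact g m u
  refine (congrArg (ι (g • m)).2 h₁).trans ?_
  have key : ∀ p, p = cotangentLift g (ι m) → ∀ v : E, ((p.2 : E →L[ℝ] ℝ) v) =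
    (ι m).2 ((mfderiv I I (fun q : Q => g • q) (ι m).1).inverse v) := by rintro p rfl v; rfl
  refine (key _ (hact g m) _).trans (congrArg (ι m).2 ?_)
  refine (DFunLike.congr_fun (inverse_mfderiv_smul (contMDiff_smul_left hsm) g (ι m).1) _).trans ?_
  exact mfderiv_inv_smul_smul (contMDiff_smul_left hsm) g _ _

theorem constraintDistribution_smul {D : Distribution I Q}
    (hsm : ContMDiff (IG.prod I) I ∞ (fun p : G × Q => p.1 • p.2))
    (hι : Manifold.IsSmoothEmbedding I' (cotangentModel I) ∞ ι)
    (hact : ∀ (g : G) (m : M), ι (g • m) = cotangentLift g (ι m)) (hDinv : D.IsInvariant G)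
    (g : G) (m : M) {u : TangentSpace I' m} (hu : u ∈ constraintDistribution I' D ι m) :
    mfderiv I' I' (fun m : M => g • m) m u ∈ constraintDistribution I' D ι (g • m) := by
  have h₁ := mfderiv_proj_smul hsm hι hact g m u
  have h₂ : mfderiv I I (fun q : Q => g • q) (ι m).1 (mfderiv I' I (fun m => (ι m).1) m u) ∈
      D (g • (ι m).1) := by
    rw [← hDinv g]; exact Submodule.mem_map_of_mem hu
  have key : ∀ q, q = g • (ι m).1 → ∀ v : E,
    (show TangentSpace I (g • (ι m).1) from v) ∈ D (g • (ι m).1) →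
      (show TangentSpace I q from v) ∈ D q := by rintro q rfl v hv; exact hv
  have h₃ := key _ (congrArg (·.1) (hact g m)) _ h₂
  rw [← h₁] at h₃
  exact h₃

end Cotangent

end Nonholonomic

end

noncomputable section

set_option linter.unusedSectionVars false

namespace Nonholonomic

/-! ### Infinitesimal generators of free actions -/

section InfGen

variable {EG : Type*} [NormedAddCommGroup EG] [NormedSpace ℝ EG]
  {HG : Type*} [TopologicalSpace HG] {IG : ModelWithCorners ℝ EG HG} [IG.Boundaryless]
  {G : Type*} [TopologicalSpace G] [ChartedSpace HG G] [Group G] [LieGroup IG ∞ G]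
  {E : Type*} [NormedAddCommGroup E] [NormedSpace ℝ E]
  {H : Type*} [TopologicalSpace H] {I : ModelWithCorners ℝ E H} [I.Boundaryless]
  {M : Type*} [TopologicalSpace M] [ChartedSpace H M] [IsManifold I ∞ M] [MulAction G M]

/-- If the generator of `ξ` vanishes at `m`, then the integral curve through `1` of the invariant
field of `ξ` fixes `m`. By freeness the curve is locally constant, so its velocity `ξ` is zero. -/
theorem infGen_injective [CompleteSpace EG]
    (hsm : ContMDiff (IG.prod I) I ∞ (fun p : G × M => p.1 • p.2))
    (hfree : ∀ (g : G) (m : M), g • m = m → g = 1) (m : M) :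
    Function.Injective (infGen IG G I m) := by
  refine (injective_iff_map_eq_zero _).2 fun ξ hξ => ?_
  have hv : ContMDiff IG IG.tangent 1
      (fun g : G => (⟨g, mulInvariantVectorField (I := IG) ξ g⟩ : TangentBundle IG G)) :=
    (contMDiff_mulInvariantVectorField (I := IG) (G := G) ξ).of_le
      (by rw [minSmoothness_of_isRCLikeNormedField]; norm_num)
  obtain ⟨γ, hγ₀, hγ⟩ := exists_isMIntegralCurveAt_of_contMDiffAt_boundaryless 0
    (hv.contMDiffAt (x := 1))
  have hmul (g : G) : ContMDiff IG IG ∞ (fun h : G => g * h) := contMDiff_mul_left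
  -- The velocity of `γ t • m` is the translate by `γ t` of the generator of `ξ` at `m`, which is
  -- zero.
  have hc : ∀ᶠ t in 𝓝 (0 : ℝ), HasMFDerivAt 𝓘(ℝ, ℝ) I (fun t => γ t • m) t
      (0 : ℝ →L[ℝ] E) := by
    filter_upwards [hγ] with t ht
    have h₁ := HasMFDerivAt.comp (g := fun h : G => h • m) t
      ((contMDiff_smul_right hsm m (γ t)).mdifferentiableAt (by simp)).hasMFDerivAt ht
    refine Eq.mp (congrArg (HasMFDerivAt 𝓘(ℝ, ℝ) I (fun t => γ t • m) t) ?_) h₁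
    refine ContinuousLinearMap.ext_ring ?_
    have h₂ : HasMFDerivAt IG I ((fun h : G => h • m) ∘ fun h => γ t * h) 1
        ((mfderiv IG I (fun h : G => h • m) (γ t) : EG →L[ℝ] E) ∘L
          (mfderiv IG IG (fun h : G => γ t * h) 1 : EG →L[ℝ] EG)) := by
      have key : ∀ z, z = γ t → HasMFDerivAt IG I (fun h : G => h • m) z
          (mfderiv IG I (fun h : G => h • m) (γ t) : EG →L[ℝ] E) := by
        rintro z rfl
        exact ((contMDiff_smul_right hsm m _).mdifferentiableAt (by simp)).hasMFDerivAt
      exact HasMFDerivAt.comp (g := fun h : G => h • m) (1 : G) (key _ (mul_one _))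
        ((hmul (γ t) 1).mdifferentiableAt (by simp)).hasMFDerivAt
    have h₃ := DFunLike.congr_fun h₂.mfderiv ξ
    have h₄ := mfderiv_smul_infGen hsm (γ t) m ξ
    rw [hξ, map_zero] at h₄
    have h₅ : (mfderiv IG I (fun h : G => h • m) (γ t) : EG →L[ℝ] E)
        (mulInvariantVectorField (I := IG) ξ (γ t)) = 0 := h₃.symm.trans h₄.symm
    refine (map_smul (mfderiv IG I (fun h : G => h • m) (γ t)) (1 : ℝ)
        (mulInvariantVectorField (I := IG) ξ (γ t))).trans ?_
    exact (one_smul ℝ _).trans h₅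
  have hcm : γ 0 • m = m := by rw [hγ₀, one_smul]
  have hcc : ContinuousAt (fun t => γ t • m) 0 := hc.self_of_nhds.continuousAt
  have hcs : ∀ᶠ t in 𝓝 (0 : ℝ), γ t • m ∈ (extChartAt I m).source := by
    have := extChartAt_source_mem_nhds (I := I) m
    rw [← hcm] at this
    have := hcc.eventually this
    rwa [hcm] at this
  obtain ⟨δ, hδ, hball⟩ := Metric.eventually_nhds_iff_ball.1 (hc.and hcs)
  have hd (t : ℝ) (ht : t ∈ Metric.ball 0 δ) :
      HasFDerivAt (fun t => extChartAt I m (γ t • m)) (0 : ℝ →L[ℝ] E) t := by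
    have h₁ := HasMFDerivAt.comp (g := extChartAt I m) t
      (mdifferentiableAt_extChartAt' (hball t ht).2).hasMFDerivAt (hball t ht).1
    exact h₁.hasFDerivAt.congr_fderiv (ContinuousLinearMap.ext fun u =>
      map_zero (mfderiv I 𝓘(ℝ, E) (extChartAt I m) (γ t • m)))
  have hconst (t : ℝ) (ht : t ∈ Metric.ball 0 δ) : γ t = 1 := by
    have h₁ := (convex_ball (0 : ℝ) δ).is_const_of_fderivWithin_eq_zero (𝕜 := ℝ)
      (f := fun t => extChartAt I m (γ t • m))
      (fun x hx => (hd x hx).differentiableAt.differentiableWithinAt)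
      (fun x hx => (hd x hx).hasFDerivWithinAt.fderivWithin
        (Metric.isOpen_ball.uniqueDiffWithinAt hx)) ht (Metric.mem_ball_self hδ)
    have h₂ := (extChartAt I m).injOn (hball t ht).2 (hball 0 (Metric.mem_ball_self hδ)).2 h₁
    exact hfree _ m (h₂.trans hcm)
  have h₁ : γ =ᶠ[𝓝 0] fun _ => (1 : G) := by
    filter_upwards [Metric.ball_mem_nhds (0 : ℝ) hδ] with t ht using hconst t ht
  have h₂ := hasMFDerivAt_unique (hγ.self_of_nhds)
    ((hasMFDerivAt_const (I := 𝓘(ℝ, ℝ)) (I' := IG) (1 : G) (0 : ℝ)).congr_of_eventuallyEq h₁)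
  have h₃ := DFunLike.congr_fun h₂ (1 : ℝ)
  have key : ∀ z : G, z = 1 → (mulInvariantVectorField (I := IG) ξ z : EG) = ξ := by
    rintro z rfl
    have : (fun h : G => 1 * h) = id := funext one_mul
    change mfderiv IG IG (fun h : G => 1 * h) 1 ξ = ξ
    rw [this]
    exact DFunLike.congr_fun (mfderiv_id (I := IG) (x := (1 : G))) ξ
  exact (key _ hγ₀).symm.trans ((one_smul ℝ _).symm.trans h₃)

end InfGen

end Nonholonomic

end

noncomputable section

set_option linter.unusedSectionVars false

namespace Nonholonomic

/-! ### The connection form of a vertical complement spanned by generators -/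

section Charts

variable {E : Type*} [NormedAddCommGroup E] [NormedSpace ℝ E]
  {H : Type*} [TopologicalSpace H] {I : ModelWithCorners ℝ E H} [I.Boundaryless]
  {M : Type*} [TopologicalSpace M] [ChartedSpace H M] [IsManifold I ∞ M]
  {F : Type*} [NormedAddCommGroup F] [NormedSpace ℝ F]
  {F' : Type*} [NormedAddCommGroup F'] [NormedSpace ℝ F']

/-- A family of linear functionals read in the chart around `x`. -/
def formInChart (a : (m : M) → TangentSpace I m →L[ℝ] F) (x : M) (y : E) : E →L[ℝ] F :=
  a ((extChartAt I x).symm y) ∘L mfderiv 𝓘(ℝ, E) I (extChartAt I x).symm y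

/-- A family of linear maps into the tangent spaces read in the chart around `x`. -/
def vecInChart (L : (m : M) → F →L[ℝ] TangentSpace I m) (x : M) (y : E) : F →L[ℝ] E :=
  (mfderiv I 𝓘(ℝ, E) (extChartAt I x) ((extChartAt I x).symm y)) ∘L L ((extChartAt I x).symm y)

theorem formInChart_vecInChart (a : (m : M) → TangentSpace I m →L[ℝ] F)
    (L : (m : M) → F' →L[ℝ] TangentSpace I m) {x : M} {y : E} (hy : y ∈ (extChartAt I x).target)
    (v : F') : formInChart a x y (vecInChart L x y v) =
      a ((extChartAt I x).symm y) (L ((extChartAt I x).symm y) v) :=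
  congrArg (a ((extChartAt I x).symm y))
    (DFunLike.congr_fun (mfderiv_symm_comp_mfderiv (I := I) hy) _)

theorem formInChart_mfderiv (a : (m : M) → TangentSpace I m →L[ℝ] F) {x : M} {y : E}
    (hy : y ∈ (extChartAt I x).target) (v : TangentSpace I ((extChartAt I x).symm y)) :
    formInChart a x y (mfderiv I 𝓘(ℝ, E) (extChartAt I x) ((extChartAt I x).symm y) v) =
      a ((extChartAt I x).symm y) v :=
  congrArg (a ((extChartAt I x).symm y))
    (DFunLike.congr_fun (mfderiv_symm_comp_mfderiv (I := I) hy) _)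

theorem formInChart_self (a : (m : M) → TangentSpace I m →L[ℝ] F) (x : M) :
    formInChart a x (extChartAt I x x) = a x := by
  have key : ∀ z, z = x → (a z : E →L[ℝ] F) = a x := by rintro z rfl; rfl
  ext v
  exact (congrArg (a ((extChartAt I x).symm (extChartAt I x x)))
    (DFunLike.congr_fun (mfderiv_symm_self (I := I) x) v)).trans
      (DFunLike.congr_fun (key ((extChartAt I x).symm (extChartAt I x x))
        (extChartAt_to_inv x)) v)

theorem vecInChart_self (L : (m : M) → F →L[ℝ] TangentSpace I m) (x : M) :
    vecInChart L x (extChartAt I x x) = L x := by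
  have key : ∀ z, z = x → ∀ v, (mfderiv I 𝓘(ℝ, E) (extChartAt I x) z (L z v) : E) = L x v := by
    rintro z rfl v
    exact DFunLike.congr_fun (mfderiv_extChartAt_self (I := I) (x := z)) _
  ext v
  exact key _ (extChartAt_to_inv x) v

theorem contDiffAt_formInChart {a : (m : M) → TangentSpace I m →L[ℝ] F} {x : M}
    (ha : (oneForm a).SmoothAt x) : ContDiffAt ℝ ∞ (formInChart a x) (extChartAt I x x) :=
  (oneForm_smoothAt_iff a x).1 ha

end Charts

/-! ### Smooth dependence of the generators on the point -/

section InfGen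

variable {EG : Type*} [NormedAddCommGroup EG] [NormedSpace ℝ EG]
  {HG : Type*} [TopologicalSpace HG] {IG : ModelWithCorners ℝ EG HG} [IG.Boundaryless]
  {G : Type*} [TopologicalSpace G] [ChartedSpace HG G] [Group G] [IsManifold IG ∞ G]
  {E : Type*} [NormedAddCommGroup E] [NormedSpace ℝ E]
  {H : Type*} [TopologicalSpace H] {I : ModelWithCorners ℝ E H} [I.Boundaryless]
  {M : Type*} [TopologicalSpace M] [ChartedSpace H M] [IsManifold I ∞ M] [MulAction G M]

/-- In charts the generator map is the partial derivative, in the group variable at the identity, of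
the smooth action map. -/
theorem contDiffAt_infGen_inChart
    (hsm : ContMDiff (IG.prod I) I ∞ (fun p : G × M => p.1 • p.2)) (m : M) :
    ContDiffAt ℝ ∞ (vecInChart (infGen IG G I) m) (extChartAt I m m) := by
  set χ := extChartAt IG (1 : G) with hχ
  set φ := extChartAt I m with hφ
  set f : E → EG → E := fun y a => φ (χ.symm a • φ.symm y) with hf
  have hχ1 : χ.symm (χ 1) = 1 := extChartAt_to_inv _
  have ht₁ : χ 1 ∈ χ.target := mem_extChartAt_target _
  have ht₂ : φ m ∈ φ.target := mem_extChartAt_target _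
  have hfs : ContDiffAt ℝ ∞ (Function.uncurry f) (φ m, χ 1) := by
    have h₁ : ContMDiffAt 𝓘(ℝ, E × EG) IG ∞ (fun p : E × EG => χ.symm p.2) (φ m, χ 1) :=
      ContMDiffAt.comp (g := χ.symm) (φ m, χ 1) (contMDiffAt_extChartAt_symm ht₁)
        contDiffAt_snd.contMDiffAt
    have h₂ : ContMDiffAt 𝓘(ℝ, E × EG) I ∞ (fun p : E × EG => φ.symm p.1) (φ m, χ 1) :=
      ContMDiffAt.comp (g := φ.symm) (φ m, χ 1) (contMDiffAt_extChartAt_symm ht₂)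
        contDiffAt_fst.contMDiffAt
    have h₃ : ContMDiffAt 𝓘(ℝ, E × EG) I ∞ (fun p : E × EG => χ.symm p.2 • φ.symm p.1)
        (φ m, χ 1) :=
      ContMDiffAt.comp (g := fun p : G × M => p.1 • p.2) (φ m, χ 1) hsm.contMDiffAt (h₁.prodMk h₂)
    refine ContMDiffAt.contDiffAt (ContMDiffAt.comp (g := φ) (φ m, χ 1) ?_ h₃)
    refine contMDiffAt_extChartAt' ?_
    change χ.symm (χ 1) • φ.symm (φ m) ∈ _
    rw [hχ1, one_smul, extChartAt_to_inv]
    exact mem_chart_source _ _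
  have h₁ : ContDiffAt ℝ ∞ (fun y => fderiv ℝ (f y) (χ 1)) (φ m) :=
    ContDiffAt.fderiv (n := ∞) (f := f) (g := fun _ => χ 1) hfs contDiffAt_const (by simp)
  refine h₁.congr_of_eventuallyEq ?_
  filter_upwards [extChartAt_target_mem_nhds (I := I) m] with y hy
  have hs : φ.symm y ∈ φ.source := φ.map_target hy
  have h₂ : HasMFDerivAt IG I (fun g : G => g • φ.symm y) (χ.symm (χ 1))
      (infGen IG G I (φ.symm y) : EG →L[ℝ] E) := by
    have key : ∀ z, z = (1 : G) → HasMFDerivAt IG I (fun g : G => g • φ.symm y) z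
      (infGen IG G I (φ.symm y) : EG →L[ℝ] E) := by
      rintro z rfl
      exact ((contMDiff_smul_right hsm _).mdifferentiableAt (by simp)).hasMFDerivAt
    exact key _ hχ1
  have h₃ : HasMFDerivAt I 𝓘(ℝ, E) φ (χ.symm (χ 1) • φ.symm y)
      (mfderiv I 𝓘(ℝ, E) φ (φ.symm y) : E →L[ℝ] E) := by
    have key : ∀ z, z = φ.symm y → HasMFDerivAt I 𝓘(ℝ, E) φ z
      (mfderiv I 𝓘(ℝ, E) φ (φ.symm y) : E →L[ℝ] E) := by
      rintro z rfl
      exact (mdifferentiableAt_extChartAt' hs).hasMFDerivAt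
    exact key _ (by rw [hχ1, one_smul])
  have h₅ : HasMFDerivAt 𝓘(ℝ, EG) I (fun a : EG => χ.symm a • φ.symm y) (χ 1)
      ((infGen IG G I (φ.symm y) : EG →L[ℝ] E) ∘L
        (mfderiv 𝓘(ℝ, EG) IG χ.symm (χ 1) : EG →L[ℝ] EG)) :=
    HasMFDerivAt.comp (g := fun g : G => g • φ.symm y) (χ 1)
      h₂ (mdifferentiableAt_extChartAt_symm ht₁).hasMFDerivAt
  have h₄ : HasMFDerivAt 𝓘(ℝ, EG) 𝓘(ℝ, E) (f y) (χ 1)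
      ((mfderiv I 𝓘(ℝ, E) φ (φ.symm y) : E →L[ℝ] E) ∘L ((infGen IG G I (φ.symm y) : EG →L[ℝ] E) ∘L
        (mfderiv 𝓘(ℝ, EG) IG χ.symm (χ 1) : EG →L[ℝ] EG))) :=
    HasMFDerivAt.comp (g := φ) (χ 1) h₃ h₅
  obtain ⟨D, hD⟩ : ∃ D : EG →L[ℝ] E, ∀ v, D v = (mfderiv I 𝓘(ℝ, E) φ (φ.symm y) : E →L[ℝ] E)
      ((infGen IG G I (φ.symm y) : EG →L[ℝ] E)
        ((mfderiv 𝓘(ℝ, EG) IG χ.symm (χ 1) : EG →L[ℝ] EG) v)) :=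
    ⟨(mfderiv I 𝓘(ℝ, E) φ (φ.symm y) : E →L[ℝ] E).comp ((infGen IG G I (φ.symm y) : EG →L[ℝ] E).comp
        (mfderiv 𝓘(ℝ, EG) IG χ.symm (χ 1) : EG →L[ℝ] EG)), fun _ => rfl⟩
  have h₆ : HasFDerivAt (f y) D (χ 1) :=
    (hasMFDerivAt_iff_hasFDerivAt.1 h₄).congr_fderiv (ContinuousLinearMap.ext fun v => (hD v).symm)
  refine Eq.symm (h₆.fderiv.trans (ContinuousLinearMap.ext fun v => (hD v).trans ?_))
  exact congrArg (fun w => (mfderiv I 𝓘(ℝ, E) φ (φ.symm y) : E →L[ℝ] E)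
    ((infGen IG G I (φ.symm y) : EG →L[ℝ] E) w))
    (DFunLike.congr_fun (mfderiv_symm_self (I := IG) (1 : G)) v)

end InfGen

/-! ### Invariant splittings and the connection form -/

section Splitting

variable {EG : Type*} [NormedAddCommGroup EG] [NormedSpace ℝ EG]
  {HG : Type*} [TopologicalSpace HG] {IG : ModelWithCorners ℝ EG HG} [IG.Boundaryless]
  {G : Type*} [TopologicalSpace G] [ChartedSpace HG G] [Group G] [IsManifold IG ∞ G]
  {E : Type*} [NormedAddCommGroup E] [NormedSpace ℝ E] [FiniteDimensional ℝ E]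
  {H : Type*} [TopologicalSpace H] {I : ModelWithCorners ℝ E H} [I.Boundaryless]
  {M : Type*} [TopologicalSpace M] [ChartedSpace H M] [IsManifold I ∞ M] [MulAction G M]
  {F : Type*} [NormedAddCommGroup F] [NormedSpace ℝ F]

variable (IG G) in
/-- An invariant splitting `TM = C ⊕ W` where `W` is spanned by the generators of the elements of
`S`, for an action with injective generator maps. -/
structure VerticalSplitting (C W : Distribution I M) (S : Submodule ℝ EG) : Prop where
  isCompl : ∀ m : M, IsCompl (C m) (W m)
  mem_iff : ∀ (m : M) (v : TangentSpace I m), v ∈ W m ↔ ∃ ξ ∈ S, infGen IG G I m ξ = v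
  injective : ∀ m : M, Function.Injective (infGen IG G I m)
  map_C : ∀ (g : G) (m : M), ∀ v ∈ C m, mfderiv I I (fun m : M => g • m) m v ∈ C (g • m)
  map_W : ∀ (g : G) (m : M), ∀ v ∈ W m, mfderiv I I (fun m : M => g • m) m v ∈ W (g • m)

variable (IG G) in
/-- The connection form as a family of linear maps. -/
def connectionMap (C W : Distribution I M) (m : M) : TangentSpace I m →L[ℝ] EG :=
  LinearMap.toContinuousLinearMap
    ((infGen IG G I m).toLinearMap.leftInverse ∘ₗ (proj W C m).toLinearMap)

theorem connectionForm_eq (C W : Distribution I M) :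
    connectionForm IG G C W = oneForm (connectionMap IG G C W) := rfl

theorem proj_eq {C W : Distribution I M} {m : M} (h : IsCompl (C m) (W m))
    (v : TangentSpace I m) : proj C W m v = (C m).projection (W m) h v := by
  have : proj C W m = LinearMap.toContinuousLinearMap ((C m).projection (W m) h) := dif_pos h
  rw [this]; rfl

theorem proj_mem {C W : Distribution I M} {m : M} (h : IsCompl (C m) (W m))
    (v : TangentSpace I m) : proj C W m v ∈ C m := by
  rw [proj_eq h]; exact Submodule.projection_apply_mem _ _

theorem proj_of_mem {C W : Distribution I M} {m : M} (h : IsCompl (C m) (W m))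
    {v : TangentSpace I m} (hv : v ∈ C m) : proj C W m v = v := by
  rw [proj_eq h]; exact Submodule.projection_apply_of_mem_left _ hv

theorem proj_of_mem_right {C W : Distribution I M} {m : M} (h : IsCompl (C m) (W m))
    {v : TangentSpace I m} (hv : v ∈ W m) : proj C W m v = 0 := by
  rw [proj_eq h]; exact (Submodule.projection_apply_eq_zero_iff _).2 hv

theorem proj_add_proj {C W : Distribution I M} {m : M} (h : IsCompl (C m) (W m))
    (v : TangentSpace I m) : proj C W m v + proj W C m v = v := by
  rw [proj_eq h, proj_eq h.symm]; exact Submodule.projection_add_projection_eq_self h v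

variable {C W : Distribution I M} {S : Submodule ℝ EG}

namespace VerticalSplitting

variable (hS : VerticalSplitting IG G C W S)
include hS

theorem infGen_mem {ξ : EG} (hξ : ξ ∈ S) (m : M) : infGen IG G I m ξ ∈ W m :=
  (hS.mem_iff m _).2 ⟨ξ, hξ, rfl⟩

theorem connectionMap_infGen {ξ : EG} (hξ : ξ ∈ S) (m : M) :
    connectionMap IG G C W m (infGen IG G I m ξ) = ξ :=
  (congrArg (infGen IG G I m).toLinearMap.leftInverse
    (proj_of_mem (hS.isCompl m).symm (hS.infGen_mem hξ m))).trans
    (LinearMap.leftInverse_apply_of_inj (f := (infGen IG G I m).toLinearMap)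
      (LinearMap.ker_eq_bot.2 (hS.injective m)) ξ)

theorem connectionMap_of_mem {m : M} {v : TangentSpace I m} (hv : v ∈ C m) :
    connectionMap IG G C W m v = 0 :=
  (congrArg (infGen IG G I m).toLinearMap.leftInverse
    (proj_of_mem_right (hS.isCompl m).symm hv)).trans (map_zero _)

theorem exists_decomposition (m : M) (v : TangentSpace I m) :
    ∃ ξ ∈ S, v = proj C W m v + infGen IG G I m ξ ∧ connectionMap IG G C W m v = ξ := by
  obtain ⟨ξ, hξ, h⟩ := (hS.mem_iff m _).1 (proj_mem (hS.isCompl m).symm v)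
  refine ⟨ξ, hξ, by rw [h]; exact (proj_add_proj (hS.isCompl m) v).symm, ?_⟩
  refine (congrArg (infGen IG G I m).toLinearMap.leftInverse h.symm).trans ?_
  exact LinearMap.leftInverse_apply_of_inj (f := (infGen IG G I m).toLinearMap)
      (LinearMap.ker_eq_bot.2 (hS.injective m)) ξ

theorem infGen_connectionMap (m : M) (v : TangentSpace I m) :
    infGen IG G I m (connectionMap IG G C W m v) = proj W C m v := by
  obtain ⟨ξ, hξ, h₁, h₂⟩ := hS.exists_decomposition m v
  rw [h₂]
  have h₃ := proj_add_proj (hS.isCompl m) v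
  rw [h₁] at h₃
  rw [← h₁] at h₃
  exact add_left_cancel (h₁.symm.trans h₃.symm)

theorem proj_eq_sub (m : M) (v : TangentSpace I m) :
    proj C W m v = v - infGen IG G I m (connectionMap IG G C W m v) := by
  rw [hS.infGen_connectionMap]
  exact eq_sub_of_add_eq (proj_add_proj (hS.isCompl m) v)

theorem proj_smul (g : G) (m : M) (v : TangentSpace I m) :
    proj C W (g • m) (mfderiv I I (fun m : M => g • m) m v) =
      mfderiv I I (fun m : M => g • m) m (proj C W m v) := by
  have h := congrArg (mfderiv I I (fun m : M => g • m) m) (proj_add_proj (hS.isCompl m) v)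
  rw [map_add] at h
  rw [← h, map_add]
  refine Eq.trans (congrArg₂ (· + ·) (proj_of_mem (hS.isCompl _)
    (hS.map_C g m _ (proj_mem (hS.isCompl m) v))) (proj_of_mem_right (hS.isCompl _)
    (hS.map_W g m _ (proj_mem (hS.isCompl m).symm v)))) (add_zero _)

end VerticalSplitting

/-- Let `a` be local equations of `C`. On `S` the composite of `a` with the generator map is
injective, since `C` meets `W` only in zero, so it has a smooth left inverse `L`. As `a` kills the
`C` part of a vector, the connection form is `L ∘ a`. -/
theorem VerticalSplitting.smoothAt_connectionForm [FiniteDimensional ℝ EG]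
    [FiniteDimensional ℝ F] (hS : VerticalSplitting IG G C W S)
    (hsm : ContMDiff (IG.prod I) I ∞ (fun p : G × M => p.1 • p.2)) (hC : C.IsLocallyKer F) (m : M) :
    (connectionForm IG G C W).SmoothAt m := by
  obtain ⟨a, ha, haC⟩ := hC m
  set Y : E → S →L[ℝ] F := fun y =>
    formInChart a m y ∘L vecInChart (infGen IG G I) m y ∘L S.subtypeL with hY
  have hYs : ContDiffAt ℝ ∞ Y (extChartAt I m m) :=
    (contDiffAt_formInChart ha).clm_comp
      ((contDiffAt_infGen_inChart hsm m).clm_comp contDiffAt_const)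
  have hYa {y : E} (hy : y ∈ (extChartAt I m).target) (ξ : S) : Y y ξ =
      a ((extChartAt I m).symm y) (infGen IG G I ((extChartAt I m).symm y) ξ) :=
    formInChart_vecInChart a (infGen IG G I) hy _
  have hinj : Function.Injective (Y (extChartAt I m m)) := by
    refine (injective_iff_map_eq_zero _).2 fun ξ hξ => ?_
    rw [hYa (mem_extChartAt_target m)] at hξ
    have h₁ : infGen IG G I ((extChartAt I m).symm (extChartAt I m m)) (ξ : EG) ∈
        C ((extChartAt I m).symm (extChartAt I m m)) := by
      have h₀ : ∀ᶠ q in 𝓝 ((extChartAt I m).symm (extChartAt I m m)),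
          ∀ v, v ∈ C q ↔ a q v = 0 := by rwa [extChartAt_to_inv]
      exact (h₀.self_of_nhds _).2 hξ
    have h₂ := (Submodule.disjoint_def.1 (hS.isCompl _).disjoint) _ h₁ (hS.infGen_mem ξ.2 _)
    exact Subtype.ext (hS.injective _ (h₂.trans (map_zero _).symm))
  obtain ⟨L, hL, hLY⟩ := exists_contDiffAt_leftInverse hYs hinj
  rw [connectionForm_eq, oneForm_smoothAt_iff]
  have h₁ : ContDiffAt ℝ ∞ (fun y => S.subtypeL ∘L L y ∘L formInChart a m y) (extChartAt I m m) :=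
    contDiffAt_const.clm_comp (hL.clm_comp (contDiffAt_formInChart ha))
  refine h₁.congr_of_eventuallyEq ?_
  have h₂ : ∀ᶠ y in 𝓝 (extChartAt I m m), ∀ v : TangentSpace I ((extChartAt I m).symm y),
      v ∈ C ((extChartAt I m).symm y) ↔ a ((extChartAt I m).symm y) v = 0 :=
    (continuousAt_extChartAt_symm (I := I) m).eventually (by rwa [extChartAt_to_inv])
  filter_upwards [extChartAt_target_mem_nhds (I := I) m, hLY, h₂] with y hy hLy hay
  ext v
  set z := (extChartAt I m).symm y
  set w : TangentSpace I z := mfderiv 𝓘(ℝ, E) I (extChartAt I m).symm y v with hw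
  obtain ⟨ξ, hξ, h₃, h₄⟩ := hS.exists_decomposition z w
  have h₅ : a z w = Y y ⟨ξ, hξ⟩ := by
    rw [hYa hy, h₃, map_add, (hay _).1 (proj_mem (hS.isCompl z) w), zero_add]
  have h₆ : L y (formInChart a m y v) = ⟨ξ, hξ⟩ := (congrArg (L y) h₅).trans (hLy _)
  exact h₄.trans (congrArg Subtype.val h₆).symm

end Splitting

end Nonholonomic

end

noncomputable section

set_option linter.unusedSectionVars false

namespace Nonholonomic

/-! ### Curvature and the form `⟨J, K⟩` -/

section NormedSpaceForms

variable {E : Type*} [NormedAddCommGroup E] [NormedSpace ℝ E]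
  {E' : Type*} [NormedAddCommGroup E'] [NormedSpace ℝ E']
  {F : Type*} [NormedAddCommGroup F] [NormedSpace ℝ F]
  {V : Type*} [NormedAddCommGroup V] [NormedSpace ℝ V]

theorem two_form_add_left (η : E [⋀^Fin 2]→L[ℝ] F) (u u' v : E) :
    η ![u + u', v] = η ![u, v] + η ![u', v] := by
  simp only [← bilin_apply, map_add, add_apply]

theorem two_form_add_right (η : E [⋀^Fin 2]→L[ℝ] F) (u v v' : E) :
    η ![u, v + v'] = η ![u, v] + η ![u, v'] := by
  simp only [← bilin_apply, map_add]

theorem two_form_zero_left (η : E [⋀^Fin 2]→L[ℝ] F) (v : E) : η ![0, v] = 0 := by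
  simp only [← bilin_apply, map_zero, zero_apply]

theorem two_form_zero_right (η : E [⋀^Fin 2]→L[ℝ] F) (v : E) : η ![v, 0] = 0 := by
  simp only [← bilin_apply, map_zero]

/-- The pullback of a two-form under bundle maps vanishes to second order on the kernel. -/
theorem extDeriv_comp_eq_zero {μ : E → E' [⋀^Fin 2]→L[ℝ] F} {T : E → E →L[ℝ] E'}
    {ζ : E → E [⋀^Fin 2]→L[ℝ] F} {x : E} (hζ : ζ =ᶠ[𝓝 x] fun y => (μ y).compContinuousLinearMap (T y))
    (hμ : ContDiffAt ℝ ∞ μ x) (hT : ContDiffAt ℝ ∞ T x) {u v w : E} (hu : T x u = 0)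
    (hv : T x v = 0) (hw : T x w = 0) : extDeriv ζ x ![u, v, w] = 0 := by
  rw [hζ.extDeriv_eq, extDeriv_two_apply
    ((contDiffAt_compContinuousLinearMap hμ hT).differentiableAt (by simp))]
  -- Every term of the product rule keeps at least one undifferentiated factor `T x v` or `T x w`.
  have key (u v w : E) (hv : T x v = 0) (hw : T x w = 0) :
      fderiv ℝ (fun y => (μ y).compContinuousLinearMap (T y) ![v, w]) x u = 0 := by
    have hT' (v : E) : DifferentiableAt ℝ (fun y => T y v) x :=
      (hT.clm_apply contDiffAt_const).differentiableAt (by simp)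
    have h₁ : (fun y => (μ y).compContinuousLinearMap (T y) ![v, w]) =
        fun y => μ y ![T y v, T y w] := by
      funext y
      refine congrArg (μ y) ?_
      ext i; fin_cases i <;> rfl
    rw [h₁, hasFDerivAt_two_form_apply (hμ.differentiableAt (by simp)) (hT' v) (hT' w)]
    simp [hv, hw, two_form_zero_right, two_form_zero_left]
  rw [key u v w hv hw, key v w u hw hu, key w u v hu hv]
  simp

theorem contDiffAt_compContinuousAlternatingMap {X : Type*} [NormedAddCommGroup X]
    [NormedSpace ℝ X] {k : ℕ} {J : X → V →L[ℝ] F} {κ : X → E [⋀^Fin k]→L[ℝ] V} {x : X}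
    (hJ : ContDiffAt ℝ ∞ J x) (hκ : ContDiffAt ℝ ∞ κ x) :
    ContDiffAt ℝ ∞ (fun y => (J y).compContinuousAlternatingMap (κ y)) x := by
  refine contDiffAt_of_toContinuousMultilinearMap ?_
  have h₁ : ContDiffAt ℝ ∞ (fun y => (κ y).toContinuousMultilinearMap) x :=
    (ContinuousAlternatingMap.toContinuousMultilinearMapLI (𝕜 := ℝ) (ι := Fin k) (E := E)
      (F := V)).contDiff.contDiffAt.comp x hκ
  exact ((ContinuousLinearMap.compContinuousMultilinearMapL ℝ (fun _ : Fin k => E) V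
    F).contDiff.contDiffAt.comp x hJ).clm_apply h₁

theorem extDeriv_pairing {J : E → V →L[ℝ] ℝ} {κ : E → E [⋀^Fin 2]→L[ℝ] V} {x : E}
    (hJ : ContDiffAt ℝ ∞ J x) (hκ : ContDiffAt ℝ ∞ κ x) (u v w : E) :
    extDeriv (fun y => (J y).compContinuousAlternatingMap (κ y)) x ![u, v, w] =
      fderiv ℝ J x u (κ x ![v, w]) + fderiv ℝ J x v (κ x ![w, u]) + fderiv ℝ J x w (κ x ![u, v]) +
        J x (extDeriv κ x ![u, v, w]) := by
  have hκ' : DifferentiableAt ℝ κ x := hκ.differentiableAt (by simp)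
  rw [extDeriv_two_apply
    ((contDiffAt_compContinuousAlternatingMap hJ hκ).differentiableAt (by simp)),
    extDeriv_two_apply hκ']
  have key (u v w : E) : fderiv ℝ (fun y => (J y).compContinuousAlternatingMap (κ y) ![v, w]) x u =
      fderiv ℝ J x u (κ x ![v, w]) + J x (fderiv ℝ (fun y => κ y ![v, w]) x u) := by
    have h₁ : DifferentiableAt ℝ (fun y => κ y ![v, w]) x :=
      differentiableAt_two_form_apply hκ' (differentiableAt_const v) (differentiableAt_const w)
    refine (DFunLike.congr_fun ((hJ.differentiableAt (by simp)).hasFDerivAt.clm_apply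
      h₁.hasFDerivAt).fderiv u).trans ?_
    simp [add_comm]
  rw [key, key, key]
  simp only [map_add]
  ring

/-- In `d⟨J, A⟩ = dJ ∧ A + ⟨J, dA⟩` the first term vanishes when both arguments lie in the kernel of
`A`. -/
theorem extDeriv_sub_comp {θ : E → E →L[ℝ] ℝ} {J : E → V →L[ℝ] ℝ} {A : E → E →L[ℝ] V}
    {x : E} (hθ : ContDiffAt ℝ ∞ θ x) (hJ : ContDiffAt ℝ ∞ J x) (hA : ContDiffAt ℝ ∞ A x)
    {ζ α : E → E [⋀^Fin 1]→L[ℝ] ℝ} {β : E → E [⋀^Fin 1]→L[ℝ] V}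
    (hζ : ∀ᶠ y in 𝓝 x, ∀ v, ζ y ![v] = θ y v - J y (A y v)) (hζd : DifferentiableAt ℝ ζ x)
    (hα : ∀ᶠ y in 𝓝 x, ∀ v, α y ![v] = θ y v) (hαd : DifferentiableAt ℝ α x)
    (hβ : ∀ᶠ y in 𝓝 x, ∀ v, β y ![v] = A y v) (hβd : DifferentiableAt ℝ β x)
    {u v : E} (hu : A x u = 0) (hv : A x v = 0) :
    extDeriv ζ x ![u, v] = extDeriv α x ![u, v] - J x (extDeriv β x ![u, v]) := by
  rw [extDeriv_one_apply hζd, extDeriv_one_apply hαd, extDeriv_one_apply hβd]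
  have h₁ (v : E) : (fun y => ζ y ![v]) =ᶠ[𝓝 x] fun y => θ y v - J y (A y v) :=
    hζ.mono fun y hy => hy v
  have h₂ (v : E) : (fun y => α y ![v]) =ᶠ[𝓝 x] fun y => θ y v := hα.mono fun y hy => hy v
  have h₃ (v : E) : (fun y => β y ![v]) =ᶠ[𝓝 x] fun y => A y v := hβ.mono fun y hy => hy v
  have hθ' (v : E) : DifferentiableAt ℝ (fun y => θ y v) x :=
    (hθ.clm_apply contDiffAt_const).differentiableAt (by simp)
  have hA' (v : E) : DifferentiableAt ℝ (fun y => A y v) x :=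
    (hA.clm_apply contDiffAt_const).differentiableAt (by simp)
  have hJ' := (hJ.differentiableAt (by simp)).hasFDerivAt
  have key (u v : E) (hv : A x v = 0) : fderiv ℝ (fun y => θ y v - J y (A y v)) x u =
      fderiv ℝ (fun y => θ y v) x u - J x (fderiv ℝ (fun y => A y v) x u) := by
    refine (DFunLike.congr_fun ((hθ' v).hasFDerivAt.sub
      (hJ'.clm_apply (hA' v).hasFDerivAt)).fderiv u).trans ?_
    simp [hv]
  rw [(h₁ v).fderiv_eq, (h₁ u).fderiv_eq, (h₂ v).fderiv_eq, (h₂ u).fderiv_eq, (h₃ v).fderiv_eq,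
    (h₃ u).fderiv_eq, key u v hv, key v u hu, map_sub]
  ring

end NormedSpaceForms

/-! ### Structure equation and the vanishing of the differential of the curvature on `C` -/

section Splitting

variable {EG : Type*} [NormedAddCommGroup EG] [NormedSpace ℝ EG] [FiniteDimensional ℝ EG]
  {HG : Type*} [TopologicalSpace HG] {IG : ModelWithCorners ℝ EG HG} [IG.Boundaryless]
  {G : Type*} [TopologicalSpace G] [ChartedSpace HG G] [Group G] [IsManifold IG ∞ G]
  {E : Type*} [NormedAddCommGroup E] [NormedSpace ℝ E] [FiniteDimensional ℝ E]
  {H : Type*} [TopologicalSpace H] {I : ModelWithCorners ℝ E H} [I.Boundaryless]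
  {M : Type*} [TopologicalSpace M] [ChartedSpace H M] [IsManifold I ∞ M] [MulAction G M]
  {F : Type*} [NormedAddCommGroup F] [NormedSpace ℝ F] [FiniteDimensional ℝ F]
  {V : Type*} [NormedAddCommGroup V] [NormedSpace ℝ V]
  {C W : Distribution I M} {S : Submodule ℝ EG}

theorem DForm.add_left (η : DForm I M V 2) (x : M) (u u' v : TangentSpace I x) :
    η x ![u + u', v] = η x ![u, v] + η x ![u', v] :=
  two_form_add_left (E := E) (η x) u u' v

theorem DForm.add_right (η : DForm I M V 2) (x : M) (u v v' : TangentSpace I x) :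
    η x ![u, v + v'] = η x ![u, v] + η x ![u, v'] :=
  two_form_add_right (E := E) (η x) u v v'

/-- The form `η (P_C ·, …, P_C ·)`. -/
def DForm.horizontal {k : ℕ} (C W : Distribution I M) (η : DForm I M V k) : DForm I M V k :=
  fun m => (η m).compContinuousLinearMap (proj C W m)

theorem DForm.horizontal_apply (η : DForm I M V 2) (m : M) (u v : TangentSpace I m) :
    η.horizontal C W m ![u, v] = η m ![proj C W m u, proj C W m v] := by
  refine congrArg (η m) ?_
  ext i; fin_cases i <;> rfl

theorem curvature_eq : curvature IG G C W = (connectionForm IG G C W).d.horizontal C W := rfl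

variable (IG G) in
/-- The projection `P_W` read in the chart around `x`. -/
def verticalInChart (C W : Distribution I M) (x : M) (y : E) : E →L[ℝ] E :=
  vecInChart (infGen IG G I) x y ∘L formInChart (connectionMap IG G C W) x y

namespace VerticalSplitting

variable (hS : VerticalSplitting IG G C W S)
include hS

theorem mfderiv_symm_verticalInChart {x : M} {y : E} (hy : y ∈ (extChartAt I x).target) (v : E) :
    mfderiv 𝓘(ℝ, E) I (extChartAt I x).symm y (verticalInChart IG G C W x y v) =
      proj W C ((extChartAt I x).symm y) (mfderiv 𝓘(ℝ, E) I (extChartAt I x).symm y v) :=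
  (DFunLike.congr_fun (mfderiv_symm_comp_mfderiv (I := I) hy) _).trans
    (hS.infGen_connectionMap _ _)

theorem mfderiv_symm_id_sub {x : M} {y : E} (hy : y ∈ (extChartAt I x).target) (v : E) :
    mfderiv 𝓘(ℝ, E) I (extChartAt I x).symm y (v - verticalInChart IG G C W x y v) =
      proj C W ((extChartAt I x).symm y) (mfderiv 𝓘(ℝ, E) I (extChartAt I x).symm y v) := by
  rw [hS.proj_eq_sub, hS.infGen_connectionMap, ← hS.mfderiv_symm_verticalInChart hy]
  exact map_sub _ _ _

theorem verticalInChart_self (x : M) (v : TangentSpace I x) :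
    verticalInChart IG G C W x (extChartAt I x x) v = proj W C x v := by
  refine Eq.trans ?_ (hS.infGen_connectionMap x v)
  refine Eq.trans ?_ (DFunLike.congr_fun (vecInChart_self (infGen IG G I) x) _)
  exact congrArg (vecInChart (infGen IG G I) x (extChartAt I x x))
    (DFunLike.congr_fun (formInChart_self (connectionMap IG G C W) x) v)

variable (hsm : ContMDiff (IG.prod I) I ∞ (fun p : G × M => p.1 • p.2)) (hC : C.IsLocallyKer F)
include hsm hC

theorem contDiffAt_verticalInChart (x : M) :
    ContDiffAt ℝ ∞ (verticalInChart IG G C W x) (extChartAt I x x) :=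
  (contDiffAt_infGen_inChart hsm x).clm_comp
    (contDiffAt_formInChart (hS.smoothAt_connectionForm hsm hC x))

omit hsm hC in
theorem inChart_horizontal {k : ℕ} (η : DForm I M V k) (x : M) :
    (η.horizontal C W).inChart x =ᶠ[𝓝 (extChartAt I x x)] fun y =>
      (η.inChart x y).compContinuousLinearMap
        (ContinuousLinearMap.id ℝ E - verticalInChart IG G C W x y) := by
  filter_upwards [extChartAt_target_mem_nhds (I := I) x] with y hy
  ext v
  refine congrArg (η ((extChartAt I x).symm y)) (funext fun i => ?_)
  exact (hS.mfderiv_symm_id_sub hy (v i)).symm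

theorem smoothAt_horizontal {k : ℕ} {η : DForm I M V k} {x : M} (hη : η.SmoothAt x) :
    (η.horizontal C W).SmoothAt x :=
  ContDiffAt.congr_of_eventuallyEq (contDiffAt_compContinuousLinearMap hη
    (contDiffAt_const.sub (hS.contDiffAt_verticalInChart hsm hC x)))
    (hS.inChart_horizontal η x)

theorem isSmooth_connectionForm : (connectionForm IG G C W).IsSmooth :=
  DForm.isSmooth_iff.2 (hS.smoothAt_connectionForm hsm hC)

theorem isSmooth_curvature : (curvature IG G C W).IsSmooth :=
  DForm.isSmooth_iff.2 fun x =>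
    hS.smoothAt_horizontal hsm hC ((hS.isSmooth_connectionForm hsm hC).d.smoothAt x)

/-- Here vertical symmetry is decisive: for fixed `ξ` in `S` the connection form is the constant `ξ`
on the generator, and it vanishes on all translates of `v` because `C` is invariant. -/
theorem d_connectionForm_infGen {ξ : EG} (hξ : ξ ∈ S) {m : M} {v : TangentSpace I m}
    (hv : v ∈ C m) : (connectionForm IG G C W).d m ![infGen IG G I m ξ, v] = 0 :=
  d_apply_infGen_eq_zero hsm (c := 0) (c' := ξ) (hS.smoothAt_connectionForm hsm hC m)
    (fun g => hS.connectionMap_of_mem (hS.map_C g m v hv)) fun m' => hS.connectionMap_infGen hξ m'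

/-- Splitting both arguments along `C ⊕ W`, the mixed terms vanish by the preceding lemma, and the
`C`-`C` term is the curvature. -/
theorem d_connectionForm_apply (m : M) (u v : TangentSpace I m) :
    (connectionForm IG G C W).d m ![u, v] = curvature IG G C W m ![u, v] +
      (connectionForm IG G C W).d m ![proj W C m u, proj W C m v] := by
  have h₁ (u v : TangentSpace I m) :
      (connectionForm IG G C W).d m ![proj W C m u, proj C W m v] = 0 := by
    obtain ⟨ξ, hξ, h⟩ := (hS.mem_iff m _).1 (proj_mem (hS.isCompl m).symm u)
    rw [← h]
    exact hS.d_connectionForm_infGen hsm hC hξ (proj_mem (hS.isCompl m) v)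
  conv_lhs => rw [← proj_add_proj (hS.isCompl m) u, ← proj_add_proj (hS.isCompl m) v]
  rw [DForm.add_left, DForm.add_right, DForm.add_right, h₁ u v, DForm.swap _ m (proj C W m u)
    (proj W C m v), h₁ v u, curvature_eq, DForm.horizontal_apply]
  simp

/-- By `d² = 0` the differential of the curvature is minus that of `dA(P_W ·, P_W ·)`. The latter is
quadratic in `P_W`, so its first derivatives still vanish on vectors of `C`. No Lie bracket on the
structure algebra is needed. -/
theorem d_curvature_apply {m : M} {u v w : TangentSpace I m} (hu : u ∈ C m) (hv : v ∈ C m)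
    (hw : w ∈ C m) : (curvature IG G C W).d m ![u, v, w] = 0 := by
  have hA := hS.isSmooth_connectionForm hsm hC
  set η : DForm I M EG 2 := (connectionForm IG G C W).d - curvature IG G C W with hη
  have h₁ : η.d m = -(curvature IG G C W).d m := by
    rw [DForm.d_sub (hA.d.smoothAt m) ((hS.isSmooth_curvature hsm hC).smoothAt m),
      DForm.d_d hA]
    simp
  have h₂ : η.inChart m =ᶠ[𝓝 (extChartAt I m m)] fun y =>
      ((connectionForm IG G C W).d.inChart m y).compContinuousLinearMap
        (verticalInChart IG G C W m y) := by
    filter_upwards [extChartAt_target_mem_nhds (I := I) m] with y hy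
    have h₃ (u v : E) : η.inChart m y ![u, v] =
        ((connectionForm IG G C W).d.inChart m y).compContinuousLinearMap
          (verticalInChart IG G C W m y) ![u, v] := by
      set z := (extChartAt I m).symm y
      have h₄ (η : DForm I M EG 2) (u v : E) : η.inChart m y ![u, v] =
          η z ![mfderiv 𝓘(ℝ, E) I (extChartAt I m).symm y u,
            mfderiv 𝓘(ℝ, E) I (extChartAt I m).symm y v] := by
        refine congrArg (η z) ?_
        ext i; fin_cases i <;> rfl
      have h₅ (μ : E [⋀^Fin 2]→L[ℝ] EG) (T : E →L[ℝ] E) (u v : E) :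
          μ.compContinuousLinearMap T ![u, v] = μ ![T u, T v] := by
        refine congrArg μ ?_
        ext i; fin_cases i <;> rfl
      rw [h₅, h₄, h₄, hS.mfderiv_symm_verticalInChart hy, hS.mfderiv_symm_verticalInChart hy]
      exact sub_eq_of_eq_add' (hS.d_connectionForm_apply hsm hC z _ _)
    refine ContinuousAlternatingMap.ext fun v => ?_
    have : v = ![v 0, v 1] := by ext i; fin_cases i <;> rfl
    rw [this, h₃]
  have h₃ : ∀ {u : TangentSpace I m}, u ∈ C m →
      verticalInChart IG G C W m (extChartAt I m m) u = 0 := fun {u} hu =>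
    (hS.verticalInChart_self m u).trans (proj_of_mem_right (hS.isCompl m).symm hu)
  have h₄ : η.d m ![u, v, w] = 0 := (DForm.d_apply η m _).trans
    (extDeriv_comp_eq_zero h₂ (hA.d.smoothAt m) (hS.contDiffAt_verticalInChart hsm hC m)
      (h₃ hu) (h₃ hv) (h₃ hw))
  rw [h₁] at h₄
  exact neg_eq_zero.1 h₄

end VerticalSplitting

end Splitting

end Nonholonomic

end

noncomputable section

set_option linter.unusedSectionVars false

namespace Nonholonomic

/-! ### The momentum pairing and the differential of the horizontal two-form -/

section Momentum

variable {EG : Type*} [NormedAddCommGroup EG] [NormedSpace ℝ EG] [FiniteDimensional ℝ EG]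
  {HG : Type*} [TopologicalSpace HG] {IG : ModelWithCorners ℝ EG HG} [IG.Boundaryless]
  {G : Type*} [TopologicalSpace G] [ChartedSpace HG G] [Group G] [IsManifold IG ∞ G]
  {E : Type*} [NormedAddCommGroup E] [NormedSpace ℝ E] [FiniteDimensional ℝ E]
  {H : Type*} [TopologicalSpace H] {I : ModelWithCorners ℝ E H} [I.Boundaryless]
  {M : Type*} [TopologicalSpace M] [ChartedSpace H M] [IsManifold I ∞ M] [MulAction G M]
  {F : Type*} [NormedAddCommGroup F] [NormedSpace ℝ F] [FiniteDimensional ℝ F]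
  {C W : Distribution I M} {S : Submodule ℝ EG}

variable (IG G) in
/-- The momentum of a family of covectors. -/
def momentumOf (θ : (m : M) → Covector I m) (m : M) : EG →L[ℝ] ℝ := θ m ∘L infGen IG G I m

theorem contDiffAt_momentumOf (hsm : ContMDiff (IG.prod I) I ∞ (fun p : G × M => p.1 • p.2))
    {θ : (m : M) → Covector I m} {m : M} (hθ : (oneForm θ).SmoothAt m) :
    ContDiffAt ℝ ∞ (fun y => momentumOf IG G θ ((extChartAt I m).symm y)) (extChartAt I m m) := by
  refine ((contDiffAt_formInChart hθ).clm_comp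
    (contDiffAt_infGen_inChart hsm m)).congr_of_eventuallyEq ?_
  filter_upwards [extChartAt_target_mem_nhds (I := I) m] with y hy
  ext ξ
  exact (formInChart_vecInChart θ (infGen IG G I) hy ξ).symm

namespace VerticalSplitting

variable (hS : VerticalSplitting IG G C W S)
  (hsm : ContMDiff (IG.prod I) I ∞ (fun p : G × M => p.1 • p.2)) (hC : C.IsLocallyKer F)
  {θ : (m : M) → Covector I m} (hθ : (oneForm θ).IsSmooth)
include hS hsm hC hθ

theorem isSmooth_pairing : (pairing (momentumOf IG G θ) (curvature IG G C W)).IsSmooth :=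
  DForm.isSmooth_iff.2 fun m => contDiffAt_compContinuousAlternatingMap
    (contDiffAt_momentumOf hsm (hθ.smoothAt m)) ((hS.isSmooth_curvature hsm hC).smoothAt m)

/-- `dJ ∧ K = d⟨J, K⟩` on `C`. -/
theorem dWedge_eq {m : M} {u v w : TangentSpace I m} (hu : u ∈ C m) (hv : v ∈ C m)
    (hw : w ∈ C m) : dWedge (momentumOf IG G θ) (curvature IG G C W) m u v w =
      (pairing (momentumOf IG G θ) (curvature IG G C W)).d m ![u, v, w] := by
  have hJ := contDiffAt_momentumOf hsm (hθ.smoothAt m)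
  have hK := (isSmooth_curvature hS hsm hC).smoothAt m
  have hJm : MDifferentiableAt I 𝓘(ℝ, EG →L[ℝ] ℝ) (momentumOf IG G θ) m :=
    (contMDiffAt_iff_inChart.2 hJ).mdifferentiableAt (by simp)
  have h₁ := extDeriv_pairing hJ hK u v w
  -- Of the Leibniz expansion of `d⟨J, K⟩` only `dJ ∧ K` survives, since `dK` vanishes on `C`.
  have h₂ := (DForm.d_apply (curvature IG G C W) m ![u, v, w]).symm.trans
    (hS.d_curvature_apply hsm hC hu hv hw)
  have h₃ : (pairing (momentumOf IG G θ) (curvature IG G C W)).d m ![u, v, w] = _ :=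
    (DForm.d_apply _ m ![u, v, w]).trans h₁
  have h₄ := DForm.inChart_self (curvature IG G C W) m
  obtain ⟨T, hT⟩ : ∃ T : E →L[ℝ] (EG →L[ℝ] ℝ),
    T = mfderiv I 𝓘(ℝ, EG →L[ℝ] ℝ) (momentumOf IG G θ) m := ⟨_, rfl⟩
  have h₅ := hT.trans (mfderiv_eq_fderiv_inChart hJm)
  have h₆ := congrArg (momentumOf IG G θ ((extChartAt I m).symm (extChartAt I m m))) h₂
  rw [map_zero] at h₆
  have h₇ (u v w : TangentSpace I m) : fderiv ℝ
      (fun y => momentumOf IG G θ ((extChartAt I m).symm y)) (extChartAt I m m) u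
        ((curvature IG G C W).inChart m (extChartAt I m m) ![v, w]) =
      T u (curvature IG G C W m ![v, w]) :=
    (congrArg (fderiv ℝ (fun y => momentumOf IG G θ ((extChartAt I m).symm y))
      (extChartAt I m m) u) (h₄ ![v, w])).trans
      (congrArg (fun T : E →L[ℝ] (EG →L[ℝ] ℝ) => T u (curvature IG G C W m ![v, w])) h₅.symm)
  rw [h₃]
  refine Eq.trans ?_ (congrArg₂ (· + ·) (congrArg₂ (· + ·) (congrArg₂ (· + ·) (h₇ u v w)
    (h₇ v w u)) (h₇ w u v)) h₆).symm
  refine Eq.trans (b := T w (curvature IG G C W m ![u, v]) + T u (curvature IG G C W m ![v, w]) +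
    T v (curvature IG G C W m ![w, u])) ?_ (by ring)
  rw [hT]
  rfl

variable (hinv : ∀ (g : G) (m : M) (u : TangentSpace I m),
  θ (g • m) (mfderiv I I (fun m : M => g • m) m u) = θ m u)
include hinv

/-- The horizontal part of an invariant one-form has a horizontal exterior derivative. -/
theorem d_horizontal_oneForm (m : M) (u v : TangentSpace I m) :
    ((oneForm θ).horizontal C W).d m ![u, v] =
      ((oneForm θ).d.horizontal C W - pairing (momentumOf IG G θ) (curvature IG G C W)) m ![u, v]
      := by
  set η : DForm I M ℝ 1 := (oneForm θ).horizontal C W with hη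
  have hηs : η.SmoothAt m := hS.smoothAt_horizontal hsm hC (hθ.smoothAt m)
  -- The form `θ ∘ P_C` is zero on generators from `S` and constant on translates of any `v`,
  -- because `θ` and the splitting are invariant.
  have h₁ {ξ : EG} (hξ : ξ ∈ S) (v : TangentSpace I m) : η.d m ![infGen IG G I m ξ, v] = 0 := by
    refine d_apply_infGen_eq_zero hsm (c := θ m (proj C W m v)) (c' := 0) hηs (fun g => ?_)
      fun m' => ?_
    · exact (congrArg (θ (g • m)) (hS.proj_smul g m v)).trans (hinv g m _)
    · exact (congrArg (θ m') (proj_of_mem_right (hS.isCompl m') (hS.infGen_mem hξ m'))).trans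
        (map_zero _)
  have h₂ (u v : TangentSpace I m) : η.d m ![proj W C m u, v] = 0 := by
    obtain ⟨ξ, hξ, h⟩ := (hS.mem_iff m _).1 (proj_mem (hS.isCompl m).symm u)
    rw [← h]
    exact h₁ hξ v
  have h₃ : η.d m ![u, v] = η.d m ![proj C W m u, proj C W m v] := by
    conv_lhs => rw [← proj_add_proj (hS.isCompl m) u, ← proj_add_proj (hS.isCompl m) v]
    rw [DForm.add_left, DForm.add_right, h₂, DForm.swap _ m (proj C W m u) (proj W C m v), h₂]
    simp
  rw [h₃]
  set a := proj C W m u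
  set b := proj C W m v
  have ha : a ∈ C m := proj_mem (hS.isCompl m) u
  have hb : b ∈ C m := proj_mem (hS.isCompl m) v
  have hA := hS.smoothAt_connectionForm hsm hC m
  have hA0 {c : TangentSpace I m} (hc : c ∈ C m) :
      formInChart (connectionMap IG G C W) m (extChartAt I m m) c = 0 :=
    (DFunLike.congr_fun (formInChart_self (connectionMap IG G C W) m) c).trans
      (hS.connectionMap_of_mem hc)
  -- Near `m` the horizontal part is `θ - ⟨J, A⟩`, and both arguments now lie in the kernel of `A`.
  have h₄ := extDeriv_sub_comp (contDiffAt_formInChart (hθ.smoothAt m))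
    (contDiffAt_momentumOf hsm (hθ.smoothAt m)) (contDiffAt_formInChart hA)
    (ζ := η.inChart m) (α := (oneForm θ).inChart m) (β := (connectionForm IG G C W).inChart m)
    (by
      filter_upwards [hS.inChart_horizontal (oneForm θ) m,
        extChartAt_target_mem_nhds (I := I) m] with y hy hyt v
      rw [hη, hy]
      refine (map_sub (formInChart θ m y) v _).trans ?_
      exact congrArg (formInChart θ m y v - ·) (formInChart_vecInChart θ (infGen IG G I) hyt _))
    (hηs.differentiableAt (by simp)) (Filter.Eventually.of_forall fun y v => rfl)
    ((hθ.smoothAt m).differentiableAt (by simp)) (Filter.Eventually.of_forall fun y v => rfl)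
    (hA.differentiableAt (by simp)) (hA0 ha) (hA0 hb)
  refine (DForm.d_apply η m ![a, b]).trans (h₄.trans ?_)
  have key : ∀ z, z = m → momentumOf IG G θ z = momentumOf IG G θ m := by rintro z rfl; rfl
  refine congrArg₂ (· - ·) ?_ ?_
  · exact (DForm.d_apply (oneForm θ) m ![a, b]).symm.trans
      (DForm.horizontal_apply (oneForm θ).d m u v).symm
  · refine (congrArg₂ (fun (p : EG →L[ℝ] ℝ) (q : EG) => p q) (key _ (extChartAt_to_inv m))
      (DForm.d_apply (connectionForm IG G C W) m ![a, b]).symm).trans ?_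
    exact congrArg (momentumOf IG G θ m)
      (DForm.horizontal_apply (connectionForm IG G C W).d m u v).symm

/-- The exterior derivative of the horizontal part of `-dθ`. -/
theorem d_horizontal_d (m : M) : ((-(oneForm θ).d).horizontal C W).d m =
    -(pairing (momentumOf IG G θ) (curvature IG G C W)).d m := by
  set η : DForm I M ℝ 1 := (oneForm θ).horizontal C W with hη
  set κ := pairing (momentumOf IG G θ) (curvature IG G C W) with hκ
  have hηs : η.IsSmooth := DForm.isSmooth_iff.2 fun m =>
    hS.smoothAt_horizontal hsm hC (hθ.smoothAt m)
  have hκs : κ.IsSmooth := hS.isSmooth_pairing hsm hC hθ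
  -- The horizontal part of `-dθ` is exact up to `-⟨J, K⟩`, so only the latter has a differential.
  have h₁ : (-(oneForm θ).d).horizontal C W = -(η.d + κ) := by
    funext m
    refine DForm.ext₂ fun u v => ?_
    have h₂ := hS.d_horizontal_oneForm hsm hC hθ hinv m u v
    have h₃ : (-(oneForm θ).d).horizontal C W m ![u, v] =
      -((oneForm θ).d.horizontal C W m ![u, v]) := rfl
    have h₄ : (-(η.d + κ)) m ![u, v] = -(η.d m ![u, v] + κ m ![u, v]) := rfl
    have h₅ : ((oneForm θ).d.horizontal C W - κ) m ![u, v] =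
      (oneForm θ).d.horizontal C W m ![u, v] - κ m ![u, v] := rfl
    rw [h₃, h₄, h₂, h₅]
    ring
  have h₂ : (η.d + κ).d m = κ.d m := by
    rw [DForm.d_add (hηs.d.smoothAt m) (hκs.smoothAt m), DForm.d_d hηs]
    simp
  rw [h₁, DForm.d_neg, Pi.neg_apply, h₂]

end VerticalSplitting

end Momentum

end Nonholonomic

end

noncomputable section

set_option linter.unusedSectionVars false

namespace Nonholonomic

/-! ### Gauge transformations of nonholonomic bivectors -/

section NormedSpaceBivectors

variable {E : Type*} [NormedAddCommGroup E] [NormedSpace ℝ E] [FiniteDimensional ℝ E]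

variable (E) in
theorem contDiff_bilin (F : Type*) [NormedAddCommGroup F] [NormedSpace ℝ F] :
    ContDiff ℝ ∞ (bilin E F) := by
  refine contDiff_clm_apply_iff.2 fun u => contDiff_clm_apply_iff.2 fun v => ?_
  simp only [bilin_apply]
  exact (ContinuousAlternatingMap.apply ℝ E F ![u, v]).contDiff

variable (E) in
theorem exists_definite_bilinear : ∃ b : E →L[ℝ] E →L[ℝ] ℝ, ∀ u, b u u = 0 → u = 0 := by
  have e : E ≃L[ℝ] EuclideanSpace ℝ (Fin (Module.finrank ℝ E)) := toEuclidean
  let p : EuclideanSpace ℝ (Fin (Module.finrank ℝ E)) →L[ℝ]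
    EuclideanSpace ℝ (Fin (Module.finrank ℝ E)) →L[ℝ] ℝ := innerSL ℝ
  refine ⟨ContinuousLinearMap.precomp ℝ (e : E →L[ℝ] _) ∘L p ∘L (e : E →L[ℝ] _), fun u hu => ?_⟩
  exact (map_eq_zero_iff _ e.injective).1 (inner_self_eq_zero (𝕜 := ℝ).1 hu)

theorem fderiv_clm_apply_const {V : Type*} [NormedAddCommGroup V] [NormedSpace ℝ V]
    {A : E → E →L[ℝ] V} {x : E} (hA : DifferentiableAt ℝ A x) (u v : E) :
    fderiv ℝ (fun y => A y v) x u = fderiv ℝ A x u v := by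
  rw [(hA.hasFDerivAt.clm_apply (hasFDerivAt_const v x)).fderiv]
  simp

/-- A bivector is smooth if it inverts a smooth two-form on the kernel of a smooth family of
projections `V`. -/
theorem contDiffAt_of_inverts {π : E → (E →L[ℝ] ℝ) →L[ℝ] E} {ζ : E → E [⋀^Fin 2]→L[ℝ] ℝ}
    {V : E → E →L[ℝ] E} {x : E} (hζ : ContDiffAt ℝ ∞ ζ x) (hVs : ContDiffAt ℝ ∞ V x)
    (hinv : ∀ᶠ y in 𝓝 x, ∀ (α : E →L[ℝ] ℝ) (v : E), ζ y ![π y α, v] = -α (v - V y v))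
    (hVπ : ∀ᶠ y in 𝓝 x, ∀ α : E →L[ℝ] ℝ, V y (π y α) = 0) (hVV : ∀ v, V x (V x v) = V x v)
    (hζV : ∀ u v, ζ x ![V x u, v] = 0)
    (h : ∀ u, V x u = 0 → (∀ v, V x v = 0 → ζ x ![u, v] = 0) → u = 0) :
    ContDiffAt ℝ ∞ π x := by
  -- Adding the definite form `b` on the range of `V` to `ζ`, which is nondegenerate only on the
  -- kernel of `V`, gives an injective map `T` at `x`. Since `T (π α) = -α ∘ (1 - V)`, composing
  -- with a smooth left inverse of `T` exhibits `π` as smooth.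
  obtain ⟨b, hb0⟩ := exists_definite_bilinear E
  set T : E → E →L[ℝ] (E →L[ℝ] ℝ) := fun y => bilin E ℝ (ζ y) +
    (ContinuousLinearMap.precomp ℝ (V y) : (E →L[ℝ] ℝ) →L[ℝ] (E →L[ℝ] ℝ)) ∘L b ∘L V y with hT
  have hTs : ContDiffAt ℝ ∞ T x := by
    have h₁ : ContDiffAt ℝ ∞ (fun y => bilin E ℝ (ζ y)) x :=
      (contDiff_bilin E ℝ).contDiffAt.comp x hζ
    have h₂ : ContDiffAt ℝ ∞ (fun y => b ∘L V y) x := contDiffAt_const.clm_comp hVs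
    have h₃ : ContDiffAt ℝ ∞ (fun y => (ContinuousLinearMap.precomp ℝ (V y) :
      (E →L[ℝ] ℝ) →L[ℝ] (E →L[ℝ] ℝ)) ∘L (b ∘L V y)) x := (contDiffAt_precomp hVs).clm_comp h₂
    exact h₁.add h₃
  have hTa (y : E) (u v : E) : T y u v = ζ y ![u, v] + b (V y u) (V y v) := by
    rw [← bilin_apply]; rfl
  have hinj : Function.Injective (T x) := by
    refine (injective_iff_map_eq_zero _).2 fun u hu => ?_
    have h₁ (v : E) : ζ x ![u, v] + b (V x u) (V x v) = 0 :=
      (hTa x u v).symm.trans (DFunLike.congr_fun hu v)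
    have h₂ : u - V x u = 0 := by
      refine h _ (by rw [map_sub, hVV, sub_self]) fun v hv => ?_
      have h₃ := h₁ v
      rw [hv, map_zero, add_zero] at h₃
      have h₄ := two_form_add_left (ζ x) (u - V x u) (V x u) v
      rwa [sub_add_cancel, h₃, hζV, add_zero, eq_comm] at h₄
    have h₃ : V x u = u := (sub_eq_zero.1 h₂).symm
    have h₄ := h₁ u
    have h₅ := hζV u u
    rw [h₃] at h₄ h₅
    rw [h₅, zero_add] at h₄
    exact hb0 u h₄
  obtain ⟨L, hL, hLT⟩ := exists_contDiffAt_leftInverse hTs hinj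
  have h₁ : ContDiffAt ℝ ∞ (fun y => -(L y ∘L (ContinuousLinearMap.precomp ℝ
      (ContinuousLinearMap.id ℝ E - V y) : (E →L[ℝ] ℝ) →L[ℝ] (E →L[ℝ] ℝ)))) x :=
    (hL.clm_comp (contDiffAt_precomp (contDiffAt_const.sub hVs))).neg
  refine ContDiffAt.congr_of_eventuallyEq h₁ ?_
  filter_upwards [hinv, hVπ, hLT] with y hy hVy hLy
  ext α
  refine (hLy (π y α)).symm.trans ?_
  have h₂ : T y (π y α) = -(α ∘L (ContinuousLinearMap.id ℝ E - V y)) := by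
    ext v
    rw [hTa, hy, hVy, map_zero]
    simp
  rw [h₂, map_neg]
  rfl

end NormedSpaceBivectors

/-! ### Pointwise linear algebra of the gauge transformation -/

section Gauge

variable {E : Type*} [NormedAddCommGroup E] [NormedSpace ℝ E] [FiniteDimensional ℝ E]
  {H : Type*} [TopologicalSpace H] {I : ModelWithCorners ℝ E H} [I.Boundaryless]
  {M : Type*} [TopologicalSpace M] [ChartedSpace H M] [IsManifold I ∞ M]
  {C W : Distribution I M} {Ω B : DForm I M ℝ 2}

theorem restrictFlat_isInvertible {m : M}
    (h : ∀ u ∈ C m, (∀ v ∈ C m, Ω m ![u, v] = 0) → u = 0) : (restrictFlat C Ω m).IsInvertible := by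
  have hinj : Function.Injective (restrictFlat C Ω m) := by
    refine (injective_iff_map_eq_zero _).2 fun u hu => Subtype.ext (h u u.2 fun v hv => ?_)
    exact DFunLike.congr_fun hu ⟨v, hv⟩
  have : FiniteDimensional ℝ (C m) := FiniteDimensional.finiteDimensional_submodule _
  let e : (C m →ₗ[ℝ] ℝ) ≃ₗ[ℝ] (C m →L[ℝ] ℝ) := LinearMap.toContinuousLinearMap
  have : FiniteDimensional ℝ (C m →L[ℝ] ℝ) := e.finiteDimensional
  have hdim : Module.finrank ℝ (C m) = Module.finrank ℝ (C m →L[ℝ] ℝ) := by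
    rw [← e.finrank_eq]
    exact (Subspace.dual_finrank_eq (K := ℝ) (V := C m)).symm
  exact ⟨(LinearMap.linearEquivOfInjective (restrictFlat C Ω m).toLinearMap hinj
    hdim).toContinuousLinearEquiv, by ext; rfl⟩

theorem bivectorOf_mem (m : M) (α : Covector I m) : bivectorOf C Ω m α ∈ C m :=
  (C m).neg_mem (Subtype.property _)

theorem bivectorOf_apply {m : M} (h : ∀ u ∈ C m, (∀ v ∈ C m, Ω m ![u, v] = 0) → u = 0)
    (α : Covector I m) {v : TangentSpace I m} (hv : v ∈ C m) :
    Ω m ![bivectorOf C Ω m α, v] = -α v := by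
  have h₁ : restrictFlat C Ω m ((restrictFlat C Ω m).inverse (α ∘L (C m).subtypeL)) =
      α ∘L (C m).subtypeL := (restrictFlat_isInvertible h).self_apply_inverse _
  refine Eq.trans (b := (Ω.flat m (-((restrictFlat C Ω m).inverse (α ∘L (C m).subtypeL) :
    TangentSpace I m))) v) rfl ?_
  rw [map_neg]
  exact congrArg Neg.neg (DFunLike.congr_fun h₁ ⟨v, hv⟩)

theorem gauge_mem (m : M) (α : Covector I m) : gauge (bivectorOf C Ω) B m α ∈ C m :=
  bivectorOf_mem m _

/-- If `β + B^♭ π^♯ β = α`, then `π_B^♯ α = π^♯ β` and `Ω(π^♯ β, v) = -β v` on `C`; eliminating `β`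
shows that the gauge transformation replaces `Ω` by `Ω - B`. -/
theorem gauge_apply {m : M} (h : ∀ u ∈ C m, (∀ v ∈ C m, Ω m ![u, v] = 0) → u = 0)
    (hB : (gaugeEndo (bivectorOf C Ω) B m).IsInvertible)
    (α : Covector I m) {v : TangentSpace I m} (hv : v ∈ C m) :
    Ω m ![gauge (bivectorOf C Ω) B m α, v] - B m ![gauge (bivectorOf C Ω) B m α, v] = -α v := by
  set β := (gaugeEndo (bivectorOf C Ω) B m).inverse α with hβ
  have h₁ : gaugeEndo (bivectorOf C Ω) B m β = α := hB.self_apply_inverse _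
  have h₂ : β v + B m ![bivectorOf C Ω m β, v] = α v := DFunLike.congr_fun h₁ v
  have h₃ := bivectorOf_apply h β hv
  change Ω m ![bivectorOf C Ω m β, v] - B m ![bivectorOf C Ω m β, v] = -α v
  rw [h₃, ← h₂]
  ring

/-- Put `β = -i_u Ω`, so that `π^♯ β = u`. The endomorphism `Id + B^♭ π^♯` sends `β` to some `δ`
that vanishes on `C`; then `π^♯ δ = 0` and `δ` is a fixed point. Injectivity forces `β = δ`, whence
`u = π^♯ δ = 0`. -/
theorem gauge_nondegenerate {m : M} (h : ∀ u ∈ C m, (∀ v ∈ C m, Ω m ![u, v] = 0) → u = 0)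
    (hB : (gaugeEndo (bivectorOf C Ω) B m).IsInvertible) {u : TangentSpace I m} (hu : u ∈ C m)
    (huv : ∀ v ∈ C m, Ω m ![u, v] - B m ![u, v] = 0) : u = 0 := by
  have hu' (β : Covector I m) (hβ : ∀ v ∈ C m, Ω m ![u, v] = -β v) : bivectorOf C Ω m β = u := by
    refine sub_eq_zero.1 (h _ ((C m).sub_mem (bivectorOf_mem m β) hu) fun v hv => ?_)
    have h₁ := DFunLike.congr_fun (map_sub (Ω.flat m) (bivectorOf C Ω m β) u) v
    refine h₁.trans ?_
    change Ω m ![bivectorOf C Ω m β, v] - Ω m ![u, v] = 0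
    rw [bivectorOf_apply h β hv, hβ v hv, sub_self]
  have hz (β : Covector I m) (hβ : ∀ v ∈ C m, β v = 0) : bivectorOf C Ω m β = 0 := by
    refine h _ (bivectorOf_mem m β) fun v hv => ?_
    rw [bivectorOf_apply h β hv, hβ v hv, neg_zero]
  set β : Covector I m := -Ω.flat m u with hβ
  have h₁ : bivectorOf C Ω m β = u := hu' β fun v _ => (neg_neg _).symm
  set δ := gaugeEndo (bivectorOf C Ω) B m β with hδ
  have h₂ : bivectorOf C Ω m δ = 0 := hz δ fun v hv => by
    have h₃ : δ v = β v + B m ![bivectorOf C Ω m β, v] := rfl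
    have h₄ : β v = -Ω m ![u, v] := rfl
    rw [h₃, h₁, h₄]
    linarith [huv v hv]
  have h₃ : gaugeEndo (bivectorOf C Ω) B m δ = δ := by
    refine (congrArg (fun w => δ + B.flat m w) h₂).trans ?_
    rw [map_zero, add_zero]
  have h₄ : δ = β := by
    rw [← hB.inverse_apply_self δ, h₃, hδ, hB.inverse_apply_self]
  rw [← h₁, ← h₄, h₂]

end Gauge

/-! ### Smoothness and Jacobiator of bivectors inverting a two-form on `C` -/

section Smooth

variable {EG : Type*} [NormedAddCommGroup EG] [NormedSpace ℝ EG] [FiniteDimensional ℝ EG]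
  {HG : Type*} [TopologicalSpace HG] {IG : ModelWithCorners ℝ EG HG} [IG.Boundaryless]
  {G : Type*} [TopologicalSpace G] [ChartedSpace HG G] [Group G] [IsManifold IG ∞ G]
  {E : Type*} [NormedAddCommGroup E] [NormedSpace ℝ E] [FiniteDimensional ℝ E]
  {H : Type*} [TopologicalSpace H] {I : ModelWithCorners ℝ E H} [I.Boundaryless]
  {M : Type*} [TopologicalSpace M] [ChartedSpace H M] [IsManifold I ∞ M] [MulAction G M]
  {F : Type*} [NormedAddCommGroup F] [NormedSpace ℝ F] [FiniteDimensional ℝ F]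
  {C W : Distribution I M} {S : Submodule ℝ EG}

/-- The map `π^♯` takes values in `C` and inverts the two-form `ζ` there. -/
structure SharpMap.Inverts (C W : Distribution I M) (π : SharpMap I M) (ζ : DForm I M ℝ 2) :
    Prop where
  mem : ∀ (m : M) (α : Covector I m), π m α ∈ C m
  apply : ∀ (m : M) (α : Covector I m) (v : TangentSpace I m), ζ m ![π m α, v] = -α (proj C W m v)
  apply_mem : ∀ (m : M), ∀ w ∈ W m, ∀ v : TangentSpace I m, ζ m ![w, v] = 0
  eq_zero : ∀ (m : M), ∀ u ∈ C m, (∀ v ∈ C m, ζ m ![u, v] = 0) → u = 0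

/-- Precomposing `Ω` with `P_C` extends its restriction to `C` by zero along `W`, while `B` already
annihilates `W`; the difference is a global two-form representing `(Ω - B)|_C`, whose differential
can be taken. -/
theorem inverts_gauge {Ω B : DForm I M ℝ 2} (hCW : ∀ m, IsCompl (C m) (W m))
    (h : ∀ m, ∀ u ∈ C m, (∀ v ∈ C m, Ω m ![u, v] = 0) → u = 0)
    (hBW : ∀ (m : M), ∀ w ∈ W m, ∀ v : TangentSpace I m, B m ![w, v] = 0)
    (hB : ∀ m, (gaugeEndo (bivectorOf C Ω) B m).IsInvertible) :
    (gauge (bivectorOf C Ω) B).Inverts C W (Ω.horizontal C W - B) := by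
  have hBv (m : M) (u v : TangentSpace I m) : B m ![u, v] = B m ![u, proj C W m v] := by
    conv_lhs => rw [← proj_add_proj (hCW m) v]
    rw [DForm.add_right, DForm.swap B m u (proj W C m v),
      hBW m _ (proj_mem (hCW m).symm v), neg_zero, add_zero]
  have hsub (m : M) (u v : TangentSpace I m) : (Ω.horizontal C W - B) m ![u, v] =
      Ω m ![proj C W m u, proj C W m v] - B m ![u, v] := by
    rw [← DForm.horizontal_apply]; rfl
  refine ⟨fun m α => gauge_mem m α, fun m α v => ?_, fun m w hw v => ?_, fun m u hu huv => ?_⟩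
  · rw [hsub, proj_of_mem (hCW m) (gauge_mem m α), hBv,
      gauge_apply (h m) (hB m) α (proj_mem (hCW m) v)]
  · rw [hsub, proj_of_mem_right (hCW m) hw, hBW m w hw, sub_zero]
    exact two_form_zero_left (E := E) (Ω m) _
  · refine gauge_nondegenerate (h m) (hB m) hu fun v hv => ?_
    have := huv v hv
    rwa [hsub, proj_of_mem (hCW m) hu, proj_of_mem (hCW m) hv] at this

namespace SharpMap.Inverts

variable {π : SharpMap I M} {ζ : DForm I M ℝ 2} (hπ : π.Inverts C W ζ)
include hπ

theorem skew (hCW : ∀ m, IsCompl (C m) (W m)) (m : M) (α β : Covector I m) :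
    β (π m α) = -α (π m β) := by
  have h₁ := hπ.apply m β (π m α)
  have h₂ := hπ.apply m α (π m β)
  rw [proj_of_mem (hCW m) (hπ.mem m _)] at h₁ h₂
  rw [DForm.swap, h₁] at h₂
  linarith

variable (hS : VerticalSplitting IG G C W S)
include hS

theorem inChart_apply {x : M} {y : E} (hy : y ∈ (extChartAt I x).target) (α : E →L[ℝ] ℝ) (v : E) :
    ζ.inChart x y ![π.inChart x y α, v] = -α (v - verticalInChart IG G C W x y v) := by
  set z := (extChartAt I x).symm y with hz
  set T : TangentSpace I z →L[ℝ] E := mfderiv I 𝓘(ℝ, E) (extChartAt I x) z with hT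
  set R : E →L[ℝ] TangentSpace I z := mfderiv 𝓘(ℝ, E) I (extChartAt I x).symm y with hR
  have h₁ : ζ.inChart x y ![π.inChart x y α, v] = ζ z ![π z (α ∘L T), R v] := by
    refine congrArg (ζ z) ?_
    ext i
    fin_cases i
    · exact DFunLike.congr_fun (mfderiv_symm_comp_mfderiv (I := I) hy) (π z (α ∘L T))
    · rfl
  rw [h₁, hπ.apply]
  have h₂ : T (R (v - verticalInChart IG G C W x y v)) = v - verticalInChart IG G C W x y v :=
    DFunLike.congr_fun (mfderiv_comp_mfderiv_symm (I := I) hy) _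
  refine congrArg (fun w => -α w) (Eq.trans ?_ h₂)
  exact congrArg T (hS.mfderiv_symm_id_sub hy v).symm

theorem connectionMap_inChart {x : M} {y : E} (hy : y ∈ (extChartAt I x).target)
    (α : E →L[ℝ] ℝ) : formInChart (connectionMap IG G C W) x y (π.inChart x y α) = 0 :=
  (formInChart_mfderiv (connectionMap IG G C W) hy _).trans
    (hS.connectionMap_of_mem (hπ.mem _ _))

theorem vertical_inChart {x : M} {y : E} (hy : y ∈ (extChartAt I x).target)
    (α : E →L[ℝ] ℝ) : verticalInChart IG G C W x y (π.inChart x y α) = 0 :=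
  (congrArg (vecInChart (infGen IG G I) x y) (hπ.connectionMap_inChart hS hy α)).trans (map_zero _)

variable (hsm : ContMDiff (IG.prod I) I ∞ (fun p : G × M => p.1 • p.2)) (hC : C.IsLocallyKer F)
  (hζ : ζ.IsSmooth)
include hsm hC hζ

theorem smoothAt (x : M) : π.SmoothAt x := by
  have hV0 (v : TangentSpace I x) : verticalInChart IG G C W x (extChartAt I x x) v =
      proj W C x v := hS.verticalInChart_self x v
  have hζ0 (u v : TangentSpace I x) : ζ.inChart x (extChartAt I x x) ![u, v] = ζ x ![u, v] :=
    DForm.inChart_self ζ x ![u, v]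
  have hW (u : TangentSpace I x) : proj W C x u ∈ W x := proj_mem (hS.isCompl x).symm u
  refine contDiffAt_of_inverts (hζ.smoothAt x) (hS.contDiffAt_verticalInChart hsm hC x) ?_ ?_
    (fun v => ?_) (fun u v => ?_) fun u hu huv => ?_
  · filter_upwards [extChartAt_target_mem_nhds (I := I) x] with y hy
    exact hπ.inChart_apply hS hy
  · filter_upwards [extChartAt_target_mem_nhds (I := I) x] with y hy
    exact hπ.vertical_inChart hS hy
  · refine (congrArg (verticalInChart IG G C W x (extChartAt I x x)) (hV0 v)).trans ?_
    exact (hV0 _).trans ((proj_of_mem (hS.isCompl x).symm (hW v)).trans (hV0 v).symm)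
  · refine (congrArg (fun w : E => ζ.inChart x (extChartAt I x x) ![w, v]) (hV0 u)).trans ?_
    exact (hζ0 _ v).trans (hπ.apply_mem x _ (hW u) v)
  · have hC' (u : TangentSpace I x) : u ∈ C x ↔ proj W C x u = 0 := by
      rw [proj_eq (hS.isCompl x).symm]
      exact (Submodule.projection_apply_eq_zero_iff _).symm
    refine hπ.eq_zero x u ((hC' u).2 ((hV0 u).symm.trans hu)) fun v hv => ?_
    exact (hζ0 u v).symm.trans (huv v ((hV0 v).trans ((hC' v).1 hv)))

/-- The cyclic derivative of a bivector that inverts a two-form on `C`. -/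
theorem half_schouten (σ : BivectorField I M) (hσ : σ.sharp = π) (m : M) (α β γ : Covector I m) :
    (1 / 2 : ℝ) * schouten σ σ m α β γ =
      -ζ.d m ![π m α, π m β, π m γ] - psi IG G C W π m α β γ := by
  subst hσ
  have hA := hS.smoothAt_connectionForm hsm hC m
  have hA' := (contDiffAt_formInChart hA).differentiableAt (n := ∞) (by simp)
  -- `A` is the connection form, whose kernel contains the values of the bivector near `m`. The
  -- generator map can be frozen at `m`, because the projection identity involving `G` is needed
  -- only at the centre of the chart.
  have h := cyclic_fderiv_bivector (V := EG) (π := σ.sharp.inChart m) (ζ := ζ.inChart m)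
    (A := formInChart (connectionMap IG G C W) m) (G := infGen IG G I m) (x := extChartAt I m m)
    ((σ.smoothAt m).differentiableAt (by simp)) ((hζ.smoothAt m).differentiableAt (by simp)) hA'
    (Filter.Eventually.of_forall fun y β γ => σ.skew_inChart m y β γ)
    (by
      filter_upwards [extChartAt_target_mem_nhds (I := I) m] with y hy β γ
      rw [hπ.inChart_apply hS hy, hπ.vertical_inChart hS hy, sub_zero, σ.skew_inChart, neg_neg])
    (fun β v => by
      rw [hπ.inChart_apply hS (mem_extChartAt_target m)]
      refine congrArg (fun w => -β (v - w)) ?_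
      exact DFunLike.congr_fun (vecInChart_self (infGen IG G I) m) _)
    (by
      filter_upwards [extChartAt_target_mem_nhds (I := I) m] with y hy β
      exact hπ.connectionMap_inChart hS hy β) α β γ
  -- The antisymmetrized derivative of the connection form is its exterior derivative, which on `C`
  -- is the curvature; this turns the remainder into `psi`.
  have hdA {u v : TangentSpace I m} (hu : u ∈ C m) (hv : v ∈ C m) :
      fderiv ℝ (formInChart (connectionMap IG G C W) m) (extChartAt I m m) u v -
        fderiv ℝ (formInChart (connectionMap IG G C W) m) (extChartAt I m m) v u =
      curvature IG G C W m ![u, v] := by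
    have h₂ (u v : E) : fderiv ℝ (fun y => (connectionForm IG G C W).inChart m y ![v])
        (extChartAt I m m) u =
        fderiv ℝ (formInChart (connectionMap IG G C W) m) (extChartAt I m m) u v :=
      fderiv_clm_apply_const hA' u v
    have h₁ := (extDeriv_one_apply (hA.differentiableAt (n := ∞) (by simp)) (u : E) (v : E)).trans
      (congrArg₂ (· - ·) (h₂ u v) (h₂ v u))
    refine h₁.symm.trans ((DForm.d_apply (connectionForm IG G C W) m ![u, v]).symm.trans ?_)
    rw [curvature_eq, DForm.horizontal_apply, proj_of_mem (hS.isCompl m) hu,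
      proj_of_mem (hS.isCompl m) hv]
  have hs (α : Covector I m) : σ.sharp.inChart m (extChartAt I m m) α = σ.sharp m α :=
    SharpMap.inChart_self σ.sharp m α
  rw [half_schouten_self]
  refine h.trans ?_
  refine congrArg₂ (· - ·) (congrArg Neg.neg ?_) (congrArg₂ (· + ·) (congrArg₂ (· + ·) ?_ ?_) ?_)
  · rw [DForm.d_apply]
    exact congrArg (extDeriv (ζ.inChart m) (extChartAt I m m))
      (congrArg₂ Matrix.vecCons (hs α) (congrArg₂ Matrix.vecCons (hs β)
        (congrArg₂ Matrix.vecCons (hs γ) rfl)))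
  · refine congrArg (fun w => γ (infGen IG G I m w)) ?_
    rw [hs α, hs β]
    exact hdA (hπ.mem m α) (hπ.mem m β)
  · refine congrArg (fun w => α (infGen IG G I m w)) ?_
    rw [hs β, hs γ]
    exact hdA (hπ.mem m β) (hπ.mem m γ)
  · refine congrArg (fun w => β (infGen IG G I m w)) ?_
    rw [hs γ, hs α]
    exact hdA (hπ.mem m γ) (hπ.mem m α)

end SharpMap.Inverts

end Smooth

end Nonholonomic

end

noncomputable section

set_option linter.unusedSectionVars false

namespace Nonholonomic

/-! ### The orbit projection -/

section Dimension

variable {E : Type*} [NormedAddCommGroup E] [NormedSpace ℝ E] [FiniteDimensional ℝ E]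
  {H : Type*} [TopologicalSpace H] {I : ModelWithCorners ℝ E H} [I.Boundaryless]
  {M : Type*} [TopologicalSpace M] [ChartedSpace H M] [IsManifold I ∞ M]
  {F : Type*} [NormedAddCommGroup F] [NormedSpace ℝ F]

/-- A smooth image of a subset of a second countable manifold has at most its dimension. -/
theorem dimH_image_le_finrank [SecondCountableTopology M] {f : M → F} {s : Set M}
    (hf : ∀ x ∈ s, ContMDiffAt I 𝓘(ℝ, F) 1 f x) : dimH (f '' s) ≤ Module.finrank ℝ E := by
  have h (x : M) (hx : x ∈ s) : ∃ U ∈ 𝓝 x, dimH (f '' U) ≤ Module.finrank ℝ E := by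
    have h₁ : ContDiffAt ℝ 1 (fun y => f ((extChartAt I x).symm y)) (extChartAt I x x) := by
      refine ContMDiffAt.contDiffAt (ContMDiffAt.comp (g := f) (extChartAt I x x) ?_
        ((contMDiffAt_extChartAt_symm (mem_extChartAt_target x)).of_le (by simp)))
      rw [extChartAt_to_inv]
      exact hf x hx
    obtain ⟨u, hu, hxu, hfu⟩ := ContDiffWithinAt.contDiffOn' (m := 1) le_rfl (by simp) h₁
    obtain ⟨r, hr, hru⟩ := Metric.isOpen_iff.1 hu _ hxu
    -- A continuously differentiable map on a convex set does not raise Hausdorff dimension.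
    have h₂ := ContDiffOn.dimH_image_le (s := Metric.ball (extChartAt I x x) r)
      (hfu.mono (by simpa using hru)) (convex_ball _ _) subset_rfl
    refine ⟨(extChartAt I x).source ∩ extChartAt I x ⁻¹' Metric.ball (extChartAt I x x) r,
      Filter.inter_mem (extChartAt_source_mem_nhds x)
        ((continuousAt_extChartAt x).preimage_mem_nhds (Metric.ball_mem_nhds _ hr)), ?_⟩
    refine (dimH_mono ?_).trans (h₂.trans ((dimH_mono (Set.subset_univ _)).trans_eq
      (Real.dimH_univ_eq_finrank E)))
    rintro _ ⟨y, ⟨hy, hyr⟩, rfl⟩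
    exact ⟨extChartAt I x y, hyr, congrArg f ((extChartAt I x).left_inv hy)⟩
  choose! U hU hdim using h
  -- Second countability leaves countably many pieces, and the Hausdorff dimension of a countable
  -- union is the supremum.
  obtain ⟨t, hts, htc, hst⟩ := TopologicalSpace.countable_cover_nhdsWithin
    (fun x hx => mem_nhdsWithin_of_mem_nhds (hU x hx))
  refine (dimH_mono (Set.image_mono hst)).trans ?_
  rw [Set.image_iUnion₂, dimH_bUnion htc]
  exact iSup₂_le fun x hx => hdim x (hts hx)

end Dimension

section ProperAction

/-- A group acting properly and freely on a nonempty second countable Hausdorff space is second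
countable. -/
theorem secondCountable_of_properSMul {G Q : Type*} [TopologicalSpace G] [TopologicalSpace Q]
    [Group G] [MulAction G Q] [ProperSMul G Q] [T2Space Q] [SecondCountableTopology Q]
    (hfree : ∀ (g : G) (q : Q), g • q = q → g = 1) (q : Q) : SecondCountableTopology G := by
  have h₁ : IsProperMap (fun gx : G × Q => (gx.1 • gx.2, gx.2)) :=
    ProperSMul.isProperMap_smul_pair
  have hinj : Function.Injective fun g : G => (g, q) := fun g g' h => congrArg Prod.fst h
  have h₂ : Topology.IsClosedEmbedding fun g : G => (g, q) := by
    refine Topology.IsClosedEmbedding.of_continuous_injective_isClosedMap (by fun_prop) hinj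
      fun s hs => ?_
    have : (fun g : G => (g, q)) '' s = Prod.fst ⁻¹' s ∩ Prod.snd ⁻¹' {q} := by
      ext ⟨g, x⟩
      simp only [Set.mem_image, Prod.mk.injEq, Set.mem_inter_iff, Set.mem_preimage,
        Set.mem_singleton_iff]
      exact ⟨by rintro ⟨a, ha, rfl, rfl⟩; exact ⟨ha, rfl⟩, fun ⟨ha, hx⟩ => ⟨g, ha, rfl, hx.symm⟩⟩
    rw [this]
    exact (hs.preimage continuous_fst).inter (isClosed_singleton.preimage continuous_snd)
  -- By properness and freeness this orbit map is a closed embedding of `G` into `Q × Q`, from which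
  -- second countability is inherited.
  have h₃ : IsProperMap fun g : G => (g • q, q) := h₁.comp h₂.isProperMap
  have hinj' : Function.Injective fun g : G => (g • q, q) := fun g g' h => by
    have h' : g • q = g' • q := congrArg Prod.fst h
    have := hfree (g'⁻¹ * g) q (by rw [mul_smul, h', inv_smul_smul])
    rwa [inv_mul_eq_one, eq_comm] at this
  exact (Topology.IsClosedEmbedding.of_continuous_injective_isClosedMap h₃.continuous hinj'
    h₃.isClosedMap).isEmbedding.secondCountableTopology

end ProperAction

section OrbitProjection

variable {EG : Type*} [NormedAddCommGroup EG] [NormedSpace ℝ EG] [FiniteDimensional ℝ EG]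
  {HG : Type*} [TopologicalSpace HG] {IG : ModelWithCorners ℝ EG HG} [IG.Boundaryless]
  {G : Type*} [TopologicalSpace G] [ChartedSpace HG G] [Group G] [IsManifold IG ∞ G]
  {E : Type*} [NormedAddCommGroup E] [NormedSpace ℝ E] [FiniteDimensional ℝ E]
  {H : Type*} [TopologicalSpace H] {I : ModelWithCorners ℝ E H} [I.Boundaryless]
  {M : Type*} [TopologicalSpace M] [ChartedSpace H M] [IsManifold I ∞ M] [MulAction G M]
  {E' : Type*} [NormedAddCommGroup E'] [NormedSpace ℝ E'] [FiniteDimensional ℝ E']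
  {H' : Type*} [TopologicalSpace H'] {I' : ModelWithCorners ℝ E' H'} [I'.Boundaryless]
  {N : Type*} [TopologicalSpace N] [ChartedSpace H' N] [IsManifold I' ∞ N]
  {ρ : M → N}

/-- In adapted coordinates, the complementary coordinate is kept at its value at `m`. -/
theorem exists_local_section {m : M} (hρ : Manifold.IsSubmersionAt I I' ∞ ρ m) :
    ∃ s : N → M, s (ρ m) = m ∧ ContMDiffAt I' I ∞ s (ρ m) ∧ ∀ᶠ z in 𝓝 (ρ m), ρ (s z) = z := by
  obtain ⟨p₀, Ψ, Φ, σ, c, hΦ, hΨ, hc, hΨs, hΦs, hcs, h₁, h₂, h₃, h₄, h₅⟩ :=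
    exists_local_parametrization hρ
  have hcont : ContinuousAt (fun z => (c z, p₀.2)) (ρ m) := hcs.continuousAt.prodMk continuousAt_const
  have hp : (c (ρ m), p₀.2) = p₀ := by rw [hc]
  refine ⟨fun z => Ψ (c z, p₀.2), by beta_reduce; rw [hp, hΨ], ?_, ?_⟩
  · refine ContMDiffAt.comp (g := Ψ) (ρ m) (by rwa [hp]) ?_
    exact hcs.prodMk_space contMDiffAt_const
  · have h₆ : ∀ᶠ z in 𝓝 (ρ m), ρ (Ψ (c z, p₀.2)) = σ (c z) :=
      hcont.eventually (p := fun p => ρ (Ψ p) = σ p.1)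
        (by beta_reduce; rwa [hp])
    filter_upwards [h₃, h₆] with z hz hz' using hz'.trans hz

theorem mfderiv_comp_local_section {s : N → M} {m : M} (hρ : MDifferentiableAt I I' ρ m)
    (hs : s (ρ m) = m) (hss : ContMDiffAt I' I ∞ s (ρ m)) (hρs : ∀ᶠ z in 𝓝 (ρ m), ρ (s z) = z)
    (v : E') : (mfderiv I I' ρ m : E →L[ℝ] E') ((mfderiv I' I s (ρ m) : E' →L[ℝ] E) v) = v := by
  have key : ∀ m', m' = m → HasMFDerivAt I I' ρ m' (mfderiv I I' ρ m : E →L[ℝ] E') := by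
    rintro m' rfl; exact hρ.hasMFDerivAt
  have h₁ := HasMFDerivAt.comp (g := ρ) (ρ m) (key _ hs)
    (hss.mdifferentiableAt (by simp)).hasMFDerivAt
  have h₂ : HasMFDerivAt I' I' (ρ ∘ s) (ρ m) (ContinuousLinearMap.id ℝ E') :=
    (hasMFDerivAt_id (I := I') (ρ m)).congr_of_eventuallyEq hρs
  exact DFunLike.congr_fun (hasMFDerivAt_unique h₁ h₂) v

theorem surjective_mfderiv {m : M} (hρ : Manifold.IsSubmersionAt I I' ∞ ρ m) :
    Function.Surjective (mfderiv I I' ρ m) := fun v => by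
  obtain ⟨s, hs, hss, hρs⟩ := exists_local_section hρ
  exact ⟨mfderiv I' I s (ρ m) v, mfderiv_comp_local_section
    (hρ.contMDiffAt.mdifferentiableAt (by simp)) hs hss hρs v⟩

theorem mfderiv_comp_smul (hsm : ContMDiff (IG.prod I) I ∞ (fun p : G × M => p.1 • p.2))
    (hρ : ContMDiff I I' ∞ ρ) (hρG : ∀ m m' : M, ρ m = ρ m' ↔ ∃ g : G, g • m = m') (g : G)
    (m : M) (v : TangentSpace I m) : (mfderiv I I' ρ (g • m) : E →L[ℝ] E')
      (mfderiv I I (fun m : M => g • m) m v) = (mfderiv I I' ρ m : E →L[ℝ] E') v := by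
  have h₁ := HasMFDerivAt.comp (g := ρ) m ((hρ (g • m)).mdifferentiableAt (by simp)).hasMFDerivAt
    ((contMDiff_smul_left hsm g m).mdifferentiableAt (by simp)).hasMFDerivAt
  have h₂ : ρ ∘ (fun m : M => g • m) = ρ := funext fun m => ((hρG m (g • m)).2 ⟨g, rfl⟩).symm
  rw [h₂] at h₁
  exact DFunLike.congr_fun
    (hasMFDerivAt_unique h₁ ((hρ m).mdifferentiableAt (by simp)).hasMFDerivAt) v

theorem mfderiv_infGen (hsm : ContMDiff (IG.prod I) I ∞ (fun p : G × M => p.1 • p.2))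
    (hρ : ContMDiff I I' ∞ ρ) (hρG : ∀ m m' : M, ρ m = ρ m' ↔ ∃ g : G, g • m = m')
    (m : M) (ξ : EG) : mfderiv I I' ρ m (infGen IG G I m ξ) = 0 := by
  have key : ∀ m', m' = m → HasMFDerivAt I I' ρ m' (mfderiv I I' ρ m : E →L[ℝ] E') := by
    rintro m' rfl; exact ((hρ _).mdifferentiableAt (by simp)).hasMFDerivAt
  have h₁ := HasMFDerivAt.comp (g := ρ) (1 : G) (key _ (one_smul G m))
    ((contMDiff_smul_right hsm m 1).mdifferentiableAt (by simp)).hasMFDerivAt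
  have h₂ : ρ ∘ (fun g : G => g • m) = fun _ => ρ m :=
    funext fun g => ((hρG m (g • m)).2 ⟨g, rfl⟩).symm
  rw [h₂] at h₁
  exact DFunLike.congr_fun (hasMFDerivAt_unique h₁ (hasMFDerivAt_const (ρ m) (1 : G))) ξ

/-- The kernel of the derivative of the orbit projection is the vertical space. -/
theorem ker_mfderiv_eq_verticalSpace [SecondCountableTopology G]
    (hsm : ContMDiff (IG.prod I) I ∞ (fun p : G × M => p.1 • p.2))
    (hρ : ContMDiff I I' ∞ ρ) (hρG : ∀ m m' : M, ρ m = ρ m' ↔ ∃ g : G, g • m = m') {m : M}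
    (hsub : Manifold.IsSubmersionAt I I' ∞ ρ m) (hinj : Function.Injective (infGen IG G I m)) :
    LinearMap.ker (mfderiv I I' ρ m).toLinearMap = verticalSpace IG G I m := by
  have hle : verticalSpace IG G I m ≤ LinearMap.ker (mfderiv I I' ρ m).toLinearMap := by
    rintro _ ⟨ξ, rfl⟩
    exact mfderiv_infGen hsm hρ hρG m ξ
  refine (Submodule.eq_of_le_of_finrank_le hle ?_).symm
  have hV : Module.finrank ℝ (verticalSpace IG G I m) = Module.finrank ℝ EG :=
    LinearMap.finrank_range_of_inj (f := (infGen IG G I m).toLinearMap) hinj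
  have hF : FiniteDimensional ℝ hsub.complement := by
    have : FiniteDimensional ℝ (E' × hsub.complement) := hsub.equiv.toLinearEquiv.finiteDimensional
    exact FiniteDimensional.of_surjective (LinearMap.snd ℝ E' hsub.complement) Prod.snd_surjective
  have h₁ : Module.finrank ℝ E = Module.finrank ℝ E' + Module.finrank ℝ hsub.complement := by
    rw [hsub.equiv.toLinearEquiv.finrank_eq, Module.finrank_prod]
  have h₂ : Module.finrank ℝ (LinearMap.range (mfderiv I I' ρ m).toLinearMap) +
      Module.finrank ℝ (LinearMap.ker (mfderiv I I' ρ m).toLinearMap) = Module.finrank ℝ E :=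
    LinearMap.finrank_range_add_finrank_ker (mfderiv I I' ρ m).toLinearMap
  have h₃ : Module.finrank ℝ (LinearMap.range (mfderiv I I' ρ m).toLinearMap) =
      Module.finrank ℝ E' := by
    rw [LinearMap.range_eq_top.2 (surjective_mfderiv hsub), finrank_top]
    rfl
  -- The kernel has the dimension of the complement by rank-nullity, and the vertical space that of
  -- `G`; since one inclusion is known, this inequality is what is left.
  suffices h : Module.finrank ℝ hsub.complement ≤ Module.finrank ℝ EG by omega
  obtain ⟨p₀, Ψ, Φ, σ, c, hΦ, hΨ, hc, hΨs, hΦs, hcs, h₄, h₅, h₆, h₇, h₈⟩ :=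
    exists_local_parametrization hsub
  have hΦU : ∀ᶠ y in 𝓝 m, ContMDiffAt I 𝓘(ℝ, E' × hsub.complement) 1 Φ y :=
    have : IsManifold I 1 M := IsManifold.of_le (n := ∞) (by simp)
    (contMDiffAt_iff_contMDiffAt_nhds (n := 1) (by simp)).1 (hΦs.of_le (by simp))
  have hΨc : ContinuousAt (fun b => Ψ (p₀.1, b)) p₀.2 :=
    ContinuousAt.comp (g := Ψ) hΨs.continuousAt (continuousAt_const.prodMk continuousAt_id)
  have hcont : ContinuousAt (fun b : hsub.complement => (p₀.1, b)) p₀.2 :=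
    continuousAt_const.prodMk continuousAt_id
  set O : Set hsub.complement := {b | ContMDiffAt I 𝓘(ℝ, E' × hsub.complement) 1 Φ (Ψ (p₀.1, b)) ∧
    Φ (Ψ (p₀.1, b)) = (p₀.1, b) ∧ ρ (Ψ (p₀.1, b)) = σ p₀.1} with hO
  have hOn : O ∈ 𝓝 p₀.2 := by
    have ha : ∀ᶠ b in 𝓝 p₀.2, ContMDiffAt I 𝓘(ℝ, E' × hsub.complement) 1 Φ (Ψ (p₀.1, b)) :=
      hΨc.eventually (p := fun y => ContMDiffAt I 𝓘(ℝ, E' × hsub.complement) 1 Φ y)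
        (by change ∀ᶠ y in 𝓝 (Ψ p₀), _; rwa [hΨ])
    exact (ha.and ((hcont.eventually (p := fun p => Φ (Ψ p) = p) h₅).and
      (hcont.eventually (p := fun p => ρ (Ψ p) = σ p.1) h₇)))
  set A : Set G := {g | ContMDiffAt I 𝓘(ℝ, E' × hsub.complement) 1 Φ (g • m)} with hA
  -- The points of `O` parametrize a piece of the fibre of `ρ` through `m`. That fibre is a single
  -- orbit, so `O` is covered by a smooth image of a subset of `G`.
  have hsubset : O ⊆ (fun g : G => (Φ (g • m)).2) '' A := by
    rintro b ⟨hb₁, hb₂, hb₃⟩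
    have hm : ρ m = σ p₀.1 := by
      have := h₇.self_of_nhds
      rwa [hΨ] at this
    obtain ⟨g, hg⟩ := (hρG m (Ψ (p₀.1, b))).1 (hm.trans hb₃.symm)
    refine ⟨g, ?_, ?_⟩
    · change ContMDiffAt I 𝓘(ℝ, E' × hsub.complement) 1 Φ (g • m)
      rwa [hg]
    · change (Φ (g • m)).2 = b
      rw [hg, hb₂]
  have h₉ := (dimH_mono hsubset).trans (dimH_image_le_finrank (I := IG)
    (f := fun g : G => (Φ (g • m)).2) fun g hg =>
      ContMDiffAt.comp (g := Prod.snd) g contDiffAt_snd.contMDiffAt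
        (ContMDiffAt.comp (g := Φ) g hg ((contMDiff_smul_right hsm m g).of_le (by simp))))
  -- Being a neighbourhood, `O` has the full dimension of the complement, which is thus at most that
  -- of `G`.
  rw [Real.dimH_of_mem_nhds hOn] at h₉
  exact_mod_cast h₉

end OrbitProjection

end Nonholonomic

end

noncomputable section

set_option linter.unusedSectionVars false

namespace Nonholonomic

/-! ### Reduction of bivectors and forms -/

section Alternating

variable {E : Type*} [NormedAddCommGroup E] [NormedSpace ℝ E]
  {F : Type*} [NormedAddCommGroup F] [NormedSpace ℝ F]

/-- The arguments are exchanged one at a time; each exchange alters the value by a term with an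
entry in `K`, which a transposition brings to the first slot. -/
theorem alternating_eq_of_sub_mem {k : ℕ} (η : E [⋀^Fin (k + 1)]→L[ℝ] F) {K : Submodule ℝ E}
    (hK : ∀ X ∈ K, ∀ Y : Fin k → E, η (Matrix.vecCons X Y) = 0) {u v : Fin (k + 1) → E}
    (h : ∀ i, u i - v i ∈ K) : η u = η v := by
  have h₀ (w : Fin (k + 1) → E) (i : Fin (k + 1)) (hw : w i ∈ K) : η w = 0 := by
    have h₁ (w : Fin (k + 1) → E) (hw : w 0 ∈ K) : η w = 0 := by
      have := hK (w 0) hw (Matrix.vecTail w)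
      rwa [show Matrix.vecCons (w 0) (Matrix.vecTail w) = w from Matrix.cons_head_tail w] at this
    by_cases hi : i = 0
    · exact h₁ w (hi ▸ hw)
    · have h₂ : η (w ∘ Equiv.swap 0 i) = -η w :=
        η.toAlternatingMap.map_swap w (i := 0) (j := i) (Ne.symm hi)
      rw [h₁ (w ∘ Equiv.swap 0 i) (by simpa using hw)] at h₂
      exact neg_eq_zero.1 h₂.symm
  have h₁ (s : Finset (Fin (k + 1))) : η (s.piecewise u v) = η v := by
    induction s using Finset.induction_on with
    | empty => simp
    | insert i s hi ih =>
      rw [Finset.piecewise_insert, ← ih]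
      have h₂ : s.piecewise u v = Function.update (s.piecewise u v) i (v i) := by
        rw [eq_comm, Function.update_eq_self_iff, Finset.piecewise_eq_of_notMem _ _ _ hi]
      conv_rhs => rw [h₂]
      rw [← sub_eq_zero, ← ContinuousAlternatingMap.map_update_sub]
      exact h₀ _ i (by simpa using h i)
  simpa using h₁ Finset.univ

end Alternating

section Reduction

variable {EG : Type*} [NormedAddCommGroup EG] [NormedSpace ℝ EG] [FiniteDimensional ℝ EG]
  {HG : Type*} [TopologicalSpace HG] {IG : ModelWithCorners ℝ EG HG} [IG.Boundaryless]
  {G : Type*} [TopologicalSpace G] [ChartedSpace HG G] [Group G] [IsManifold IG ∞ G]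
  {E : Type*} [NormedAddCommGroup E] [NormedSpace ℝ E] [FiniteDimensional ℝ E]
  {H : Type*} [TopologicalSpace H] {I : ModelWithCorners ℝ E H} [I.Boundaryless]
  {M : Type*} [TopologicalSpace M] [ChartedSpace H M] [IsManifold I ∞ M] [MulAction G M]
  {E' : Type*} [NormedAddCommGroup E'] [NormedSpace ℝ E'] [FiniteDimensional ℝ E']
  {H' : Type*} [TopologicalSpace H'] {I' : ModelWithCorners ℝ E' H'} [I'.Boundaryless]
  {N : Type*} [TopologicalSpace N] [ChartedSpace H' N] [IsManifold I' ∞ N]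
  {F : Type*} [NormedAddCommGroup F] [NormedSpace ℝ F]
  {ρ : M → N}

theorem DForm.SmoothAt.congr_of_eventuallyEq {k : ℕ} {η θ : DForm I M F k} {x : M}
    (hθ : θ.SmoothAt x) (h : ∀ᶠ y in 𝓝 x, η y = θ y) : η.SmoothAt x := by
  have h₁ : ∀ᶠ y in 𝓝 (extChartAt I x x), η ((extChartAt I x).symm y) =
      θ ((extChartAt I x).symm y) :=
    (continuousAt_extChartAt_symm (I := I) x).eventually (p := fun y => η y = θ y)
      (by rwa [extChartAt_to_inv])
  refine ContDiffAt.congr_of_eventuallyEq hθ ?_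
  filter_upwards [h₁] with y hy
  exact congrArg (fun μ => ContinuousAlternatingMap.compContinuousLinearMap μ
    (mfderiv 𝓘(ℝ, E) I (extChartAt I x).symm y)) hy

/-- A form on the base is smooth if its pullback under a surjective submersion is. -/
theorem DForm.isSmooth_of_pullback {k : ℕ} (hρ : ∀ m, Manifold.IsSubmersionAt I I' ∞ ρ m)
    (hρs : Function.Surjective ρ) {φ : DForm I' N F k}
    (h : (DForm.pullback I I' ρ φ).IsSmooth) : φ.IsSmooth := by
  refine DForm.isSmooth_iff.2 fun z => ?_
  obtain ⟨m, rfl⟩ := hρs z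
  obtain ⟨s, hs, hss, hρs⟩ := exists_local_section (hρ m)
  -- Near the point, `φ` is the pullback of `ρ^* φ` along a smooth local section.
  refine DForm.SmoothAt.congr_of_eventuallyEq
    (DForm.SmoothAt.pullback (f := s) (h.smoothAt (s (ρ m))) hss) ?_
  have hs1 : ∀ᶠ z in 𝓝 (ρ m), ContMDiffAt I' I 1 s z :=
    have : IsManifold I 1 M := IsManifold.of_le (n := ∞) (by simp)
    have : IsManifold I' 1 N := IsManifold.of_le (n := ∞) (by simp)
    (contMDiffAt_iff_contMDiffAt_nhds (n := 1) (by simp)).1 (hss.of_le (by simp))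
  filter_upwards [hs1, eventually_eventually_nhds.2 hρs] with z hz hzs
  have h₁ := HasMFDerivAt.comp (g := ρ) z
    (((hρ (s z)).contMDiffAt.mdifferentiableAt (by simp)).hasMFDerivAt)
    (hz.mdifferentiableAt (by simp)).hasMFDerivAt
  have h₂ : HasMFDerivAt I' I' (ρ ∘ s) z (ContinuousLinearMap.id ℝ E') :=
    (hasMFDerivAt_id (I := I') z).congr_of_eventuallyEq hzs
  have h₃ := hasMFDerivAt_unique h₁ h₂
  have key : ∀ z', z' = z → ∀ v : Fin k → E', φ z' v = φ z v := by rintro z' rfl v; rfl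
  ext v
  refine (key _ hzs.self_of_nhds v).symm.trans ?_
  exact congrArg (φ (ρ (s z))) (funext fun i => (DFunLike.congr_fun h₃ (v i)).symm)

/-- Pullback along a surjective submersion is injective on forms and commutes with `d`. -/
theorem DForm.d_eq_zero_of_pullback {k : ℕ} (hρ : ∀ m, Manifold.IsSubmersionAt I I' ∞ ρ m)
    (hρs : Function.Surjective ρ) {φ : DForm I' N F k} (hφ : φ.IsSmooth)
    (h : (DForm.pullback I I' ρ φ).d = 0) (z : N) : φ.d z = 0 := by
  obtain ⟨m, rfl⟩ := hρs z
  have h₁ := (DForm.d_pullback (hφ.smoothAt (ρ m)) (hρ m).contMDiffAt).symm.trans (congrFun h m)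
  ext v
  choose u hu using surjective_mfderiv (hρ m)
  refine Eq.trans ?_ (DFunLike.congr_fun h₁ fun i => u (v i))
  exact congrArg (φ.d (ρ m)) (funext fun i => (hu (v i)).symm)

/-- Basic forms descend to the orbit space. -/
theorem DForm.exists_of_isBasic {k : ℕ}
    (hsm : ContMDiff (IG.prod I) I ∞ (fun p : G × M => p.1 • p.2))
    (hρ : ∀ m, Manifold.IsSubmersionAt I I' ∞ ρ m) (hρs : Function.Surjective ρ)
    (hρG : ∀ m m' : M, ρ m = ρ m' ↔ ∃ g : G, g • m = m')
    (hker : ∀ m, LinearMap.ker (mfderiv I I' ρ m).toLinearMap = verticalSpace IG G I m)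
    {η : DForm I M ℝ (k + 1)} (hη : DForm.IsBasic IG G η) :
    ∃ φ : DForm I' N ℝ (k + 1), DForm.pullback I I' ρ φ = η := by
  have hρc : ContMDiff I I' ∞ ρ := fun m => (hρ m).contMDiffAt
  choose s hs using hρs
  have hR (z : N) : ∃ R : E' →L[ℝ] E, ∀ v, (mfderiv I I' ρ (s z) : E →L[ℝ] E') (R v) = v := by
    obtain ⟨t, ht, hts, hρt⟩ := exists_local_section (hρ (s z))
    exact ⟨mfderiv I' I t (ρ (s z)), mfderiv_comp_local_section
      ((hρc _).mdifferentiableAt (by simp)) ht hts hρt⟩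
  choose R hR using hR
  -- The fibre point `s z` and the right inverse `R z` are arbitrary choices without continuity.
  -- Invariance compares different points of a fibre, and horizontality compares different lifts of
  -- a vector.
  refine ⟨fun z => (η (s z) : E [⋀^Fin (k + 1)]→L[ℝ] ℝ).compContinuousLinearMap (R z), ?_⟩
  funext m
  ext v
  obtain ⟨g, hg⟩ := (hρG m (s (ρ m))).1 (hs (ρ m)).symm
  have h₁ : η m v = η (g • m) (fun i => mfderiv I I (fun m : M => g • m) m (v i)) :=
    (DFunLike.congr_fun (congrFun (hη.1 g) m) v).symm
  rw [h₁]
  have key : ∀ m', m' = g • m → ∀ u : Fin (k + 1) → E,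
      (∀ i, (mfderiv I I' ρ m' : E →L[ℝ] E') (u i) =
        (mfderiv I I' ρ (g • m) : E →L[ℝ] E') (mfderiv I I (fun m : M => g • m) m (v i))) →
      η m' u = η (g • m) (fun i => mfderiv I I (fun m : M => g • m) m (v i)) := by
    rintro m' rfl u hu
    refine alternating_eq_of_sub_mem (E := E) (η (g • m))
      (K := verticalSpace IG G I (g • m)) (hη.2 (g • m)) fun i => ?_
    rw [← hker]
    exact (map_sub (mfderiv I I' ρ (g • m) : E →L[ℝ] E') _ _).trans (sub_eq_zero.2 (hu i))
  refine key (s (ρ m)) hg.symm _ fun i => ?_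
  exact (hR (ρ m) _).trans (mfderiv_comp_smul hsm hρc hρG g m (v i)).symm

/-- Invariant bivector fields descend to the orbit space. -/
theorem exists_reduced_bivector
    (hsm : ContMDiff (IG.prod I) I ∞ (fun p : G × M => p.1 • p.2))
    (hρ : ∀ m, Manifold.IsSubmersionAt I I' ∞ ρ m) (hρs : Function.Surjective ρ)
    (hρG : ∀ m m' : M, ρ m = ρ m' ↔ ∃ g : G, g • m = m') (π : BivectorField I M)
    (hπ : ∀ (g : G) (m : M) (α : Covector I (g • m)), π.sharp (g • m) α =
      mfderiv I I (fun m : M => g • m) m (π.sharp m (α ∘L mfderiv I I (fun m : M => g • m) m))) :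
    ∃ σ : BivectorField I' N, ∀ m, SharpMap.RelatedAt ρ π.sharp σ.sharp m := by
  have hρc : ContMDiff I I' ∞ ρ := fun m => (hρ m).contMDiffAt
  choose s hs using hρs
  -- The bivector is pushed forward from an arbitrarily chosen point of each fibre. Invariance makes
  -- the result independent of the choice, and smoothness is read off afterwards along smooth local
  -- sections.
  set σ : SharpMap I' N := fun z => (mfderiv I I' ρ (s z) : E →L[ℝ] E') ∘L
    (π.sharp (s z) : (E →L[ℝ] ℝ) →L[ℝ] E) ∘L
      (ContinuousLinearMap.precomp ℝ (mfderiv I I' ρ (s z) : E →L[ℝ] E')) with hσ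
  have hrel (m : M) : SharpMap.RelatedAt ρ π.sharp σ m := by
    intro β
    obtain ⟨g, hg⟩ := (hρG m (s (ρ m))).1 (hs (ρ m)).symm
    have key : ∀ m', m' = g • m → (mfderiv I I' ρ m' : E →L[ℝ] E')
        (π.sharp m' ((β : E' →L[ℝ] ℝ) ∘L (mfderiv I I' ρ m' : E →L[ℝ] E'))) =
          (mfderiv I I' ρ m : E →L[ℝ] E') (π.sharp m (β ∘L mfderiv I I' ρ m)) := by
      rintro m' rfl
      refine (congrArg (mfderiv I I' ρ (g • m)) (hπ g m _)).trans ?_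
      refine (mfderiv_comp_smul hsm hρc hρG g m _).trans ?_
      refine congrArg (fun γ : Covector I m =>
        (mfderiv I I' ρ m : E →L[ℝ] E') (π.sharp m γ)) ?_
      ext v
      exact congrArg (β : E' →L[ℝ] ℝ) (mfderiv_comp_smul hsm hρc hρG g m v)
    exact key _ hg.symm
  refine ⟨⟨σ, fun z α β => ?_, fun z₁ z hz => ?_⟩, hrel⟩
  · exact π.skew (s z) ((α : E' →L[ℝ] ℝ) ∘L (mfderiv I I' ρ (s z) : E →L[ℝ] E'))
      ((β : E' →L[ℝ] ℝ) ∘L (mfderiv I I' ρ (s z) : E →L[ℝ] E'))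
  · obtain ⟨m, hm⟩ : ∃ m, ρ m = (extChartAt I' z₁).symm z := ⟨_, hs _⟩
    have hmz : ρ m ∈ (extChartAt I' z₁).source := by
      rw [hm]; exact (extChartAt I' z₁).map_target hz
    obtain ⟨t, ht, hts, hρt⟩ := exists_local_section (hρ m)
    have h₁ := SharpMap.contDiffAt_of_related (σ := σ) (f := ρ) hmz (π.smoothAt (t (ρ m))) hts
      (hρc _) hρt (Filter.Eventually.of_forall fun z => hrel (t z))
    rw [hm, (extChartAt I' z₁).right_inv hz] at h₁
    exact h₁.contDiffWithinAt

end Reduction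

end Nonholonomic

end

noncomputable section

set_option linter.unusedSectionVars false

namespace Nonholonomic

/-! ### Invariance -/

section Invariance

variable {EG : Type*} [NormedAddCommGroup EG] [NormedSpace ℝ EG] [FiniteDimensional ℝ EG]
  {HG : Type*} [TopologicalSpace HG] {IG : ModelWithCorners ℝ EG HG} [IG.Boundaryless]
  {G : Type*} [TopologicalSpace G] [ChartedSpace HG G] [Group G] [IsManifold IG ∞ G]
  {E : Type*} [NormedAddCommGroup E] [NormedSpace ℝ E] [FiniteDimensional ℝ E]
  {H : Type*} [TopologicalSpace H] {I : ModelWithCorners ℝ E H} [I.Boundaryless]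
  {M : Type*} [TopologicalSpace M] [ChartedSpace H M] [IsManifold I ∞ M] [MulAction G M]
  {E' : Type*} [NormedAddCommGroup E'] [NormedSpace ℝ E'] [FiniteDimensional ℝ E']
  {H' : Type*} [TopologicalSpace H'] {I' : ModelWithCorners ℝ E' H'} [I'.Boundaryless]
  {N : Type*} [TopologicalSpace N] [ChartedSpace H' N] [IsManifold I' ∞ N]
  {C W : Distribution I M} {S : Submodule ℝ EG}

theorem DForm.IsInvariant.neg {k : ℕ} {η : DForm I M ℝ k} (hη : DForm.IsInvariant G η) :
    DForm.IsInvariant G (-η) := fun g => by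
  conv_rhs => rw [← hη g]
  rfl

theorem DForm.IsInvariant.sub {k : ℕ} {η θ : DForm I M ℝ k} (hη : DForm.IsInvariant G η)
    (hθ : DForm.IsInvariant G θ) : DForm.IsInvariant G (η - θ) := fun g => by
  conv_rhs => rw [← hη g, ← hθ g]
  rfl

theorem DForm.IsInvariant.d {k : ℕ} {η : DForm I M ℝ k} (hη : DForm.IsInvariant G η)
    (hsm : ContMDiff (IG.prod I) I ∞ (fun p : G × M => p.1 • p.2)) (hs : η.IsSmooth) :
    DForm.IsInvariant G η.d := fun g => by
  funext m
  rw [← DForm.d_pullback (hs.smoothAt _) (contMDiff_smul_left hsm g m), hη g]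

theorem VerticalSplitting.isInvariant_horizontal (hS : VerticalSplitting IG G C W S) {k : ℕ}
    {η : DForm I M ℝ k} (hη : DForm.IsInvariant G η) :
    DForm.IsInvariant G (η.horizontal C W) := fun g => by
  funext m
  ext v
  refine Eq.trans ?_ (DFunLike.congr_fun (congrFun (hη g) m) fun i => proj C W m (v i))
  exact congrArg (η (g • m)) (funext fun i => hS.proj_smul g m (v i))

/-- The translated bivector inverts the same invariant form on `C`, and nondegeneracy makes the
inverse unique. -/
theorem SharpMap.Inverts.smul {π : SharpMap I M} {ζ : DForm I M ℝ 2} (hπ : π.Inverts C W ζ)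
    (hS : VerticalSplitting IG G C W S)
    (hsm : ContMDiff (IG.prod I) I ∞ (fun p : G × M => p.1 • p.2)) (hζ : DForm.IsInvariant G ζ)
    (g : G) (m : M) (α : Covector I (g • m)) : π (g • m) α =
      mfderiv I I (fun m : M => g • m) m (π m (α ∘L mfderiv I I (fun m : M => g • m) m)) := by
  set T : TangentSpace I m →L[ℝ] TangentSpace I (g • m) := mfderiv I I (fun m : M => g • m) m
  have hζT (u v : TangentSpace I m) : ζ (g • m) ![T u, T v] = ζ m ![u, v] := by
    refine Eq.trans ?_ (DFunLike.congr_fun (congrFun (hζ g) m) ![u, v])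
    refine congrArg (ζ (g • m)) ?_
    ext i; fin_cases i <;> rfl
  have hC := hS.map_C g m _ (hπ.mem m (α ∘L T))
  refine sub_eq_zero.1 (hπ.eq_zero (g • m) _ ((C (g • m)).sub_mem (hπ.mem _ _) hC) fun v hv => ?_)
  obtain ⟨w, rfl⟩ : ∃ w, T w = v :=
    ⟨_, mfderiv_smul_inv_smul (fun g => contMDiff_smul_left hsm g) g m v⟩
  have h₁ := DForm.add_left ζ (g • m) (π (g • m) α - T (π m (α ∘L T))) (T (π m (α ∘L T))) (T w)
  rw [sub_add_cancel, hζT, hπ.apply, hπ.apply, hS.proj_smul] at h₁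
  exact right_eq_add.1 h₁

/-- Each term evaluates a pulled-back covector on a generator, which is tangent to a fibre of `ρ`.
This is why the non-Jacobi term `psi` does not reach the quotient. -/
theorem psi_comp_eq_zero {π : SharpMap I M} {ρ : M → N}
    (hsm : ContMDiff (IG.prod I) I ∞ (fun p : G × M => p.1 • p.2))
    (hρ : ContMDiff I I' ∞ ρ) (hρG : ∀ m m' : M, ρ m = ρ m' ↔ ∃ g : G, g • m = m') (m : M)
    (α β γ : Covector I' (ρ m)) : psi IG G C W π m (α ∘L mfderiv I I' ρ m)
      (β ∘L mfderiv I I' ρ m) (γ ∘L mfderiv I I' ρ m) = 0 := by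
  have h (α : Covector I' (ρ m)) (ξ : EG) :
      (α ∘L mfderiv I I' ρ m) (infGen IG G I m ξ) = 0 :=
    (congrArg α (mfderiv_infGen hsm hρ hρG m ξ)).trans (map_zero α)
  unfold psi
  rw [h, h, h, add_zero, add_zero]

theorem onForm_three (π : SharpMap I M) (η : DForm I M ℝ 3) (m : M) (α β γ : Covector I m) :
    π.onForm η m ![α, β, γ] = -η m ![π m α, π m β, π m γ] := by
  have : (fun i => π m ((![α, β, γ] : Fin 3 → Covector I m) i)) = ![π m α, π m β, π m γ] := by
    ext i; fin_cases i <;> rfl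
  unfold SharpMap.onForm
  rw [this]
  ring

/-- The twisted Poisson structure on the orbit space. -/
theorem exists_isTwistedPoisson {ρ : M → N}
    (hsm : ContMDiff (IG.prod I) I ∞ (fun p : G × M => p.1 • p.2))
    (hρ : ∀ m, Manifold.IsSubmersionAt I I' ∞ ρ m) (hρs : Function.Surjective ρ)
    (hρG : ∀ m m' : M, ρ m = ρ m' ↔ ∃ g : G, g • m = m')
    (hker : ∀ m, LinearMap.ker (mfderiv I I' ρ m).toLinearMap = verticalSpace IG G I m)
    {π : SharpMap I M} {σ : BivectorField I' N}
    (hrel : ∀ m, SharpMap.RelatedAt ρ π σ.sharp m) {η : DForm I M ℝ 3} (hη : η.IsSmooth)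
    (hdη : η.d = 0) (hηb : DForm.IsBasic IG G η)
    (hσ : ∀ (m : M) (α β γ : Covector I' (ρ m)), (1 / 2 : ℝ) * schouten σ σ (ρ m) α β γ =
      -(π.onForm η m ![α ∘L mfderiv I I' ρ m, β ∘L mfderiv I I' ρ m, γ ∘L mfderiv I I' ρ m])) :
    ∃ φ : DForm I' N ℝ 3, DForm.pullback I I' ρ φ = -η ∧ IsTwistedPoisson σ φ := by
  obtain ⟨φ, hφ⟩ := DForm.exists_of_isBasic hsm hρ hρs hρG hker hηb
  have hφs : φ.IsSmooth := DForm.isSmooth_of_pullback hρ hρs (hφ ▸ hη)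
  have hdφ (z : N) : φ.d z = 0 := DForm.d_eq_zero_of_pullback hρ hρs hφs (hφ ▸ hdη) z
  -- `φ` descends from `η` itself, so the twisting form is its negative; in the last goal the sign
  -- `(-1)^3` of `SharpMap.onForm` enters on both sides.
  refine ⟨-φ, ?_, hφs.neg, fun z => ?_, fun z α β γ => ?_⟩
  · rw [← hφ]; rfl
  · rw [DForm.d_neg, Pi.neg_apply, hdφ, neg_zero]
  · obtain ⟨m, rfl⟩ := hρs z
    rw [hσ, onForm_three, onForm_three, neg_neg, Pi.neg_apply, ContinuousAlternatingMap.neg_apply,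
      neg_neg]
    rw [hrel m α, hrel m β, hrel m γ, ← hφ]
    refine congrArg (φ (ρ m)) ?_
    ext i; fin_cases i <;> rfl

end Invariance

end Nonholonomic

end

/-! ### Assembly for the nonholonomic system -/

open Nonholonomic in
theorem mainTheorem5 {n k d e : ℕ}
    -- the configuration manifold
    {Q : Type*} [TopologicalSpace Q] [T2Space Q] [SecondCountableTopology Q]
    [ChartedSpace (EuclideanSpace ℝ (Fin n)) Q] [IsManifold (𝓡 n) ∞ Q]
    -- the symmetry group, acting smoothly, freely and properly
    {G : Type*} [Group G] [TopologicalSpace G]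
    [ChartedSpace (EuclideanSpace ℝ (Fin k)) G] [LieGroup (𝓡 k) ∞ G]
    [MulAction G Q] [ContMDiffSMul (𝓡 k) (𝓡 n) ∞ G Q] [ProperSMul G Q]
    (hfree : ∀ (g : G) (q : Q), g • q = q → g = 1)
    -- the nonholonomic system, with invariant Lagrangian and constraints
    (κ : Bundle.ContMDiffRiemannianMetric (𝓡 n) ∞ (EuclideanSpace ℝ (Fin n))
      (TangentSpace (𝓡 n) : Q → Type _))
    (U : Q → ℝ) (hU : ContMDiff (𝓡 n) 𝓘(ℝ, ℝ) ∞ U)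
    (hL : ∀ (g : G) (v : TangentBundle (𝓡 n) Q),
      lagrangian κ U ⟨g • v.1, mfderiv (𝓡 n) (𝓡 n) (fun q : Q => g • q) v.1 v.2⟩ =
        lagrangian κ U v)
    (D : Distribution (𝓡 n) Q) (hD : D.IsRegular) (hDinv : D.IsInvariant G)
    -- the embedded submanifold `ι : M → T^*Q` with image `Leg(D)` and the lifted action on it
    {M : Type*} [TopologicalSpace M] [ChartedSpace (EuclideanSpace ℝ (Fin d)) M]
    [IsManifold (𝓡 d) ∞ M]
    (ι : M → CotangentBundle (𝓡 n) Q)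
    (hι : Manifold.IsSmoothEmbedding (𝓡 d) (cotangentModel (𝓡 n)) ∞ ι)
    (hιD : Set.range ι = constraintSet κ D)
    [MulAction G M] (hact : ∀ (g : G) (m : M), ι (g • m) = cotangentLift g (ι m))
    -- the orbit projection `ρ : M → N = M/G`
    {N : Type*} [TopologicalSpace N] [ChartedSpace (EuclideanSpace ℝ (Fin e)) N]
    [IsManifold (𝓡 e) ∞ N]
    (ρ : M → N) (hρ : Manifold.IsSubmersion (𝓡 d) (𝓡 e) ∞ ρ) (hρs : Function.Surjective ρ)
    (hρG : ∀ m m' : M, ρ m = ρ m' ↔ ∃ g : G, g • m = m')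
    -- the dimension assumption
    (hdim : ∀ m : M,
      constraintDistribution (𝓡 d) D ι m ⊔ verticalSpace (𝓡 k) G (𝓡 d) m = ⊤)
    -- the invariant vertical complement and the vertical-symmetry condition
    (W : Distribution (𝓡 d) M)
    (hW : IsInvariantVerticalComplement (𝓡 k) G (constraintDistribution (𝓡 d) D ι) W)
    (gW : LieSubalgebra ℝ (GroupLieAlgebra (𝓡 k) G))
    (hgW : ∀ m : M, (W m : Set (TangentSpace (𝓡 d) m)) =
      {v | ∃ ξ ∈ gW, v = infGen (𝓡 k) G (𝓡 d) m ξ}) :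
    let C : Distribution (𝓡 d) M := constraintDistribution (𝓡 d) D ι
    let J : M → (EuclideanSpace ℝ (Fin k) →L[ℝ] ℝ) := momentum (𝓡 d) (𝓡 k) G ι
    let K : DForm (𝓡 d) M (EuclideanSpace ℝ (Fin k)) 2 := curvature (𝓡 k) G C W
    let πnh : SharpMap (𝓡 d) M := nonholonomicSharp (𝓡 d) D ι
    -- `dJ ∧ K_W = d⟨J, K_W⟩` on `C`
    (∀ (m : M), ∀ X ∈ C m, ∀ Y ∈ C m, ∀ Z ∈ C m,
      dWedge J K m X Y Z = (pairing J K).d m ![X, Y, Z]) ∧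
    ∀ B : DForm (𝓡 d) M ℝ 2, B.IsSmooth →
      (∀ (m : M), ∀ Z ∈ W m, ∀ Y : TangentSpace (𝓡 d) m, B m ![Z, Y] = 0) →
      (∀ m : M, (gaugeEndo πnh B m).IsInvertible) →
      ∃ πB : BivectorField (𝓡 d) M, πB.sharp = gauge πnh B ∧
        -- the Jacobiator of `π_B`
        (∀ (m : M) (α β γ : Covector (𝓡 d) m),
          (1 / 2 : ℝ) * schouten πB πB m α β γ =
            -(πB.sharp.onForm (B.d + (pairing J K).d) m ![α, β, γ]) -
              psi (𝓡 k) G C W πB.sharp m α β γ) ∧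
        (DForm.IsInvariant G B →
          -- the reduced bivector field on `M/G` and its Jacobiator
          ∃ πred : BivectorField (𝓡 e) N,
            (∀ (m : M) (α : Covector (𝓡 e) (ρ m)),
              πred.sharp (ρ m) α =
                mfderiv (𝓡 d) (𝓡 e) ρ m (πB.sharp m (α ∘L mfderiv (𝓡 d) (𝓡 e) ρ m))) ∧
            (∀ (m : M) (α β γ : Covector (𝓡 e) (ρ m)),
              (1 / 2 : ℝ) * schouten πred πred (ρ m) α β γ =
                -(πB.sharp.onForm (B.d + (pairing J K).d) m
                  ![α ∘L mfderiv (𝓡 d) (𝓡 e) ρ m, β ∘L mfderiv (𝓡 d) (𝓡 e) ρ m,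
                    γ ∘L mfderiv (𝓡 d) (𝓡 e) ρ m])) ∧
            -- the twisted Poisson property
            (DForm.IsBasic (𝓡 k) G (B.d + (pairing J K).d) →
              ∃ φ : DForm (𝓡 e) N ℝ 3,
                DForm.pullback (𝓡 d) (𝓡 e) ρ φ = -(B.d + (pairing J K).d) ∧
                IsTwistedPoisson πred φ)) := by
  intro C J K πnh
  have hsmQ : ContMDiff ((𝓡 k).prod (𝓡 n)) (𝓡 n) ∞ (fun p : G × Q => p.1 • p.2) :=
    ContMDiffSMul.contMDiff_smul
  have hsm : ContMDiff ((𝓡 k).prod (𝓡 d)) (𝓡 d) ∞ (fun p : G × M => p.1 • p.2) :=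
    contMDiff_lifted_smul hsmQ hι hact
  have hfreeM (g : G) (m : M) (h : g • m = m) : g = 1 := by
    refine hfree g (ι m).1 ?_
    have h₁ := congrArg (fun p : CotangentBundle (𝓡 n) Q => p.1) (hact g m)
    rw [h] at h₁
    exact h₁.symm
  have hproj : ContMDiff (𝓡 d) (𝓡 n) ∞ (fun m : M => (ι m).1) := fun m =>
    (contMDiffAt_cotangent_iff.1 (hι.contMDiff m)).1
  have hC : C.IsLocallyKer (EuclideanSpace ℝ (Fin n)) := hD.isLocallyKer.comap hproj
  set S : Submodule ℝ (EuclideanSpace ℝ (Fin k)) := gW.toSubmodule with hSdef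
  have hS : VerticalSplitting (𝓡 k) G C W S :=
    { isCompl := hW.isCompl
      mem_iff := fun m v => by
        have h : v ∈ W m ↔ v ∈ {v | ∃ ξ ∈ gW, v = infGen (𝓡 k) G (𝓡 d) m ξ} :=
          Set.ext_iff.1 (hgW m) v
        exact h.trans (exists_congr fun ξ => and_congr Iff.rfl eq_comm)
      injective := infGen_injective hsm hfreeM
      map_C := fun g m v hv => constraintDistribution_smul hsmQ hι hact hDinv g m hv
      map_W := fun g m v hv => hW.invariant g m ▸ Submodule.mem_map_of_mem hv }
  -- The restricted Liouville form as a family of covectors; with this choice `momentumOf` is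
  -- definitionally the momentum map of the statement.
  set θ : (m : M) → Covector (𝓡 d) m := fun m =>
    (ContinuousAlternatingMap.ofSubsingleton ℝ (TangentSpace (𝓡 d) m) ℝ (0 : Fin 1)).symm
      (thetaM (𝓡 d) ι m) with hθdef
  have hθeq : oneForm θ = thetaM (𝓡 d) ι := funext fun m => Equiv.apply_symm_apply _ _
  have hθ : (oneForm θ).IsSmooth := by
    rw [hθeq]
    exact DForm.isSmooth_iff.2 (thetaM_smoothAt hι.contMDiff)
  have hinv (g : G) (m : M) (u : TangentSpace (𝓡 d) m) :
      θ (g • m) (mfderiv (𝓡 d) (𝓡 d) (fun m : M => g • m) m u) = θ m u :=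
    thetaM_smul hsmQ hι hact g m u
  have hΩ : omegaM (𝓡 d) ι = -(oneForm θ).d := by rw [hθeq, omegaM_eq hι.contMDiff]
  have hnd (m : M) : ∀ u ∈ C m, (∀ v ∈ C m, omegaM (𝓡 d) ι m ![u, v] = 0) → u = 0 :=
    fun u hu huv => omegaM_nondegenerate hι hιD hD hu huv
  refine ⟨fun m X hX Y hY Z hZ => hS.dWedge_eq hsm hC hθ hX hY hZ, fun B hB hBW hBinv => ?_⟩
  -- From here on `π_B` enters only through the two-form that it inverts.
  have hπ : (gauge πnh B).Inverts C W ((omegaM (𝓡 d) ι).horizontal C W - B) :=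
    inverts_gauge hS.isCompl hnd hBW hBinv
  have hΩs : (omegaM (𝓡 d) ι).IsSmooth := by rw [hΩ]; exact hθ.d.neg
  have hΩh : ((omegaM (𝓡 d) ι).horizontal C W).IsSmooth := DForm.isSmooth_iff.2 fun m =>
    hS.smoothAt_horizontal hsm hC (hΩs.smoothAt m)
  have hζ : ((omegaM (𝓡 d) ι).horizontal C W - B).IsSmooth := hΩh.sub hB
  have hJK : (pairing J K).IsSmooth := hS.isSmooth_pairing hsm hC hθ
  -- The differential of the horizontal part of `Ω_M` is `-d⟨J, K⟩`; together with `-dB` this gives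
  -- the form appearing in the Jacobiator.
  have hdζ (m : M) : ((omegaM (𝓡 d) ι).horizontal C W - B).d m =
      -(B.d + (pairing J K).d) m := by
    have h₁ := hS.d_horizontal_d hsm hC hθ hinv m
    rw [DForm.d_sub (hΩh.smoothAt m) (hB.smoothAt m), hΩ, h₁]
    exact (neg_add' ((pairing J K).d m) (B.d m)).symm.trans (congrArg Neg.neg (add_comm _ _))
  set πB : BivectorField (𝓡 d) M :=
    { sharp := gauge πnh B
      skew := hπ.skew hS.isCompl
      smooth := SharpMap.contDiffOn_inChart (hπ.smoothAt hS hsm hC hζ) } with hπB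
  have hjac (m : M) (α β γ : Covector (𝓡 d) m) : (1 / 2 : ℝ) * schouten πB πB m α β γ =
      -(πB.sharp.onForm (B.d + (pairing J K).d) m ![α, β, γ]) -
        psi (𝓡 k) G C W πB.sharp m α β γ := by
    rw [hπ.half_schouten hS hsm hC hζ πB rfl, hdζ, onForm_three]
    rfl
  refine ⟨πB, rfl, hjac, fun hBG => ?_⟩
  have hΩG : DForm.IsInvariant G (omegaM (𝓡 d) ι) := by
    have h₁ : DForm.IsInvariant G (oneForm θ) := fun g =>
      funext fun m => DForm.ext₁ fun u => hinv g m u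
    rw [hΩ]
    exact (h₁.d hsm hθ).neg
  have hζG := (hS.isInvariant_horizontal hΩG).sub hBG
  have hsub (m : M) := hρ.isSubmersionAt m
  obtain ⟨πred, hrel⟩ := exists_reduced_bivector hsm hsub hρs hρG πB (hπ.smul hS hsm hζG)
  have hred (m : M) (α β γ : Covector (𝓡 e) (ρ m)) :
      (1 / 2 : ℝ) * schouten πred πred (ρ m) α β γ =
        -(πB.sharp.onForm (B.d + (pairing J K).d) m
          ![α ∘L mfderiv (𝓡 d) (𝓡 e) ρ m, β ∘L mfderiv (𝓡 d) (𝓡 e) ρ m,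
            γ ∘L mfderiv (𝓡 d) (𝓡 e) ρ m]) := by
    rw [half_schouten_related (hρ.contMDiff m) hrel, hjac, psi_comp_eq_zero hsm hρ.contMDiff hρG,
      sub_zero]
  refine ⟨πred, hrel, hred, fun hbasic => ?_⟩
  have hker (m : M) : LinearMap.ker (mfderiv (𝓡 d) (𝓡 e) ρ m).toLinearMap =
      verticalSpace (𝓡 k) G (𝓡 d) m := by
    -- The dimension count for the kernel needs `G` to be second countable, which comes from the
    -- free and proper action on `Q`.
    have := secondCountable_of_properSMul (G := G) hfree (ι m).1
    exact ker_mfderiv_eq_verticalSpace hsm hρ.contMDiff hρG (hsub m) (hS.injective m)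
  have hη : (B.d + (pairing J K).d).IsSmooth := hB.d.add hJK.d
  have hdη : (B.d + (pairing J K).d).d = 0 := by
    funext m
    rw [DForm.d_add (hB.d.smoothAt m) (hJK.d.smoothAt m), DForm.d_d hB, DForm.d_d hJK]
    exact add_zero _
  exact exists_isTwistedPoisson hsm hsub hρs hρG hker hrel hη hdη hbasic hred
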